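/- Let $G_{n,2}$ be the Grassmann manifold of $2$-dimensional complex subspaces of $\mathbb C^n$, with the canonical actions of $T^n\subset(\mathbb C^*)^n$, Plücker coordinates $P^I(L)$ ($I=\{i<j\}\subset\{1,\dots,n\}$), the symplectic form $\Omega$ that is the pullback of the Fubini–Study form (suitably normalised) under the Plücker embedding, and the moment map $$\mu(L)=\frac{\sum_I|P^I(L)|^2\Lambda_I}{\sum_I|P^I(L)|^2}\in\Delta_{n,2}=\operatorname{conv}\{\Lambda_I\},\qquad \Lambda_{\{i,j\}}=e_i+e_j .$$ For a set $\sigma$ of $2$-subsets let $W_\sigma=\{L: P^I(L)\ne0\iff I\in\sigma\}$ and $P_\sigma=\operatorname{conv}\{\Lambda_I: I\in\sigma\}$; call $\sigma$ admissible if $W_\sigma\neq\emptyset$. A chamber $C_\omega$, for a set $\omega$ of admissible $\sigma$, is a nonempty subset of $\Delta_{n,2}$ such that $C_\omega=\Delta_{n,2}\cap\bigcap_{\sigma\in\omega}\mathring P_\sigma$ and $C_\omega\cap\mathring P_\sigma=\emptyset$ for every admissible $\sigma\notin\omega$, where $\mathring P_\sigma$ is the relative interior. Its space of parameters is the quotient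 space $F_\omega=\bigl(\bigcup_{\sigma\in\omega}W_\sigma\bigr)/(\mathbb C^*)^n$, that is, the union of the orbit spaces $W_\sigma/(\mathbb C^*)^n$, $\sigma\in\omega$. **Theorem.** Let $C_\omega\subset\Delta_{n,2}$ be a chamber with $\dim C_\omega=n-1$. Then $F_\omega$ is a smooth manifold (of real dimension $2(n-3)$, Hausdorff and second countable) which is the symplectic reduction of $G_{n,2}$ by the canonical $T^n$-action at every $\mathbf x\in C_\omega$. Precisely, there is a smooth structure on $F_\omega$ such that for every $\mathbf x\in C_\omega$: 1. $\Omega$ is a symplectic form, invariant under the smooth action of $T^n$, and the action is Hamiltonian with proper moment map $\mu$ (with the convention $\Omega(X_v,Y)=d\langle\mu,v\rangle(Y)$); 2. $\mathbf x$ is a regular value of $\mu$ (as a map to the affine span of its image), the diagonal circle acts trivially on $G_{n,2}$, and $T^{n-1}=T^n/\operatorname{diag}(T^n)$ acts freely on $\mu^{-1}(\mathbf x)$; 3. $\mu^{-1}(\mathbf x)$ is an embedded smooth submanifold of dimension $3n-7$, and $\mu^{-1}(\mathbf x)/T^{n-1}$ is a smooth manifold (Hausdorff, second countable) such that the projection $\pi:\mu^{-1}(\mathbf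 x)\to\mu^{-1}(\mathbf x)/T^{n-1}$ is a smooth submersion, with a symplectic form $\hat\Omega$ such that $\pi^*\hat\Omega=i^*\Omega$, where $i:\mu^{-1}(\mathbf x)\to G_{n,2}$ is the inclusion; 4. $\mu^{-1}(\mathbf x)\subset\bigcup_{\sigma\in\omega}W_\sigma$, and this inclusion induces a diffeomorphism $\mu^{-1}(\mathbf x)/T^{n-1}\to F_\omega$. -/

import Mathlib

open scoped Manifold ContDiff

noncomputable section

namespace SymplecticReduction

/-! ### Symplectic forms, Hamiltonian torus actions and symplectic reduction

All manifolds are real manifolds without boundary modelled on a real normed space `E`. -/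

/-- A field of real bilinear forms on the tangent spaces of `M`. -/
abbrev FormField (E M : Type*) [NormedAddCommGroup E] [NormedSpace ℝ E]
    [TopologicalSpace M] [ChartedSpace E M] :=
  ∀ p : M, LinearMap.BilinForm ℝ (TangentSpace 𝓘(ℝ, E) p)

/-- The coefficients of a field of bilinear forms in a chart `e`: the value at `y` of the pullback
of `Ω` under `e⁻¹`, on the constant vector fields `u` and `v`. -/
def chartCoeff {E M : Type*} [NormedAddCommGroup E] [NormedSpace ℝ E]
    [TopologicalSpace M] [ChartedSpace E M] (Ω : FormField E M)
    (e : OpenPartialHomeomorph M E) (u v : E) (y : E) : ℝ :=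
  Ω (e.symm y) (mfderiv 𝓘(ℝ, E) 𝓘(ℝ, E) e.symm y u) (mfderiv 𝓘(ℝ, E) 𝓘(ℝ, E) e.symm y v)

/-- `Ω` is a symplectic form: a smooth closed nondegenerate differential `2`-form. -/
structure IsSymplecticForm {E M : Type*} [NormedAddCommGroup E] [NormedSpace ℝ E]
    [TopologicalSpace M] [ChartedSpace E M] (Ω : FormField E M) : Prop where
  alternating : ∀ p u, Ω p u u = 0
  smooth : ∀ e ∈ atlas E M, ∀ u v, ContDiffOn ℝ ∞ (chartCoeff Ω e u v) e.target
  closed : ∀ e ∈ atlas E M, ∀ y ∈ e.target, ∀ u v w,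
    fderiv ℝ (chartCoeff Ω e v w) y u + fderiv ℝ (chartCoeff Ω e w u) y v
      + fderiv ℝ (chartCoeff Ω e u v) y w = 0
  nondegenerate : ∀ p u, (∀ v, Ω p u v = 0) → u = 0

/-- The exponential map of the torus `(S¹)^ι`, whose Lie algebra is `ℝ^ι`. -/
def torusExp {ι : Type*} (v : ι → ℝ) : ι → Circle := fun i => Circle.exp (v i)

/-- The vector field `X_v` generated by an element `v` of the Lie algebra of the torus: the velocity
at time `0` of `θ ↦ exp(θ v) • p`. -/
def fundamentalField {ι : Type*} (E : Type*) {M : Type*}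
    [NormedAddCommGroup E] [NormedSpace ℝ E] [TopologicalSpace M] [ChartedSpace E M]
    [MulAction (ι → Circle) M] (v : ι → ℝ) (p : M) : TangentSpace 𝓘(ℝ, E) p :=
  mfderiv 𝓘(ℝ, ℝ) 𝓘(ℝ, E) (fun θ : ℝ => torusExp (θ • v) • p) 0 (1 : ℝ)

/-- The torus `(S¹)^ι` acts smoothly on `M`, preserves `Ω`, and the action is Hamiltonian with
moment map `μ`, that is, `Ω(X_v, Y) = d⟨μ, v⟩(Y)`. -/
structure IsHamiltonianAction {ι E M : Type*} [Fintype ι]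
    [NormedAddCommGroup E] [NormedSpace ℝ E] [TopologicalSpace M] [ChartedSpace E M]
    [MulAction (ι → Circle) M] (Ω : FormField E M) (μ : M → ι → ℝ) : Prop where
  smooth_action : ContMDiff (𝓘(ℝ, ι → ℝ).prod 𝓘(ℝ, E)) 𝓘(ℝ, E) ∞
    (fun q : (ι → ℝ) × M => torusExp q.1 • q.2)
  invariant : ∀ (t : ι → Circle) (p : M) (u v : TangentSpace 𝓘(ℝ, E) p),
    Ω (t • p) (mfderiv 𝓘(ℝ, E) 𝓘(ℝ, E) (fun q : M => t • q) p u)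
      (mfderiv 𝓘(ℝ, E) 𝓘(ℝ, E) (fun q : M => t • q) p v) = Ω p u v
  smooth_moment : ContMDiff 𝓘(ℝ, E) 𝓘(ℝ, ι → ℝ) ∞ μ
  moment : ∀ (v : ι → ℝ) (p : M) (Y : TangentSpace 𝓘(ℝ, E) p),
    Ω p (fundamentalField E v p) Y
      = mfderiv 𝓘(ℝ, E) 𝓘(ℝ, ℝ) (fun q : M => ∑ i, v i * μ q i) p Y

/-- The level set `μ⁻¹(x)`, with the subspace topology. -/
abbrev LevelSet {ι M : Type*} (μ : M → ι → ℝ) (x : ι → ℝ) : Type _ := {p : M // μ p = x}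

/-- The orbit relation of the torus on a level set. -/
def levelSetoid {ι M : Type*} [MulAction (ι → Circle) M] (μ : M → ι → ℝ) (x : ι → ℝ) :
    Setoid (LevelSet μ x) :=
  (MulAction.orbitRel (ι → Circle) M).comap Subtype.val

/-- The orbit space `μ⁻¹(x)/T`, with the quotient topology. -/
abbrev ReducedSpace {ι M : Type*} [MulAction (ι → Circle) M] (μ : M → ι → ℝ) (x : ι → ℝ) :
    Type _ :=
  Quotient (levelSetoid μ x)

/-- The projection `μ⁻¹(x) → μ⁻¹(x)/T`. -/
def reducedMk {ι M : Type*} [MulAction (ι → Circle) M] (μ : M → ι → ℝ) (x : ι → ℝ)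
    (p : LevelSet μ x) : ReducedSpace μ x :=
  Quotient.mk (levelSetoid μ x) p

/-- The orbit space `μ⁻¹(x)/T`, with its given smooth structure (modelled on `EQ`) and with the form
`Ωr`, is the symplectic reduction at `x` of the Hamiltonian torus action on `(M, Ω)` with moment map
`μ`, where `K` is the kernel of the action, so that `T/K` is the torus that acts effectively:

* `Ω` is symplectic, the action is Hamiltonian with moment map `μ`, and `μ` is proper;
* `x` is a regular value of `μ`, seen as a map to the affine span of its image, and `T/K` acts
  freely on `μ⁻¹(x)`;
* the orbit space is a manifold (Hausdorff, second countable, smooth) and `Ωr` is symplectic;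
* `μ⁻¹(x)` is an embedded submanifold of `M` (modelled on `EZ`), the projection
  `π : μ⁻¹(x) → μ⁻¹(x)/T` is a smooth submersion, and `π^* Ωr = i^* Ω` for the inclusion `i` (this
  determines the smooth structures and `Ωr`). -/
structure IsSymplecticReduction {ι E M : Type*} [Fintype ι]
    [NormedAddCommGroup E] [NormedSpace ℝ E] [TopologicalSpace M] [ChartedSpace E M]
    [MulAction (ι → Circle) M] (Ω : FormField E M) (μ : M → ι → ℝ) (K : Subgroup (ι → Circle))
    (x : ι → ℝ)
    (EZ EQ : Type*) [NormedAddCommGroup EZ] [NormedSpace ℝ EZ]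
    [NormedAddCommGroup EQ] [NormedSpace ℝ EQ] [ChartedSpace EQ (ReducedSpace μ x)]
    (Ωr : FormField EQ (ReducedSpace μ x)) : Prop where
  symplectic : IsSymplecticForm Ω
  hamiltonian : IsHamiltonianAction Ω μ
  proper : IsProperMap μ
  regular : ∀ p : M, μ p = x → ∀ w ∈ vectorSpan ℝ (Set.range μ),
    ∃ u : TangentSpace 𝓘(ℝ, E) p, mfderiv 𝓘(ℝ, E) 𝓘(ℝ, ι → ℝ) μ p u = w
  kernel : ∀ t ∈ K, ∀ p : M, t • p = p
  free : ∀ p : M, μ p = x → MulAction.stabilizer (ι → Circle) p = K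
  isManifold : IsManifold 𝓘(ℝ, EQ) ∞ (ReducedSpace μ x)
  t2 : T2Space (ReducedSpace μ x)
  secondCountable : SecondCountableTopology (ReducedSpace μ x)
  symplectic_reduced : IsSymplecticForm Ωr
  pullback : ∃ _ : ChartedSpace EZ (LevelSet μ x),
    IsManifold 𝓘(ℝ, EZ) ∞ (LevelSet μ x) ∧
    ContMDiff 𝓘(ℝ, EZ) 𝓘(ℝ, E) ∞ (Subtype.val : LevelSet μ x → M) ∧
    (∀ p : LevelSet μ x, Function.Injective
      (mfderiv 𝓘(ℝ, EZ) 𝓘(ℝ, E) (Subtype.val : LevelSet μ x → M) p)) ∧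
    ContMDiff 𝓘(ℝ, EZ) 𝓘(ℝ, EQ) ∞ (reducedMk μ x) ∧
    (∀ p : LevelSet μ x, Function.Surjective
      (mfderiv 𝓘(ℝ, EZ) 𝓘(ℝ, EQ) (reducedMk μ x) p)) ∧
    ∀ (p : LevelSet μ x) (u v : TangentSpace 𝓘(ℝ, EZ) p),
      Ωr (reducedMk μ x p) (mfderiv 𝓘(ℝ, EZ) 𝓘(ℝ, EQ) (reducedMk μ x) p u)
          (mfderiv 𝓘(ℝ, EZ) 𝓘(ℝ, EQ) (reducedMk μ x) p v)
        = Ω (p : M) (mfderiv 𝓘(ℝ, EZ) 𝓘(ℝ, E) (Subtype.val : LevelSet μ x → M) p u)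
            (mfderiv 𝓘(ℝ, EZ) 𝓘(ℝ, E) (Subtype.val : LevelSet μ x → M) p v)

/-! ### The Grassmann manifold of `2`-planes -/

/-- The set `G_{n,2}` of `2`-dimensional complex subspaces of `ℂⁿ`. -/
def Gr (n : ℕ) : Type := {L : Submodule ℂ (Fin n → ℂ) // Module.finrank ℂ L = 2}

/-- The columns of `A` span `L` (hence they are a basis of `L`). -/
def IsFrame {n : ℕ} (A : Matrix (Fin n) (Fin 2) ℂ) (L : Gr n) : Prop :=
  LinearMap.range A.mulVecLin = L.1

/-- The `2`-subsets `I = {i < j}` of `{1, …, n}`. -/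
abbrev Pair (n : ℕ) : Type := {I : Fin n × Fin n // I.1 < I.2}

/-- The Plücker coordinates (`2 × 2` minors) of an `n × 2` matrix. -/
def plucker {n : ℕ} (A : Matrix (Fin n) (Fin 2) ℂ) (I : Pair n) : ℂ :=
  A I.1.1 0 * A I.1.2 1 - A I.1.1 1 * A I.1.2 0

theorem exists_isFrame {n : ℕ} (L : Gr n) : ∃ A, IsFrame A L := by
  let b := Module.finBasisOfFinrankEq ℂ L.1 L.2
  refine ⟨Matrix.of fun i j => (b j : Fin n → ℂ) i, ?_⟩
  have hb := congrArg (Submodule.map L.1.subtype) b.span_eq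
  rw [Submodule.map_span, Submodule.map_top, Submodule.range_subtype, ← Set.range_comp] at hb
  rw [IsFrame, Matrix.range_mulVecLin]
  exact hb

/-- A chosen frame of a plane. -/
def frame {n : ℕ} (L : Gr n) : Matrix (Fin n) (Fin 2) ℂ := (exists_isFrame L).choose

theorem isFrame_frame {n : ℕ} (L : Gr n) : IsFrame (frame L) L := (exists_isFrame L).choose_spec

theorem IsFrame.injective {n : ℕ} {A : Matrix (Fin n) (Fin 2) ℂ} {L : Gr n} (h : IsFrame A L) :
    Function.Injective A.mulVecLin := by
  have h1 := LinearMap.finrank_range_add_finrank_ker A.mulVecLin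
  rw [show LinearMap.range A.mulVecLin = L.1 from h, L.2] at h1
  simp only [Module.finrank_fintype_fun_eq_card, Fintype.card_fin] at h1
  rw [← LinearMap.ker_eq_bot]
  exact Submodule.finrank_eq_zero.1 (by omega)

/-- Two frames of the same plane differ by an invertible matrix. -/
theorem IsFrame.exists_mul {n : ℕ} {A B : Matrix (Fin n) (Fin 2) ℂ} {L : Gr n}
    (hA : IsFrame A L) (hB : IsFrame B L) : ∃ g : Matrix (Fin 2) (Fin 2) ℂ, IsUnit g.det ∧
      B = A * g := by
  have key : ∀ {A B : Matrix (Fin n) (Fin 2) ℂ}, IsFrame A L → IsFrame B L →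
      ∃ g : Matrix (Fin 2) (Fin 2) ℂ, B = A * g := by
    intro A B hA hB
    have : ∀ j, ∃ c : Fin 2 → ℂ, A.mulVec c = B.col j := by
      intro j
      have : B.col j ∈ LinearMap.range A.mulVecLin := by
        rw [show LinearMap.range A.mulVecLin = LinearMap.range B.mulVecLin from
          Eq.trans hA (Eq.symm hB)]
        exact ⟨Pi.single j 1, by simp⟩
      exact this
    choose c hc using this
    refine ⟨Matrix.of fun i j => c j i, ?_⟩
    ext i j
    have := congrFun (hc j) i
    simp only [Matrix.col_apply] at this
    rw [← this]
    rfl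
  obtain ⟨g, hg⟩ := key hA hB
  obtain ⟨h, hh⟩ := key hB hA
  refine ⟨g, ?_, hg⟩
  have h1 : g * h = 1 := by
    apply Matrix.mulVec_injective
    funext v
    apply hA.injective
    simp only [Matrix.mulVecLin_apply, Matrix.mulVec_mulVec, Matrix.mul_one]
    rw [← Matrix.mul_assoc, ← hg, ← hh]
  exact IsUnit.of_mul_eq_one h.det (by rw [← Matrix.det_mul, h1, Matrix.det_one])

/-- Plücker coordinates are homogeneous coordinates: a change of frame rescales them. -/
theorem plucker_mul {n : ℕ} (A : Matrix (Fin n) (Fin 2) ℂ) (g : Matrix (Fin 2) (Fin 2) ℂ)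
    (I : Pair n) : plucker (A * g) I = g.det * plucker A I := by
  simp only [plucker, Matrix.mul_apply, Fin.sum_univ_two, Matrix.det_fin_two]
  ring

/-! #### The smooth structure

A chart is given by a numbering `e` of the `n` coordinates by `Fin 2 ⊕ Fin (n - 2)`. It is defined on
the planes that project isomorphically to the first two coordinates, and such a plane is the graph of
an `(n - 2) × 2` matrix. -/

/-- The space of `(n - 2) × 2` complex matrices. -/
abbrev GrModel (n : ℕ) : Type := Fin (n - 2) → Fin 2 → ℂ

/-- A numbering of the coordinates. -/
abbrev Numbering (n : ℕ) : Type := Fin 2 ⊕ Fin (n - 2) ≃ Fin n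

/-- The first two rows of `A` in the numbering `e`. -/
def top {n : ℕ} (e : Numbering n) (A : Matrix (Fin n) (Fin 2) ℂ) : Matrix (Fin 2) (Fin 2) ℂ :=
  A.submatrix (fun i => e (Sum.inl i)) id

/-- The last `n - 2` rows of `A` in the numbering `e`. -/
def bot {n : ℕ} (e : Numbering n) (A : Matrix (Fin n) (Fin 2) ℂ) :
    Matrix (Fin (n - 2)) (Fin 2) ℂ :=
  A.submatrix (fun i => e (Sum.inr i)) id

/-- The `n × 2` matrix with first two rows the identity and last rows `Z`, in the numbering `e`. -/
def graphFrame {n : ℕ} (e : Numbering n) (Z : GrModel n) : Matrix (Fin n) (Fin 2) ℂ :=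
  (Matrix.fromRows (1 : Matrix (Fin 2) (Fin 2) ℂ) (Matrix.of Z)).submatrix e.symm id

theorem top_graphFrame {n : ℕ} (e : Numbering n) (Z : GrModel n) : top e (graphFrame e Z) = 1 := by
  ext i j
  simp [top, graphFrame]

theorem bot_graphFrame {n : ℕ} (e : Numbering n) (Z : GrModel n) :
    bot e (graphFrame e Z) = Matrix.of Z := by
  ext i j
  simp [bot, graphFrame]

theorem top_mul {n : ℕ} (e : Numbering n) (A : Matrix (Fin n) (Fin 2) ℂ)
    (g : Matrix (Fin 2) (Fin 2) ℂ) : top e (A * g) = top e A * g := by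
  ext i j
  simp [top, Matrix.mul_apply]

theorem bot_mul {n : ℕ} (e : Numbering n) (A : Matrix (Fin n) (Fin 2) ℂ)
    (g : Matrix (Fin 2) (Fin 2) ℂ) : bot e (A * g) = bot e A * g := by
  ext i j
  simp [bot, Matrix.mul_apply]

theorem eq_of_top_bot {n : ℕ} (e : Numbering n) {A B : Matrix (Fin n) (Fin 2) ℂ}
    (h1 : top e A = top e B) (h2 : bot e A = bot e B) : A = B := by
  ext i j
  obtain ⟨k, rfl⟩ := e.surjective i
  rcases k with k | k
  · exact congrFun (congrFun h1 k) j
  · exact congrFun (congrFun h2 k) j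

theorem finrank_range_graphFrame {n : ℕ} (e : Numbering n) (Z : GrModel n) :
    Module.finrank ℂ (LinearMap.range (graphFrame e Z).mulVecLin) = 2 := by
  rw [LinearMap.finrank_range_of_inj]
  · simp
  · intro v w h
    funext i
    have := congrFun h (e (Sum.inl i))
    simpa [graphFrame, Matrix.mulVec, dotProduct, Matrix.one_apply] using this

/-- The plane which is the graph of `Z`. -/
def graph {n : ℕ} (e : Numbering n) (Z : GrModel n) : Gr n :=
  ⟨LinearMap.range (graphFrame e Z).mulVecLin, finrank_range_graphFrame e Z⟩

theorem isFrame_graphFrame {n : ℕ} (e : Numbering n) (Z : GrModel n) :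
    IsFrame (graphFrame e Z) (graph e Z) := rfl

/-- The matrix of which the plane spanned by the columns of `A` is the graph. -/
def slope {n : ℕ} (e : Numbering n) (A : Matrix (Fin n) (Fin 2) ℂ) : GrModel n :=
  bot e A * (top e A)⁻¹

theorem slope_mul {n : ℕ} (e : Numbering n) (A : Matrix (Fin n) (Fin 2) ℂ)
    (g : Matrix (Fin 2) (Fin 2) ℂ) (hg : IsUnit g.det) : slope e (A * g) = slope e A := by
  rw [slope, slope, top_mul, bot_mul, Matrix.mul_inv_rev, Matrix.mul_assoc,
    ← Matrix.mul_assoc g, Matrix.mul_nonsing_inv g hg, Matrix.one_mul]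

theorem IsFrame.slope_eq {n : ℕ} {A B : Matrix (Fin n) (Fin 2) ℂ} {L : Gr n} (e : Numbering n)
    (hA : IsFrame A L) (hB : IsFrame B L) : slope e A = slope e B := by
  obtain ⟨g, hg, rfl⟩ := hA.exists_mul hB
  exact (slope_mul e A g hg).symm

theorem IsFrame.det_top_ne_zero {n : ℕ} {A B : Matrix (Fin n) (Fin 2) ℂ} {L : Gr n}
    (e : Numbering n) (hA : IsFrame A L) (hB : IsFrame B L) (h : (top e A).det ≠ 0) :
    (top e B).det ≠ 0 := by
  obtain ⟨g, hg, rfl⟩ := hA.exists_mul hB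
  rw [top_mul, Matrix.det_mul]
  exact mul_ne_zero h hg.ne_zero

theorem graph_slope {n : ℕ} (e : Numbering n) (L : Gr n) (h : (top e (frame L)).det ≠ 0) :
    graph e (slope e (frame L)) = L := by
  have hu : IsUnit (top e (frame L)).det := isUnit_iff_ne_zero.2 h
  have hA : frame L = graphFrame e (slope e (frame L)) * top e (frame L) := by
    apply eq_of_top_bot e
    · rw [top_mul, top_graphFrame, Matrix.one_mul]
    · rw [bot_mul, bot_graphFrame]
      change _ = bot e (frame L) * (top e (frame L))⁻¹ * top e (frame L)
      rw [Matrix.mul_assoc, Matrix.nonsing_inv_mul _ hu, Matrix.mul_one]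
  apply Subtype.ext
  have hL : LinearMap.range (frame L).mulVecLin = L.1 := isFrame_frame L
  refine Eq.trans ?_ hL
  conv_rhs => rw [hA]
  rw [Matrix.mulVecLin_mul]
  refine (LinearMap.range_comp_of_range_eq_top _ (LinearMap.range_eq_top.2 fun v => ?_)).symm
  exact ⟨((top e (frame L))⁻¹).mulVec v, by
    rw [Matrix.mulVecLin_apply, Matrix.mulVec_mulVec, Matrix.mul_nonsing_inv _ hu,
      Matrix.one_mulVec]⟩

theorem slope_graph {n : ℕ} (e : Numbering n) (Z : GrModel n) :
    slope e (frame (graph e Z)) = Z := by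
  rw [(isFrame_frame (graph e Z)).slope_eq e (isFrame_graphFrame e Z), slope, top_graphFrame,
    bot_graphFrame, inv_one, Matrix.mul_one]
  rfl

/-- The chart of the Grassmann manifold attached to a numbering of the coordinates. -/
def grChart {n : ℕ} (e : Numbering n) : PartialEquiv (Gr n) (GrModel n) where
  toFun L := slope e (frame L)
  invFun Z := graph e Z
  source := {L | (top e (frame L)).det ≠ 0}
  target := Set.univ
  map_source' _ _ := Set.mem_univ _
  map_target' Z _ := (isFrame_graphFrame e Z).det_top_ne_zero e (isFrame_frame _)
    (by rw [top_graphFrame]; simp)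
  left_inv' L h := graph_slope e L h
  right_inv' Z _ := slope_graph e Z

theorem exists_numbering {n : ℕ} (i j : Fin n) (hij : i ≠ j) :
    ∃ e : Numbering n, e (Sum.inl 0) = i ∧ e (Sum.inl 1) = j := by
  have hn : 2 + (n - 2) = n := by
    have := i.2
    have := j.2
    have : (i : ℕ) ≠ j := fun h => hij (Fin.ext h)
    omega
  let e₀ : Numbering n := finSumFinEquiv.trans (finCongr hn)
  let e₁ : Numbering n := e₀.trans (Equiv.swap (e₀ (Sum.inl 0)) i)
  have h1 : e₁ (Sum.inl 0) = i := by simp [e₁]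
  have h2 : e₁ (Sum.inl 1) ≠ i := by
    rw [← h1]
    exact fun h => by simpa using e₁.injective h
  refine ⟨e₁.trans (Equiv.swap (e₁ (Sum.inl 1)) j), ?_, by simp⟩
  simp only [Equiv.trans_apply, h1]
  exact Equiv.swap_apply_of_ne_of_ne h2.symm hij

theorem exists_mem_source {n : ℕ} (L : Gr n) : ∃ e : Numbering n, L ∈ (grChart e).source := by
  by_contra! H
  have hz : ∀ i j : Fin n, frame L i 0 * frame L j 1 - frame L i 1 * frame L j 0 = 0 := by
    intro i j
    by_cases hij : i = j
    · subst hij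
      ring
    · obtain ⟨e, h0, h1⟩ := exists_numbering i j hij
      have := H e
      simp only [grChart, Set.mem_ofPred_eq, not_not, Matrix.det_fin_two, top,
        Matrix.submatrix_apply, id, h0, h1] at this
      exact this
  have hinj := (isFrame_frame L).injective
  have hcol : ∀ j, frame L j 0 = 0 ∧ frame L j 1 = 0 := by
    intro j
    have h1 : (![frame L j 1, -frame L j 0] : Fin 2 → ℂ) = 0 := by
      apply hinj
      funext i
      have := hz i j
      simp only [Matrix.mulVecLin_apply, Matrix.mulVec, dotProduct, Fin.sum_univ_two]
      simp
      linear_combination this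
    have a := congrFun h1 0
    have b := congrFun h1 1
    simp at a b
    exact ⟨b, a⟩
  have : (![1, 0] : Fin 2 → ℂ) = 0 := by
    apply hinj
    funext i
    simp [Matrix.mulVec, dotProduct, Fin.sum_univ_two, (hcol i).1]
  simpa using congrFun this 0

/-- The numbering that gives the preferred chart at `L`. -/
def chartIndex {n : ℕ} (L : Gr n) : Numbering n := (exists_mem_source L).choose

theorem contDiff_graphFrame {n : ℕ} (e : Numbering n) (i : Fin n) (j : Fin 2) :
    ContDiff ℝ ∞ (fun Z : GrModel n => graphFrame e Z i j) := by
  obtain ⟨k, rfl⟩ := e.surjective i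
  rcases k with k | k
  · simp only [graphFrame, Matrix.submatrix_apply, Equiv.symm_apply_apply, Matrix.fromRows_apply_inl]
    exact contDiff_const
  · simp only [graphFrame, Matrix.submatrix_apply, Equiv.symm_apply_apply, Matrix.fromRows_apply_inr,
      Matrix.of_apply, id]
    fun_prop

theorem contDiff_det_top {n : ℕ} (e e' : Numbering n) :
    ContDiff ℝ ∞ (fun Z : GrModel n => (top e' (graphFrame e Z)).det) := by
  simp only [Matrix.det_fin_two, top, Matrix.submatrix_apply, id]
  exact ((contDiff_graphFrame e _ _).mul (contDiff_graphFrame e _ _)).sub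
    ((contDiff_graphFrame e _ _).mul (contDiff_graphFrame e _ _))

theorem transition_source {n : ℕ} (e e' : Numbering n) :
    ((grChart e).symm.trans (grChart e')).source
      = {Z | (top e' (graphFrame e Z)).det ≠ 0} := by
  ext Z
  simp only [PartialEquiv.trans_source, PartialEquiv.symm_source, Set.mem_inter_iff,
    Set.mem_preimage, Set.mem_ofPred_eq]
  constructor
  · rintro ⟨_, h⟩
    exact (isFrame_frame _).det_top_ne_zero e' (isFrame_graphFrame e Z) h
  · intro h
    exact ⟨Set.mem_univ _, (isFrame_graphFrame e Z).det_top_ne_zero e' (isFrame_frame _) h⟩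

theorem transition_apply {n : ℕ} (e e' : Numbering n) (Z : GrModel n) :
    ((grChart e).symm.trans (grChart e')) Z = slope e' (graphFrame e Z) :=
  (isFrame_frame (graph e Z)).slope_eq e' (isFrame_graphFrame e Z)

theorem contDiffOn_transition {n : ℕ} (e e' : Numbering n) :
    ContDiffOn ℝ ∞ ((grChart e).symm.trans (grChart e'))
      ((grChart e).symm.trans (grChart e')).source := by
  rw [transition_source]
  refine ContDiffOn.congr ?_ (fun Z _ => transition_apply e e' Z)
  refine contDiffOn_pi.2 fun i => contDiffOn_pi.2 fun j => ?_
  have hinv : ContDiffOn ℝ ∞ (fun Z : GrModel n => ((top e' (graphFrame e Z)).det)⁻¹)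
      {Z | (top e' (graphFrame e Z)).det ≠ 0} :=
    (contDiff_det_top e e').contDiffOn.inv fun Z hZ => hZ
  have hc : ∀ (i : Fin n) (j : Fin 2), ContDiffOn ℝ ∞ (fun Z : GrModel n => graphFrame e Z i j)
      {Z | (top e' (graphFrame e Z)).det ≠ 0} := fun i j => (contDiff_graphFrame e i j).contDiffOn
  have hadj : ∀ k, ContDiffOn ℝ ∞
      (fun Z : GrModel n => (top e' (graphFrame e Z)).adjugate k j)
      {Z | (top e' (graphFrame e Z)).det ≠ 0} := by
    intro k
    fin_cases k <;> fin_cases j <;>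
    simp only [Matrix.adjugate_fin_two, top] <;>
    first | exact hc _ _ | exact (hc _ _).neg
  have hterm : ∀ k, ContDiffOn ℝ ∞
      (fun Z : GrModel n => bot e' (graphFrame e Z) i k * (top e' (graphFrame e Z))⁻¹ k j)
      {Z | (top e' (graphFrame e Z)).det ≠ 0} := by
    intro k
    simp only [Matrix.inv_def, Ring.inverse_eq_inv', Matrix.smul_apply, smul_eq_mul]
    exact (hc _ _).mul (hinv.mul (hadj k))
  refine ((hterm 0).add (hterm 1)).congr fun Z _ => ?_
  simp only [slope, Matrix.mul_apply, Fin.sum_univ_two]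

/-- The atlas of the Grassmann manifold. -/
def grCore (n : ℕ) : ChartedSpaceCore (GrModel n) (Gr n) where
  atlas := Set.range grChart
  chartAt L := grChart (chartIndex L)
  mem_chart_source L := (exists_mem_source L).choose_spec
  chart_mem_atlas L := ⟨_, rfl⟩
  open_source := by
    rintro _ _ ⟨e, rfl⟩ ⟨e', rfl⟩
    rw [transition_source]
    exact isOpen_ne_fun (contDiff_det_top e e').continuous continuous_const
  continuousOn_toFun := by
    rintro _ _ ⟨e, rfl⟩ ⟨e', rfl⟩
    exact (contDiffOn_transition e e').continuousOn

/-- The topology of the Grassmann manifold, given by its charts. -/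
instance (n : ℕ) : TopologicalSpace (Gr n) := (grCore n).toTopologicalSpace

instance (n : ℕ) : ChartedSpace (GrModel n) (Gr n) := (grCore n).toChartedSpace

instance (n : ℕ) : IsManifold 𝓘(ℝ, GrModel n) ∞ (Gr n) := by
  apply isManifold_of_contDiffOn
  rintro _ _ ⟨_, ⟨p, rfl⟩, he⟩ ⟨_, ⟨p', rfl⟩, he'⟩
  simp only [Set.mem_iUnion, Set.mem_singleton_iff] at he he'
  obtain ⟨⟨e, rfl⟩, rfl⟩ := he
  obtain ⟨⟨e', rfl⟩, rfl⟩ := he'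
  have h := contDiffOn_transition e e'
  simp only [modelWithCornersSelf_coe, modelWithCornersSelf_coe_symm, Set.preimage_id,
    Set.range_id, Set.inter_univ, Function.id_comp, Function.comp_id]
  exact h

/-! #### Torus actions -/

/-- The diagonal linear automorphism of `ℂⁿ` given by `t ∈ (ℂ^*)ⁿ`. -/
def diagMap {n : ℕ} (t : Fin n → ℂˣ) : (Fin n → ℂ) ≃ₗ[ℂ] (Fin n → ℂ) :=
  LinearEquiv.piCongrRight fun i => LinearEquiv.smulOfUnit (t i)

/-- The canonical action of `(ℂ^*)ⁿ` on the Grassmann manifold. -/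
instance (n : ℕ) : MulAction (Fin n → ℂˣ) (Gr n) where
  smul t L := ⟨L.1.map (diagMap t).toLinearMap, by
    rw [LinearEquiv.finrank_map_eq]; exact L.2⟩
  one_smul L := by
    apply Subtype.ext
    change L.1.map (diagMap 1).toLinearMap = L.1
    rw [show (diagMap (1 : Fin n → ℂˣ)).toLinearMap = LinearMap.id from ?_, Submodule.map_id]
    ext i
    simp [diagMap, LinearEquiv.smulOfUnit]
  mul_smul s t L := by
    apply Subtype.ext
    change L.1.map (diagMap (s * t)).toLinearMap
      = (L.1.map (diagMap t).toLinearMap).map (diagMap s).toLinearMap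
    rw [← Submodule.map_comp]
    congr 1
    apply LinearMap.ext
    intro v
    funext i
    simp [diagMap, LinearEquiv.smulOfUnit, mul_smul]

/-- The canonical action of the compact torus `Tⁿ` on the Grassmann manifold. -/
instance (n : ℕ) : MulAction (Fin n → Circle) (Gr n) :=
  MulAction.compHom (Gr n)
    (MonoidHom.pi fun i => Circle.toUnits.comp (Pi.evalMonoidHom (fun _ : Fin n => Circle) i))

/-- The diagonal circle of `Tⁿ`. -/
def diagCircle (n : ℕ) : Subgroup (Fin n → Circle) where
  carrier := {t | ∀ i j, t i = t j}
  one_mem' _ _ := rfl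
  mul_mem' hs ht i j := by simp only [Pi.mul_apply, hs i j, ht i j]
  inv_mem' ht i j := by simp only [Pi.inv_apply, ht i j]

/-! #### The symplectic form and the moment map -/

/-- The Fubini–Study form on `ℂ^ι`, away from `0`, at the point `z` and on the vectors `a` and `b`:
`2 Im (⟨a, b⟩ / |z|² - ⟨a, z⟩ ⟨z, b⟩ / |z|⁴)` where `⟨a, b⟩ = ∑ aᵢ b̄ᵢ`. It is the lift of a
form on the projective space. In terms of the Fubini–Study metric `g` and the complex structure `J`
the form is a positive multiple of `(a, b) ↦ g(a, J b)`, normalised so that the moment map of the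
standard torus action, with the sign convention `Ω(X_v, Y) = dH_v(Y)`, is `|zᵢ|² / |z|²`. -/
def fubiniStudy {ι : Type*} [Fintype ι] (z a b : ι → ℂ) : ℝ :=
  2 * (dotProduct a (star b) / dotProduct z (star z)
    - dotProduct a (star z) * dotProduct z (star b) / dotProduct z (star z) ^ 2).im

/-- The Plücker embedding in the chart given by `e`, in homogeneous coordinates. -/
def pluckerLift {n : ℕ} (e : Numbering n) (Z : GrModel n) : Pair n → ℂ := plucker (graphFrame e Z)

/-- The invariant symplectic form of the Grassmann manifold: the pullback of the Fubini–Study form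
under the Plücker embedding. Here the tangent space at `L` is identified with the model space by the
preferred chart at `L`. -/
def grForm (n : ℕ) : FormField (GrModel n) (Gr n) := fun L =>
  let e := chartIndex L
  let Z : GrModel n := grChart e L
  let D : GrModel n →L[ℝ] (Pair n → ℂ) := fderiv ℝ (pluckerLift e) Z
  (LinearMap.mk₂ ℝ (fun u v : GrModel n => fubiniStudy (pluckerLift e Z) (D u) (D v))
    (fun u u' v => by
      simp only [fubiniStudy, map_add, add_dotProduct, add_mul, add_div, Complex.sub_im,
        Complex.add_im]
      ring)
    (fun c u v => by
      simp only [fubiniStudy, map_smul, smul_dotProduct, Complex.real_smul, mul_assoc,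
        mul_div_assoc, ← mul_sub, Complex.im_ofReal_mul, smul_eq_mul]
      ring)
    (fun u v v' => by
      simp only [fubiniStudy, map_add, star_add, dotProduct_add, mul_add, add_div, Complex.sub_im,
        Complex.add_im]
      ring)
    (fun c u v => by
      have hs : ∀ w : Pair n → ℂ, star (c • w) = c • star w := fun w => by
        funext i
        simp
      simp only [fubiniStudy, map_smul, hs, dotProduct_smul, Complex.real_smul,
        mul_left_comm _ (c : ℂ), mul_div_assoc, ← mul_sub, Complex.im_ofReal_mul, smul_eq_mul]
      ring) :
    LinearMap.BilinForm ℝ (GrModel n))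

/-- The vertex `Λ_I` of the hypersimplex. -/
def vertex {n : ℕ} (I : Pair n) : Fin n → ℝ := fun k => if k = I.1.1 ∨ k = I.1.2 then 1 else 0

/-- The moment map `μ(L) = (∑_I |P^I(L)|² Λ_I) / ∑_I |P^I(L)|²`. -/
def momentMap {n : ℕ} (L : Gr n) : Fin n → ℝ :=
  (∑ I : Pair n, ‖plucker (frame L) I‖ ^ 2)⁻¹ •
    ∑ I : Pair n, ‖plucker (frame L) I‖ ^ 2 • vertex I

/-- The moment map may be computed in any frame. -/
theorem momentMap_eq {n : ℕ} {L : Gr n} {A : Matrix (Fin n) (Fin 2) ℂ} (hA : IsFrame A L) :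
    momentMap L = (∑ I : Pair n, ‖plucker A I‖ ^ 2)⁻¹ •
      ∑ I : Pair n, ‖plucker A I‖ ^ 2 • vertex I := by
  obtain ⟨g, hg, rfl⟩ := (isFrame_frame L).exists_mul hA
  have h0 : ‖g.det‖ ^ 2 ≠ 0 := by simpa using hg.ne_zero
  simp only [momentMap, plucker_mul, norm_mul, mul_pow, mul_smul, ← Finset.smul_sum,
    ← Finset.mul_sum, mul_inv]
  rw [smul_comm _ (‖g.det‖ ^ 2), smul_smul, inv_mul_cancel₀ h0, one_smul]

/-! ### Strata, admissible polytopes, chambers and their spaces of parameters -/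

/-- The hypersimplex `Δ_{n,2}`. -/
def hypersimplex (n : ℕ) : Set (Fin n → ℝ) := convexHull ℝ (Set.range (vertex (n := n)))

/-- The set `W_σ` of the planes whose nonzero Plücker coordinates are those with index in `σ`. -/
def stratum {n : ℕ} (σ : Set (Pair n)) : Set (Gr n) :=
  {L | ∀ I, plucker (frame L) I ≠ 0 ↔ I ∈ σ}

/-- The set `σ` gives a stratum, that is, `W_σ` is not empty. -/
def IsAdmissible {n : ℕ} (σ : Set (Pair n)) : Prop := (stratum σ).Nonempty

/-- The polytope `P_σ`, admissible if `W_σ` is not empty. -/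
def polytope {n : ℕ} (σ : Set (Pair n)) : Set (Fin n → ℝ) := convexHull ℝ (vertex '' σ)

/-- `C` is the chamber `C_S` of the decomposition of the hypersimplex by the admissible polytopes:
`S` is a set of admissible `σ`, and `C` is a nonempty set, the intersection of the relative interiors
of the polytopes `P_σ` with `σ ∈ S`, and disjoint from those with `σ ∉ S`. -/
structure IsChamber {n : ℕ} (S : Set (Set (Pair n))) (C : Set (Fin n → ℝ)) : Prop where
  nonempty : C.Nonempty
  admissible : ∀ σ ∈ S, IsAdmissible σ
  eq_inter : C = {x ∈ hypersimplex n | ∀ σ ∈ S, x ∈ intrinsicInterior ℝ (polytope σ)}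
  disjoint : ∀ σ, IsAdmissible σ → σ ∉ S → Disjoint C (intrinsicInterior ℝ (polytope σ))

/-- The union of the strata `W_σ` with `σ ∈ S`. -/
def strataUnion {n : ℕ} (S : Set (Set (Pair n))) : Set (Gr n) := ⋃ σ ∈ S, stratum σ

/-- The orbit relation of `(ℂ^*)ⁿ` on the union of the strata `W_σ` with `σ ∈ S`. -/
def parameterSetoid {n : ℕ} (S : Set (Set (Pair n))) : Setoid (strataUnion S) :=
  (MulAction.orbitRel (Fin n → ℂˣ) (Gr n)).comap Subtype.val

/-- The space of parameters `F_S` of a chamber: the union of the orbit spaces `W_σ / (ℂ^*)ⁿ` over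
`σ ∈ S`, with the quotient topology. -/
abbrev ParameterSpace {n : ℕ} (S : Set (Set (Pair n))) : Type := Quotient (parameterSetoid S)

/-- The class in `F_S` of a plane that lies in one of the strata `W_σ` with `σ ∈ S`. -/
def parameterMk {n : ℕ} (S : Set (Set (Pair n))) (L : strataUnion S) : ParameterSpace S :=
  Quotient.mk (parameterSetoid S) L

end SymplecticReduction

end

open SymplecticReduction

open scoped Manifold ContDiff

noncomputable section

namespace SymplecticReduction

open Filter Topology

variable {n : ℕ}

/-! ### Frames and smooth maps to the Grassmann manifold -/

/-! Stability does not depend on the point of the chamber. Since `C` spans the directions of the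
hyperplane `∑ k, x k = 2`, each polytope P_σ with σ in `S` is full dimensional in that hyperplane,
and its relative interior is its interior. So for every `x` in `C` the union of the strata is the
set `stable x` of the planes L with `x` an interior point of P_{supp L} (`IsChamber.mem_iff`). This
set is open, because supports only grow near a plane, and the stabiliser of each of its planes in
the complex torus is the diagonal (`IsRigid.eq_of_smul_eq`).

The two quotients are compared by an elementary form of the Kempf–Ness theorem. Moving a plane with
weights c_I = |P^I|² to the level set at `x` by the positive torus element exp s means solving ∑ c_I
exp(2⟨s, Λ_I⟩)(Λ_I - x) = 0. This is the critical equation of a sum of exponentials, coercive modulo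
the diagonal because `x` is interior. A minimum gives existence, monotonicity of exp gives
uniqueness modulo the diagonal, and the implicit function theorem gives smooth dependence on the
plane. The resulting map `retract x` from stable planes to the level set turns the action of the
complex torus into that of its phases (`retract_smul`). Hence it inverts, on orbit spaces, the
inclusion of the level set (`IsStableLocus.homeo`).

The smooth structures come from slices. The rows of a frame of a stable plane are n points of the
projective line, and the orbit of the plane is their configuration up to projective maps. Three
distinct points are moved to 0, 1 and a generic m, chosen so that no other point goes to infinity;
the remaining n - 3 points are the coordinates. These charts of the space of parameters do not
involve `x`. Transported by the homeomorphism they are charts of the reduced space, and together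
with n - 1 angles they give charts of the level set.

All computations with the form take place on Plücker vectors of frames (`grForm_mfderiv`), because
the Fubini–Study form ignores rescaling. It is closed because it has a potential, and nondegenerate
by Cauchy–Schwarz. The reduced form is the pullback of Ω under v ↦ `retract x (c.plane v)`. A
torus-valued change of representatives inside the level set does not affect it, since by the moment
equation the torus directions are Ω-orthogonal to the level set (`grForm_rotate`). It is
nondegenerate because ker dμ is spanned by slice and torus directions, and a slice direction
orthogonal to all slice directions must be a torus direction, hence zero
(`Slice.eq_zero_of_grForm_eq_zero`). -/

/-- The `2 × 2` minor of the rows `i` and `j`. -/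
def minor (A : Matrix (Fin n) (Fin 2) ℂ) (i j : Fin n) : ℂ := A i 0 * A j 1 - A i 1 * A j 0

theorem plucker_eq_minor (A : Matrix (Fin n) (Fin 2) ℂ) (I : Pair n) :
    plucker A I = minor A I.1.1 I.1.2 := rfl

theorem minor_self (A : Matrix (Fin n) (Fin 2) ℂ) (i : Fin n) : minor A i i = 0 := by
  simp only [minor]; ring

theorem minor_swap (A : Matrix (Fin n) (Fin 2) ℂ) (i j : Fin n) :
    minor A i j = -minor A j i := by
  simp only [minor]; ring

theorem minor_mul (A : Matrix (Fin n) (Fin 2) ℂ) (g : Matrix (Fin 2) (Fin 2) ℂ) (i j : Fin n) :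
    minor (A * g) i j = g.det * minor A i j := by
  simp only [minor, Matrix.mul_apply, Fin.sum_univ_two, Matrix.det_fin_two]
  ring

theorem det_top_eq_minor (e : Numbering n) (A : Matrix (Fin n) (Fin 2) ℂ) :
    (top e A).det = minor A (e (Sum.inl 0)) (e (Sum.inl 1)) := by
  simp [Matrix.det_fin_two, top, minor]

/-- Cramer's rule: a vector in the kernel is annihilated by the nonzero minor. -/
theorem isFrame_of_minor_ne_zero {A : Matrix (Fin n) (Fin 2) ℂ} {i j : Fin n}
    (h : minor A i j ≠ 0) : ∃ L : Gr n, IsFrame A L := by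
  refine ⟨⟨LinearMap.range A.mulVecLin, ?_⟩, rfl⟩
  rw [LinearMap.finrank_range_of_inj]
  · simp
  · rw [← LinearMap.ker_eq_bot, LinearMap.ker_eq_bot']
    intro v hv
    have h1 := congrFun hv i
    have h2 := congrFun hv j
    simp only [Matrix.mulVecLin_apply, Matrix.mulVec, dotProduct, Fin.sum_univ_two,
      Pi.zero_apply] at h1 h2
    have a0 : minor A i j * v 0 = 0 := by
      rw [minor]; linear_combination A j 1 * h1 - A i 1 * h2
    have a1 : minor A i j * v 1 = 0 := by
      rw [minor]; linear_combination A i 0 * h2 - A j 0 * h1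
    funext k
    fin_cases k
    · exact (mul_eq_zero.1 a0).resolve_left h
    · exact (mul_eq_zero.1 a1).resolve_left h

theorem IsFrame.unique {A : Matrix (Fin n) (Fin 2) ℂ} {L M : Gr n} (hL : IsFrame A L)
    (hM : IsFrame A M) : L = M := Subtype.ext (Eq.trans (Eq.symm hL) hM)

theorem IsFrame.mul {A : Matrix (Fin n) (Fin 2) ℂ} {L : Gr n} (hA : IsFrame A L)
    {g : Matrix (Fin 2) (Fin 2) ℂ} (hg : IsUnit g.det) : IsFrame (A * g) L := by
  rw [IsFrame, ← show LinearMap.range A.mulVecLin = L.1 from hA, Matrix.mulVecLin_mul]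
  refine LinearMap.range_comp_of_range_eq_top _ (LinearMap.range_eq_top.2 fun v => ?_)
  exact ⟨(g⁻¹).mulVec v, by
    rw [Matrix.mulVecLin_apply, Matrix.mulVec_mulVec, Matrix.mul_nonsing_inv _ hg,
      Matrix.one_mulVec]⟩

theorem IsFrame.smul {A : Matrix (Fin n) (Fin 2) ℂ} {L : Gr n} (hA : IsFrame A L)
    {c : ℂ} (hc : c ≠ 0) : IsFrame (c • A) L := by
  have := hA.mul (g := c • 1) (by simp [hc])
  simpa using this

theorem mul_top_eq (e : Numbering n) (A : Matrix (Fin n) (Fin 2) ℂ) (h : (top e A).det ≠ 0) :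
    graphFrame e (slope e A) * top e A = A := by
  have hu : IsUnit (top e A).det := isUnit_iff_ne_zero.2 h
  apply eq_of_top_bot e
  · rw [top_mul, top_graphFrame, Matrix.one_mul]
  · rw [bot_mul, bot_graphFrame]
    change bot e A * (top e A)⁻¹ * top e A = _
    rw [Matrix.mul_assoc, Matrix.nonsing_inv_mul _ hu, Matrix.mul_one]

theorem graph_slope_of_isFrame (e : Numbering n) {A : Matrix (Fin n) (Fin 2) ℂ} {L : Gr n}
    (hA : IsFrame A L) (h : (top e A).det ≠ 0) : graph e (slope e A) = L := by
  have h1 := (isFrame_graphFrame e (slope e A)).mul (isUnit_iff_ne_zero.2 h)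
  rw [mul_top_eq e A h] at h1
  exact h1.unique hA

theorem pluckerLift_slope (e : Numbering n) (A : Matrix (Fin n) (Fin 2) ℂ)
    (h : (top e A).det ≠ 0) : pluckerLift e (slope e A) = ((top e A).det)⁻¹ • plucker A := by
  funext I
  have := plucker_mul (graphFrame e (slope e A)) (top e A) I
  rw [mul_top_eq e A h] at this
  rw [pluckerLift, Pi.smul_apply, this, smul_eq_mul, inv_mul_cancel_left₀ h]

/-- The charts of the Grassmann manifold as partial homeomorphisms. -/
def grHomeo (e : Numbering n) : OpenPartialHomeomorph (Gr n) (GrModel n) :=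
  (grCore n).openPartialHomeomorph (grChart e) ⟨e, rfl⟩

theorem grHomeo_target (e : Numbering n) : (grHomeo e).target = Set.univ := rfl

theorem mem_grHomeo_source_iff (e : Numbering n) {A : Matrix (Fin n) (Fin 2) ℂ} {L : Gr n}
    (hA : IsFrame A L) : L ∈ (grHomeo e).source ↔ (top e A).det ≠ 0 :=
  ⟨fun h => (isFrame_frame L).det_top_ne_zero e hA h,
    fun h => hA.det_top_ne_zero e (isFrame_frame L) h⟩

theorem mem_atlas_iff (E : OpenPartialHomeomorph (Gr n) (GrModel n)) :
    E ∈ atlas (GrModel n) (Gr n) ↔ ∃ e, E = grHomeo e := by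
  constructor
  · rintro ⟨_, ⟨p, rfl⟩, he⟩
    simp only [Set.mem_iUnion, Set.mem_singleton_iff] at he
    obtain ⟨⟨e, rfl⟩, rfl⟩ := he
    exact ⟨e, rfl⟩
  · rintro ⟨e, rfl⟩
    refine ⟨_, ⟨grChart e, rfl⟩, ?_⟩
    simp only [Set.mem_iUnion, Set.mem_singleton_iff]
    exact ⟨⟨e, rfl⟩, rfl⟩

theorem grHomeo_mem_maximalAtlas (e : Numbering n) :
    grHomeo e ∈ IsManifold.maximalAtlas 𝓘(ℝ, GrModel n) ∞ (Gr n) :=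
  IsManifold.subset_maximalAtlas ((mem_atlas_iff _).2 ⟨e, rfl⟩)

theorem contMDiff_graph (e : Numbering n) :
    ContMDiff 𝓘(ℝ, GrModel n) 𝓘(ℝ, GrModel n) ∞ (graph e) := by
  have := contMDiffOn_symm_of_mem_maximalAtlas (grHomeo_mem_maximalAtlas e)
  rw [grHomeo_target] at this
  exact contMDiffOn_univ.1 this

theorem contMDiffAt_grHomeo (e : Numbering n) {L : Gr n} (h : L ∈ (grHomeo e).source) :
    ContMDiffAt 𝓘(ℝ, GrModel n) 𝓘(ℝ, GrModel n) ∞ (grHomeo e) L :=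
  contMDiffAt_of_mem_maximalAtlas (grHomeo_mem_maximalAtlas e) h

theorem exists_graph_eq (L : Gr n) : ∃ e Z, graph e Z = L := by
  obtain ⟨e, he⟩ := exists_mem_source L
  exact ⟨e, _, graph_slope e L he⟩

/-- A map on the Grassmann manifold is smooth if its expressions in the charts are. -/
theorem contMDiffAt_of_comp_graph {E' H' N : Type*} [NormedAddCommGroup E'] [NormedSpace ℝ E']
    [TopologicalSpace H'] {J : ModelWithCorners ℝ E' H'} [TopologicalSpace N] [ChartedSpace H' N]
    {f : Gr n → N} {e : Numbering n} {Z : GrModel n}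
    (h : ContMDiffAt 𝓘(ℝ, GrModel n) J ∞ (fun Z => f (graph e Z)) Z) :
    ContMDiffAt 𝓘(ℝ, GrModel n) J ∞ f (graph e Z) := by
  have hs : graph e Z ∈ (grHomeo e).source := (grHomeo e).map_target (Set.mem_univ Z)
  have h1 := contMDiffAt_grHomeo e hs
  have h2 : grHomeo e (graph e Z) = Z := (grHomeo e).right_inv (Set.mem_univ Z)
  have h3 := ContMDiffAt.comp (graph e Z) (g := fun Z => f (graph e Z)) (by rwa [h2]) h1
  refine h3.congr_of_eventuallyEq ?_
  filter_upwards [(grHomeo e).open_source.mem_nhds hs] with L hL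
  exact congrArg f ((grHomeo e).left_inv hL).symm

/-- The entries of a matrix-valued map are smooth at a point. -/
def SmoothFrameAt {E' H' X : Type*} [NormedAddCommGroup E'] [NormedSpace ℝ E']
    [TopologicalSpace H'] (J : ModelWithCorners ℝ E' H') [TopologicalSpace X] [ChartedSpace H' X]
    (A : X → Matrix (Fin n) (Fin 2) ℂ) (x : X) : Prop :=
  ∀ i j, ContMDiffAt J 𝓘(ℝ, ℂ) ∞ (fun y => A y i j) x

section
variable {E' H' X : Type*} [NormedAddCommGroup E'] [NormedSpace ℝ E']
    [TopologicalSpace H'] {J : ModelWithCorners ℝ E' H'} [TopologicalSpace X] [ChartedSpace H' X]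
    {A : X → Matrix (Fin n) (Fin 2) ℂ} {x : X}

theorem contMDiffAt_cmul {f g : X → ℂ} (hf : ContMDiffAt J 𝓘(ℝ, ℂ) ∞ f x)
    (hg : ContMDiffAt J 𝓘(ℝ, ℂ) ∞ g x) : ContMDiffAt J 𝓘(ℝ, ℂ) ∞ (fun y => f y * g y) x :=
  ContMDiffAt.comp x (g := fun p : ℂ × ℂ => p.1 * p.2) (f := fun y => (f y, g y))
    (contDiff_mul (𝕜 := ℝ) (n := ∞)).contMDiff.contMDiffAt (hf.prodMk_space hg)

theorem contMDiffAt_cinv {f : X → ℂ} (hf : ContMDiffAt J 𝓘(ℝ, ℂ) ∞ f x) (h : f x ≠ 0) :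
    ContMDiffAt J 𝓘(ℝ, ℂ) ∞ (fun y => (f y)⁻¹) x :=
  ((contDiffAt_inv ℝ h).contMDiffAt).comp (f := f) x hf

theorem contMDiffAt_cdiv {f g : X → ℂ} (hf : ContMDiffAt J 𝓘(ℝ, ℂ) ∞ f x)
    (hg : ContMDiffAt J 𝓘(ℝ, ℂ) ∞ g x) (h : g x ≠ 0) :
    ContMDiffAt J 𝓘(ℝ, ℂ) ∞ (fun y => f y / g y) x := by
  simp only [div_eq_mul_inv]
  exact contMDiffAt_cmul hf (contMDiffAt_cinv hg h)

theorem SmoothFrameAt.minor (hA : SmoothFrameAt J A x) (i j : Fin n) :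
    ContMDiffAt J 𝓘(ℝ, ℂ) ∞ (fun y => minor (A y) i j) x :=
  (contMDiffAt_cmul (hA i 0) (hA j 1)).sub (contMDiffAt_cmul (hA i 1) (hA j 0))

theorem SmoothFrameAt.plucker (hA : SmoothFrameAt J A x) :
    ContMDiffAt J 𝓘(ℝ, Pair n → ℂ) ∞ (fun y => plucker (A y)) x :=
  contMDiffAt_pi_space.2 fun _ => hA.minor _ _

theorem SmoothFrameAt.slope (hA : SmoothFrameAt J A x) (e : Numbering n)
    (h : (top e (A x)).det ≠ 0) :
    ContMDiffAt J 𝓘(ℝ, GrModel n) ∞ (fun y => slope e (A y)) x := by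
  have hd : ContMDiffAt J 𝓘(ℝ, ℂ) ∞ (fun y => (top e (A y)).det) x := by
    simp only [det_top_eq_minor]; exact hA.minor _ _
  have hinv : ContMDiffAt J 𝓘(ℝ, ℂ) ∞ (fun y => ((top e (A y)).det)⁻¹) x :=
    contMDiffAt_cinv hd h
  refine contMDiffAt_pi_space.2 fun i => contMDiffAt_pi_space.2 fun j => ?_
  have hadj : ∀ k, ContMDiffAt J 𝓘(ℝ, ℂ) ∞ (fun y => (top e (A y)).adjugate k j) x := by
    intro k
    fin_cases k <;> fin_cases j <;>
    simp only [Matrix.adjugate_fin_two, top] <;>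
    first | exact hA _ _ | exact (hA _ _).neg
  have hterm : ∀ k, ContMDiffAt J 𝓘(ℝ, ℂ) ∞
      (fun y => bot e (A y) i k * (top e (A y))⁻¹ k j) x := by
    intro k
    simp only [Matrix.inv_def, Ring.inverse_eq_inv', Matrix.smul_apply, smul_eq_mul]
    exact contMDiffAt_cmul (hA _ _) (contMDiffAt_cmul hinv (hadj k))
  refine ((hterm 0).add (hterm 1)).congr_of_eventuallyEq (Eventually.of_forall fun y => ?_)
  simp only [SymplecticReduction.slope, Matrix.mul_apply, Fin.sum_univ_two, Pi.add_apply]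

/-- A map to the Grassmann manifold with a smooth frame is smooth. -/
theorem SmoothFrameAt.contMDiffAt (hA : SmoothFrameAt J A x) {G : X → Gr n}
    (hG : ∀ᶠ y in 𝓝 x, IsFrame (A y) (G y)) : ContMDiffAt J 𝓘(ℝ, GrModel n) ∞ G x := by
  obtain ⟨e, he⟩ := exists_mem_source (G x)
  have hx : (top e (A x)).det ≠ 0 := (mem_grHomeo_source_iff e hG.self_of_nhds).1 he
  -- Near `x` the map is `graph e` composed with the slope of the given frame.
  have h1 := ((contMDiff_graph e).contMDiffAt).comp x (hA.slope e hx)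
  refine h1.congr_of_eventuallyEq ?_
  have hc : ContinuousAt (fun y => (top e (A y)).det) x := by
    simp only [det_top_eq_minor]; exact (hA.minor _ _).continuousAt
  filter_upwards [hG, hc.eventually_ne hx] with y hy hy'
  exact (graph_slope_of_isFrame e hy hy').symm

end

theorem smoothFrameAt_graphFrame (e : Numbering n) (Z : GrModel n) :
    SmoothFrameAt 𝓘(ℝ, GrModel n) (graphFrame e) Z := fun i j =>
  (contDiff_graphFrame e i j).contMDiff.contMDiffAt

/-- The matrix with rescaled rows. -/
def scale (t : Fin n → ℂ) (A : Matrix (Fin n) (Fin 2) ℂ) : Matrix (Fin n) (Fin 2) ℂ :=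
  Matrix.of fun i j => t i * A i j

theorem minor_scale (t : Fin n → ℂ) (A : Matrix (Fin n) (Fin 2) ℂ) (i j : Fin n) :
    minor (scale t A) i j = t i * t j * minor A i j := by
  simp only [minor, scale, Matrix.of_apply]; ring

theorem IsFrame.scale {A : Matrix (Fin n) (Fin 2) ℂ} {L : Gr n} (hA : IsFrame A L)
    (t : Fin n → ℂˣ) : IsFrame (scale (fun i => (t i : ℂ)) A) (t • L) := by
  change LinearMap.range _ = L.1.map (diagMap t).toLinearMap
  rw [← show LinearMap.range A.mulVecLin = L.1 from hA, ← LinearMap.range_comp]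
  congr 1
  apply LinearMap.ext
  intro v
  funext i
  simp [diagMap, LinearEquiv.smulOfUnit, SymplecticReduction.scale, Matrix.mulVec, dotProduct,
    Units.smul_def, mul_assoc]

theorem IsFrame.scale_circle {A : Matrix (Fin n) (Fin 2) ℂ} {L : Gr n} (hA : IsFrame A L)
    (t : Fin n → Circle) : IsFrame (SymplecticReduction.scale (fun i => (t i : ℂ)) A) (t • L) :=
  hA.scale fun i => Circle.toUnits (t i)

theorem exists_minor_ne_zero {A : Matrix (Fin n) (Fin 2) ℂ} {L : Gr n} (hA : IsFrame A L) :
    ∃ i j, minor A i j ≠ 0 := by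
  obtain ⟨e, he⟩ := exists_mem_source L
  have := (mem_grHomeo_source_iff e hA).1 he
  rw [det_top_eq_minor] at this
  exact ⟨_, _, this⟩

theorem exists_plucker_ne_zero {A : Matrix (Fin n) (Fin 2) ℂ} {L : Gr n} (hA : IsFrame A L) :
    ∃ I, plucker A I ≠ 0 := by
  obtain ⟨i, j, h⟩ := exists_minor_ne_zero hA
  rcases lt_trichotomy i j with hij | rfl | hij
  · exact ⟨⟨(i, j), hij⟩, h⟩
  · exact absurd (minor_self A i) h
  · exact ⟨⟨(j, i), hij⟩, by rw [plucker_eq_minor, minor_swap]; simpa using h⟩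

/-! ### The Fubini–Study form -/

theorem dotProduct_star_self_eq {ι : Type*} [Fintype ι] (z : ι → ℂ) :
    dotProduct z (star z) = ((∑ i, ‖z i‖ ^ 2 : ℝ) : ℂ) := by
  simp [dotProduct, Complex.mul_conj, Complex.normSq_eq_norm_sq]

theorem dotProduct_star_self_ne_zero {ι : Type*} [Fintype ι] {z : ι → ℂ} (hz : z ≠ 0) :
    dotProduct z (star z) ≠ 0 := by
  rw [dotProduct_star_self_eq]
  obtain ⟨i, hi⟩ := Function.ne_iff.1 hz
  have : 0 < ∑ i, ‖z i‖ ^ 2 := Finset.sum_pos' (fun _ _ => by positivity)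
    ⟨i, Finset.mem_univ _, by have := norm_pos_iff.2 hi; positivity⟩
  exact_mod_cast this.ne'

/-- Rescaling `z`, `a` and `b` multiplies all products by |c|², and the components of the vectors
along `z` cancel between the two terms. So the form lives on projective space, and any frame may be
used to compute it. -/
theorem fubiniStudy_gauge {ι : Type*} [Fintype ι] (z a b : ι → ℂ) (c α β : ℂ) (hc : c ≠ 0)
    (hz : z ≠ 0) : fubiniStudy (c • z) (c • a + α • z) (c • b + β • z) = fubiniStudy z a b := by
  have hN := dotProduct_star_self_ne_zero hz
  have hc' : star c ≠ 0 := by simpa using hc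
  simp only [fubiniStudy, star_add, star_smul, add_dotProduct, dotProduct_add, smul_dotProduct,
    dotProduct_smul, smul_eq_mul]
  congr 2
  field_simp
  ring

/-! ### Velocities of families of planes, computed from frames -/

section
variable {X : Type*} [NormedAddCommGroup X] [NormedSpace ℝ X]

/-- Tangent vectors at a plane are written in the preferred chart there, so this is the derivative
of the chart expression, and `slope` takes the same value on every frame of a plane. -/
theorem mfderiv_eq_fderiv_slope {A : X → Matrix (Fin n) (Fin 2) ℂ} {G : X → Gr n} {x : X}
    (hA : SmoothFrameAt 𝓘(ℝ, X) A x) (hG : ∀ᶠ y in 𝓝 x, IsFrame (A y) (G y)) :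
    (mfderiv 𝓘(ℝ, X) 𝓘(ℝ, GrModel n) G x : X → GrModel n)
      = fderiv ℝ (fun y => slope (chartIndex (G x)) (A y)) x := by
  have h : MDifferentiableAt 𝓘(ℝ, X) 𝓘(ℝ, GrModel n) G x :=
    (hA.contMDiffAt hG).mdifferentiableAt (by simp)
  have h1 : fderivWithin ℝ (writtenInExtChartAt 𝓘(ℝ, X) 𝓘(ℝ, GrModel n) x G)
      (Set.range 𝓘(ℝ, X)) (extChartAt 𝓘(ℝ, X) x x)
      = fderiv ℝ (fun y => slope (chartIndex (G x)) (frame (G y))) x := by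
    simp only [modelWithCornersSelf_coe, Set.range_id, fderivWithin_univ]
    rfl
  refine congrArg (fun D : X →L[ℝ] GrModel n => (D : X → GrModel n)) (h.mfderiv.trans (h1.trans ?_))
  refine Filter.EventuallyEq.fderiv_eq ?_
  filter_upwards [hG] with y hy
  exact (isFrame_frame (G y)).slope_eq _ hy

theorem SmoothFrameAt.contDiffAt_plucker {A : X → Matrix (Fin n) (Fin 2) ℂ} {x : X}
    (hA : SmoothFrameAt 𝓘(ℝ, X) A x) : ContDiffAt ℝ ∞ (fun y => SymplecticReduction.plucker (A y)) x :=
  hA.plucker.contDiffAt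

theorem contDiff_pluckerLift (e : Numbering n) : ContDiff ℝ ∞ (pluckerLift e) :=
  contDiff_iff_contDiffAt.2 fun Z => (smoothFrameAt_graphFrame e Z).contDiffAt_plucker

theorem pluckerLift_ne_zero (e : Numbering n) (Z : GrModel n) : pluckerLift e Z ≠ 0 := by
  obtain ⟨I, hI⟩ := exists_plucker_ne_zero (isFrame_graphFrame e Z)
  exact fun h => hI (congrFun h I)

/-- The Plücker lift in the chart is the Plücker vector of the frame divided by one minor. The
product rule then gives the rescaled derivative plus a multiple of the Plücker vector, which
`fubiniStudy_gauge` discards. -/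
theorem fderiv_pluckerLift_mfderiv {A : X → Matrix (Fin n) (Fin 2) ℂ} {G : X → Gr n} {x : X}
    (hA : SmoothFrameAt 𝓘(ℝ, X) A x) (hG : ∀ᶠ y in 𝓝 x, IsFrame (A y) (G y)) (u : X) :
    ∃ α : ℂ, fderiv ℝ (pluckerLift (chartIndex (G x))) (slope (chartIndex (G x)) (A x))
        (mfderiv 𝓘(ℝ, X) 𝓘(ℝ, GrModel n) G x u)
      = ((top (chartIndex (G x)) (A x)).det)⁻¹ • fderiv ℝ (fun y => plucker (A y)) x u
        + α • plucker (A x) := by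
  set e := chartIndex (G x) with he
  have hdet : (top e (A x)).det ≠ 0 :=
    (mem_grHomeo_source_iff e hG.self_of_nhds).1 (mem_chart_source (GrModel n) (G x))
  have hd : ContDiffAt ℝ ∞ (fun y => (top e (A y)).det) x := by
    simp only [det_top_eq_minor]; exact (hA.minor _ _).contDiffAt
  have hdi : DifferentiableAt ℝ (fun y => ((top e (A y)).det)⁻¹) x :=
    (hd.inv hdet).differentiableAt (by simp)
  have hP := (hA.contDiffAt_plucker).differentiableAt (by simp)
  have hs : DifferentiableAt ℝ (fun y => slope e (A y)) x :=
    (hA.slope e hdet).contDiffAt.differentiableAt (by simp)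
  have hL : DifferentiableAt ℝ (pluckerLift e) (slope e (A x)) :=
    (contDiff_pluckerLift e).differentiable (by simp) _
  refine ⟨fderiv ℝ (fun y => ((top e (A y)).det)⁻¹) x u, ?_⟩
  have h1 : fderiv ℝ (fun y => pluckerLift e (slope e (A y))) x
      = fderiv ℝ (fun y => ((top e (A y)).det)⁻¹ • plucker (A y)) x := by
    refine Filter.EventuallyEq.fderiv_eq ?_
    filter_upwards [hd.continuousAt.eventually_ne hdet] with y hy
    exact pluckerLift_slope e (A y) hy
  have h2 : fderiv ℝ (fun y => pluckerLift e (slope e (A y))) x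
      = (fderiv ℝ (pluckerLift e) (slope e (A x))).comp (fderiv ℝ (fun y => slope e (A y)) x) :=
    fderiv_comp (g := pluckerLift e) x hL hs
  have h3 := congrFun (mfderiv_eq_fderiv_slope hA hG) u
  rw [fderiv_fun_smul hdi hP] at h1
  have h4 := DFunLike.congr_fun (h2.symm.trans h1) u
  simp only [ContinuousLinearMap.comp_apply, add_apply,
    smul_apply, ContinuousLinearMap.smulRight_apply] at h4
  rw [← h4]
  exact congrArg _ h3

/-- The form of the Grassmann manifold on the velocities of families of planes with a frame. -/
theorem grForm_mfderiv {Y : Type*} [NormedAddCommGroup Y] [NormedSpace ℝ Y]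
    {A : X → Matrix (Fin n) (Fin 2) ℂ} {G : X → Gr n} {x : X}
    (hA : SmoothFrameAt 𝓘(ℝ, X) A x) (hG : ∀ᶠ y in 𝓝 x, IsFrame (A y) (G y))
    {B : Y → Matrix (Fin n) (Fin 2) ℂ} {H : Y → Gr n} {y : Y}
    (hB : SmoothFrameAt 𝓘(ℝ, Y) B y) (hH : ∀ᶠ z in 𝓝 y, IsFrame (B z) (H z))
    (hAB : B y = A x) {p : Gr n} (hp : G x = p) (u : X) (w : Y) :
    grForm n p (mfderiv 𝓘(ℝ, X) 𝓘(ℝ, GrModel n) G x u : GrModel n)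
        (mfderiv 𝓘(ℝ, Y) 𝓘(ℝ, GrModel n) H y w : GrModel n)
      = fubiniStudy (plucker (A x)) (fderiv ℝ (fun x => plucker (A x)) x u)
        (fderiv ℝ (fun y => plucker (B y)) y w) := by
  subst hp
  have hGH : H y = G x := (hAB ▸ hH.self_of_nhds).unique hG.self_of_nhds
  obtain ⟨α, hα⟩ := fderiv_pluckerLift_mfderiv hA hG u
  obtain ⟨β, hβ⟩ := fderiv_pluckerLift_mfderiv hB hH w
  rw [hGH, hAB] at hβ
  set e := chartIndex (G x) with he
  have hdet : (top e (A x)).det ≠ 0 :=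
    (mem_grHomeo_source_iff e hG.self_of_nhds).1 (mem_chart_source (GrModel n) (G x))
  have hslope : grChart e (G x) = slope e (A x) :=
    (isFrame_frame (G x)).slope_eq e hG.self_of_nhds
  have hz : plucker (A x) ≠ 0 := by
    obtain ⟨I, hI⟩ := exists_plucker_ne_zero hG.self_of_nhds
    exact fun h => hI (congrFun h I)
  change fubiniStudy (pluckerLift e (grChart e (G x)))
    (fderiv ℝ (pluckerLift e) (grChart e (G x)) _)
    (fderiv ℝ (pluckerLift e) (grChart e (G x)) _) = _
  rw [hslope]
  refine (congrArg₂ (fubiniStudy (pluckerLift e (slope e (A x)))) hα hβ).trans ?_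
  rw [pluckerLift_slope e _ hdet]
  exact fubiniStudy_gauge _ _ _ _ _ _ (inv_ne_zero hdet) hz

/-- Reduces smoothness and closedness on the Grassmann manifold to pullbacks of the Fubini–Study
form to a vector space. -/
theorem chartCoeff_grForm (e : Numbering n) (u v : GrModel n) (Z : GrModel n) :
    chartCoeff (grForm n) (grHomeo e) u v Z
      = fubiniStudy (pluckerLift e Z) (fderiv ℝ (pluckerLift e) Z u)
        (fderiv ℝ (pluckerLift e) Z v) :=
  grForm_mfderiv (G := graph e) (H := graph e) (smoothFrameAt_graphFrame e Z)
    (Eventually.of_forall fun _ => isFrame_graphFrame e _) (smoothFrameAt_graphFrame e Z)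
    (Eventually.of_forall fun _ => isFrame_graphFrame e _) rfl rfl u v

/-! ### Closedness of pullbacks of the Fubini–Study form -/

variable {ι : Type*} [Fintype ι]

/-- The hermitian product is smooth. -/
theorem contDiffAt_dotProduct_star {P Q : X → ι → ℂ} {x : X} (hP : ContDiffAt ℝ ∞ P x)
    (hQ : ContDiffAt ℝ ∞ Q x) : ContDiffAt ℝ ∞ (fun y => dotProduct (P y) (star (Q y))) x := by
  simp only [dotProduct, Pi.star_apply, Complex.star_def]
  refine ContDiffAt.sum fun i _ => ?_
  exact (contDiffAt_pi.1 hP i).mul (Complex.conjCLE.contDiff.contDiffAt.comp x (contDiffAt_pi.1 hQ i))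

theorem fderiv_dotProduct_star {P Q : X → ι → ℂ} {x : X} (hP : DifferentiableAt ℝ P x)
    (hQ : DifferentiableAt ℝ Q x) (v : X) :
    fderiv ℝ (fun y => dotProduct (P y) (star (Q y))) x v
      = dotProduct (fderiv ℝ P x v) (star (Q x)) + dotProduct (P x) (star (fderiv ℝ Q x v)) := by
  have h : ∀ i, HasFDerivAt (fun y => P y i * star (Q y i)) _ x := fun i =>
    ((hasFDerivAt_pi'.1 hP.hasFDerivAt i).mul
      (Complex.conjCLE.toContinuousLinearMap.hasFDerivAt.comp x (hasFDerivAt_pi'.1 hQ.hasFDerivAt i)))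
  have h2 := HasFDerivAt.fun_sum (u := Finset.univ) fun i _ => h i
  simp only [dotProduct, Pi.star_apply]
  rw [h2.fderiv]
  simp only [sum_apply, ← Finset.sum_add_distrib]
  refine Finset.sum_congr rfl fun i _ => ?_
  simp [mul_comm, add_comm]

/-- The local potential of the pulled back Fubini–Study form. -/
def potential (P : X → ι → ℂ) (u : X) (y : X) : ℝ :=
  (dotProduct (fderiv ℝ P y u) (star (P y)) / dotProduct (P y) (star (P y))).im

theorem dotProduct_star_comm (a b : ι → ℂ) :
    dotProduct a (star b) = star (dotProduct b (star a)) := by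
  simp [dotProduct, mul_comm]

theorem contDiffAt_potential {P : X → ι → ℂ} {x : X} (hP : ContDiffAt ℝ ∞ P x) (h0 : P x ≠ 0)
    (u : X) : ContDiffAt ℝ ∞ (potential P u) x := by
  have h1 : ContDiffAt ℝ ∞ (fun y => fderiv ℝ P y u) x :=
    (hP.fderiv_right (by simp)).clm_apply contDiffAt_const
  have h2 := (contDiffAt_dotProduct_star h1 hP).mul
    ((contDiffAt_dotProduct_star hP hP).inv (dotProduct_star_self_ne_zero h0))
  exact Complex.imCLM.contDiff.contDiffAt.comp x h2

theorem isSymm_fderiv_fderiv {F : Type*} [NormedAddCommGroup F] [NormedSpace ℝ F] {f : X → F}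
    {x : X} (hf : ContDiffAt ℝ ∞ f x) (u v : X) :
    fderiv ℝ (fun y => fderiv ℝ f y u) x v = fderiv ℝ (fun y => fderiv ℝ f y v) x u := by
  have hd : DifferentiableAt ℝ (fderiv ℝ f) x :=
    (hf.fderiv_right (m := ∞) (by simp)).differentiableAt (by simp)
  have h1 : ∀ a, fderiv ℝ (fun y => fderiv ℝ f y a) x = (fderiv ℝ (fderiv ℝ f) x).flip a := by
    intro a
    rw [fderiv_clm_apply hd (differentiableAt_const a)]
    ext w
    simp
  rw [h1, h1]
  exact ((hf.isSymmSndFDerivAt (by simpa using WithTop.coe_le_coe.2 (le_top : (2 : ℕ∞) ≤ ⊤))).eq v u)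

theorem fderiv_potential {P : X → ι → ℂ} {x : X} (hP : ContDiffAt ℝ ∞ P x) (h0 : P x ≠ 0)
    (u v : X) :
    fderiv ℝ (potential P u) x v
      = ((dotProduct (fderiv ℝ (fun y => fderiv ℝ P y u) x v) (star (P x))
          + dotProduct (fderiv ℝ P x u) (star (fderiv ℝ P x v))) / dotProduct (P x) (star (P x))
        - dotProduct (fderiv ℝ P x u) (star (P x)) * (dotProduct (fderiv ℝ P x v) (star (P x))
          + dotProduct (P x) (star (fderiv ℝ P x v))) / dotProduct (P x) (star (P x)) ^ 2).im := by
  have hPd := hP.differentiableAt (by simp : (∞ : WithTop ℕ∞) ≠ 0)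
  have h1 : DifferentiableAt ℝ (fun y => fderiv ℝ P y u) x :=
    ((hP.fderiv_right (m := ∞) (by simp)).clm_apply contDiffAt_const).differentiableAt (by simp)
  have hN0 := dotProduct_star_self_ne_zero h0
  have hn : DifferentiableAt ℝ (fun y => dotProduct (fderiv ℝ P y u) (star (P y))) x :=
    (contDiffAt_dotProduct_star ((hP.fderiv_right (m := ∞) (by simp)).clm_apply contDiffAt_const)
      hP).differentiableAt (by simp)
  have hN : DifferentiableAt ℝ (fun y => dotProduct (P y) (star (P y))) x :=
    (contDiffAt_dotProduct_star hP hP).differentiableAt (by simp)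
  have h2 := hn.hasFDerivAt.mul ((hasDerivAt_inv hN0).hasFDerivAt.restrictScalars ℝ |>.comp x hN.hasFDerivAt)
  have h3 := (Complex.imCLM.hasFDerivAt.comp x h2).fderiv
  rw [show fderiv ℝ (potential P u) x = _ from h3]
  simp only [ContinuousLinearMap.comp_apply, Complex.imCLM_apply]
  congr 1
  simp only [add_apply, smul_apply, smul_eq_mul,
    ContinuousLinearMap.comp_apply]
  rw [fderiv_dotProduct_star h1 hPd, fderiv_dotProduct_star hPd hPd]
  simp
  field_simp
  ring

/-- The pulled back form is minus the exterior derivative of the one-form `potential P`: the second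
derivatives of `P` cancel by symmetry, and the remaining terms pair up with their conjugates, which
accounts for the factor 2. -/
theorem fubiniStudy_eq_potential {P : X → ι → ℂ} {x : X} (hP : ContDiffAt ℝ ∞ P x) (h0 : P x ≠ 0)
    (u v : X) : fubiniStudy (P x) (fderiv ℝ P x u) (fderiv ℝ P x v)
      = fderiv ℝ (potential P u) x v - fderiv ℝ (potential P v) x u := by
  rw [fderiv_potential hP h0, fderiv_potential hP h0, isSymm_fderiv_fderiv hP v u, fubiniStudy]
  rw [dotProduct_star_comm (fderiv ℝ P x v) (fderiv ℝ P x u),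
    dotProduct_star_comm (P x) (fderiv ℝ P x u), dotProduct_star_comm (P x) (fderiv ℝ P x v)]
  rw [dotProduct_star_self_eq]
  generalize (∑ i, ‖P x i‖ ^ 2 : ℝ) = N
  generalize dotProduct (fderiv ℝ P x u) (star (fderiv ℝ P x v)) = a
  generalize dotProduct (fderiv ℝ P x u) (star (P x)) = b
  generalize dotProduct (fderiv ℝ P x v) (star (P x)) = c
  generalize dotProduct (fderiv ℝ (fun y => fderiv ℝ P y u) x v) (star (P x)) = d
  rw [← Complex.ofReal_pow]
  simp only [Complex.sub_im, Complex.div_ofReal_im, Complex.add_im, Complex.mul_im, Complex.add_re,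
    Complex.star_def, Complex.conj_re, Complex.conj_im]
  ring

theorem contDiffAt_fubiniStudy {P : X → ι → ℂ} {x : X} (hP : ContDiffAt ℝ ∞ P x) (h0 : P x ≠ 0)
    (u v : X) :
    ContDiffAt ℝ ∞ (fun y => fubiniStudy (P y) (fderiv ℝ P y u) (fderiv ℝ P y v)) x := by
  have h1 : ∀ u, ContDiffAt ℝ ∞ (fun y => fderiv ℝ P y u) x := fun u =>
    (hP.fderiv_right (by simp)).clm_apply contDiffAt_const
  have hN := contDiffAt_dotProduct_star hP hP
  have hN0 := dotProduct_star_self_ne_zero h0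
  have h2 := ((contDiffAt_dotProduct_star (h1 u) (h1 v)).mul (hN.inv hN0)).sub
    (((contDiffAt_dotProduct_star (h1 u) hP).mul (contDiffAt_dotProduct_star hP (h1 v))).mul
      ((hN.pow 2).inv (pow_ne_zero 2 hN0)))
  exact contDiffAt_const.mul (Complex.imCLM.contDiff.contDiffAt.comp x h2)

/-- An exact form is closed: the six second derivatives of the potentials cancel in pairs. -/
theorem fubiniStudy_closed {P : X → ι → ℂ} {x : X} (hP : ∀ᶠ y in 𝓝 x, ContDiffAt ℝ ∞ P y)
    (h0 : P x ≠ 0) (u v w : X) :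
    fderiv ℝ (fun y => fubiniStudy (P y) (fderiv ℝ P y v) (fderiv ℝ P y w)) x u
      + fderiv ℝ (fun y => fubiniStudy (P y) (fderiv ℝ P y w) (fderiv ℝ P y u)) x v
      + fderiv ℝ (fun y => fubiniStudy (P y) (fderiv ℝ P y u) (fderiv ℝ P y v)) x w = 0 := by
  have hPx := hP.self_of_nhds
  have hne := hPx.continuousAt.eventually_ne h0
  have hp : ∀ u, ContDiffAt ℝ ∞ (potential P u) x := contDiffAt_potential hPx h0
  have hd : ∀ u v, DifferentiableAt ℝ (fun y => fderiv ℝ (potential P u) y v) x := fun u v =>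
    (((hp u).fderiv_right (m := ∞) (by simp)).clm_apply contDiffAt_const).differentiableAt (by simp)
  have key : ∀ u v w, fderiv ℝ (fun y => fubiniStudy (P y) (fderiv ℝ P y v) (fderiv ℝ P y w)) x u
      = fderiv ℝ (fun y => fderiv ℝ (potential P v) y w) x u
        - fderiv ℝ (fun y => fderiv ℝ (potential P w) y v) x u := by
    intro u v w
    rw [← sub_apply, ← fderiv_fun_sub (hd v w) (hd w v)]
    congr 1
    refine Filter.EventuallyEq.fderiv_eq ?_
    filter_upwards [hP, hne] with y hy hy0
    exact fubiniStudy_eq_potential hy hy0 v w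
  rw [key, key, key, isSymm_fderiv_fderiv (hp v) w u, isSymm_fderiv_fderiv (hp w) v u,
    isSymm_fderiv_fderiv (hp u) w v]
  ring

end

/-! ### The form of the Grassmann manifold is symplectic -/

theorem fubiniStudy_self {ι : Type*} [Fintype ι] (z a : ι → ℂ) : fubiniStudy z a a = 0 := by
  rw [fubiniStudy, dotProduct_star_comm z a, dotProduct_star_self_eq, dotProduct_star_self_eq,
    Complex.star_def, Complex.mul_conj, ← Complex.ofReal_pow, ← Complex.ofReal_div,
    ← Complex.ofReal_div, ← Complex.ofReal_sub, Complex.ofReal_im, mul_zero]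

/-- The Fubini–Study metric is positive: by Cauchy–Schwarz in its explicit form. -/
theorem eq_smul_of_fubiniStudy_I {ι : Type*} [Fintype ι] {z a : ι → ℂ} (hz : z ≠ 0)
    (h : fubiniStudy z a (Complex.I • a) = 0) : ∃ c : ℂ, a = c • z := by
  have hN := dotProduct_star_self_ne_zero hz
  refine ⟨dotProduct a (star z) / dotProduct z (star z), ?_⟩
  -- `c • z` is the hermitian projection of `a` to the line of `z`; the form on (a, i a) is a
  -- multiple of the squared norm of the remainder.
  set c := dotProduct a (star z) / dotProduct z (star z) with hc
  have hb : dotProduct (a - c • z) (star (a - c • z))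
      = dotProduct a (star a) - dotProduct a (star z) * dotProduct z (star a)
        / dotProduct z (star z) := by
    have hs : star c = dotProduct z (star a) / dotProduct z (star z) := by
      rw [hc, star_div₀, ← dotProduct_star_comm, ← dotProduct_star_comm]
    simp only [star_sub, star_smul, sub_dotProduct, dotProduct_sub, smul_dotProduct,
      dotProduct_smul, smul_eq_mul, hs]
    rw [hc]
    field_simp
    ring
  have h2 : (dotProduct (a - c • z) (star (a - c • z)) / dotProduct z (star z)).re = 0 := by
    rw [hb]
    simp only [fubiniStudy, star_smul, dotProduct_smul, smul_eq_mul, Complex.star_def,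
      Complex.conj_I] at h
    have h3 : (-Complex.I * dotProduct a (star a) / dotProduct z (star z)
      - dotProduct a (star z) * (-Complex.I * dotProduct z (star a)) / dotProduct z (star z) ^ 2)
      = -Complex.I * ((dotProduct a (star a) - dotProduct a (star z) * dotProduct z (star a)
        / dotProduct z (star z)) / dotProduct z (star z)) := by
      field_simp
      ring
    rw [h3] at h
    simpa using h
  rw [dotProduct_star_self_eq, dotProduct_star_self_eq, ← Complex.ofReal_div,
    Complex.ofReal_re] at h2
  have hN' : (∑ i, ‖z i‖ ^ 2 : ℝ) ≠ 0 := by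
    rw [dotProduct_star_self_eq] at hN; exact_mod_cast hN
  have h4 := (div_eq_zero_iff.1 h2).resolve_right hN'
  rw [Finset.sum_eq_zero_iff_of_nonneg fun _ _ => by positivity] at h4
  funext i
  have := h4 i (Finset.mem_univ i)
  simp only [Pi.sub_apply, ne_eq, OfNat.ofNat_ne_zero, not_false_eq_true, pow_eq_zero_iff,
    norm_eq_zero] at this
  exact sub_eq_zero.1 this

/-- The slope is recovered from the minors. -/
theorem minor_graphFrame_inl (e : Numbering n) (Z : GrModel n) :
    minor (graphFrame e Z) (e (Sum.inl 0)) (e (Sum.inl 1)) = 1 := by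
  rw [← det_top_eq_minor, top_graphFrame, Matrix.det_one]

theorem minor_graphFrame_zero (e : Numbering n) (Z : GrModel n) (k : Fin (n - 2)) :
    minor (graphFrame e Z) (e (Sum.inl 0)) (e (Sum.inr k)) = Z k 1 := by
  simp [minor, graphFrame]

theorem minor_graphFrame_one (e : Numbering n) (Z : GrModel n) (k : Fin (n - 2)) :
    minor (graphFrame e Z) (e (Sum.inr k)) (e (Sum.inl 1)) = Z k 0 := by
  simp [minor, graphFrame]

theorem minor_eq_of_plucker_eq {A B : Matrix (Fin n) (Fin 2) ℂ} {c : ℂ}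
    (h : ∀ I, plucker B I = c * plucker A I) (i j : Fin n) : minor B i j = c * minor A i j := by
  rcases lt_trichotomy i j with hij | rfl | hij
  · exact h ⟨(i, j), hij⟩
  · simp [minor_self]
  · rw [minor_swap B, minor_swap A]
    have := h ⟨(j, i), hij⟩
    rw [plucker_eq_minor, plucker_eq_minor] at this
    rw [this]; ring

/-- The derivative of a minor is linear over `ℂ` and given by the derivative of the Plücker lift. -/
theorem fderiv_minor_graphFrame_eq {e : Numbering n} {Z u : GrModel n} {c : ℂ}
    (h : fderiv ℝ (pluckerLift e) Z u = c • pluckerLift e Z) (i j : Fin n) :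
    fderiv ℝ (fun Z => minor (graphFrame e Z) i j) Z u = c * minor (graphFrame e Z) i j := by
  have hd := (contDiff_pluckerLift e).differentiable (by simp) Z
  have h1 : ∀ I : Pair n, fderiv ℝ (fun Z => minor (graphFrame e Z) I.1.1 I.1.2) Z u
      = c * minor (graphFrame e Z) I.1.1 I.1.2 := by
    intro I
    have h2 := (hasFDerivAt_pi'.1 hd.hasFDerivAt I).fderiv
    have h3 : fderiv ℝ (fun Z => minor (graphFrame e Z) I.1.1 I.1.2) Z u
      = fderiv ℝ (pluckerLift e) Z u I := by
      rw [show (fun Z => minor (graphFrame e Z) I.1.1 I.1.2) = fun Z => pluckerLift e Z I from rfl,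
        h2]
      rfl
    rw [h3, h]
    rfl
  rcases lt_trichotomy i j with hij | rfl | hij
  · exact h1 ⟨(i, j), hij⟩
  · simp [minor_self]
  · have := h1 ⟨(j, i), hij⟩
    simp only [minor_swap _ i j]
    rw [fderiv_fun_neg, neg_apply, this]
    ring

/-- The Plücker map to projective space is an immersion: one minor is identically 1, which forces `c
= 0`, and the entries of `Z` are themselves minors. -/
theorem eq_zero_of_fderiv_pluckerLift {e : Numbering n} {Z u : GrModel n} {c : ℂ}
    (h : fderiv ℝ (pluckerLift e) Z u = c • pluckerLift e Z) : u = 0 := by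
  have h1 := fderiv_minor_graphFrame_eq h
  have hc : c = 0 := by
    have := h1 (e (Sum.inl 0)) (e (Sum.inl 1))
    simp only [minor_graphFrame_inl] at this
    simpa using this.symm
  subst hc
  have hcoord : ∀ k j, fderiv ℝ (fun Z : GrModel n => Z k j) Z u = u k j := by
    intro k j
    have : HasFDerivAt (fun Z : GrModel n => Z k j)
      ((ContinuousLinearMap.proj (R := ℝ) (φ := fun _ : Fin 2 => ℂ) j).comp
        (ContinuousLinearMap.proj (R := ℝ) (φ := fun _ : Fin (n - 2) => Fin 2 → ℂ) k)) Z :=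
      ((ContinuousLinearMap.proj (R := ℝ) (φ := fun _ : Fin 2 => ℂ) j).comp
        (ContinuousLinearMap.proj (R := ℝ) (φ := fun _ : Fin (n - 2) => Fin 2 → ℂ) k)).hasFDerivAt
    rw [this.fderiv]
    rfl
  funext k j
  rw [← hcoord]
  fin_cases j
  · have := h1 (e (Sum.inr k)) (e (Sum.inl 1))
    simp only [minor_graphFrame_one] at this
    simpa using this
  · have := h1 (e (Sum.inl 0)) (e (Sum.inr k))
    simp only [minor_graphFrame_zero] at this
    simpa using this

/-- A differentiable map which is complex differentiable has a complex linear real derivative. -/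
theorem fderiv_pluckerLift_I_smul (e : Numbering n) (Z u : GrModel n) :
    fderiv ℝ (pluckerLift e) Z (Complex.I • u) = Complex.I • fderiv ℝ (pluckerLift e) Z u := by
  have hc : ∀ i j, Differentiable ℂ fun Z : GrModel n => graphFrame e Z i j := by
    intro i j
    obtain ⟨k, rfl⟩ := e.surjective i
    rcases k with k | k
    · simp only [graphFrame, Matrix.submatrix_apply, Equiv.symm_apply_apply,
        Matrix.fromRows_apply_inl]
      exact differentiable_const _
    · simp only [graphFrame, Matrix.submatrix_apply, Equiv.symm_apply_apply,
        Matrix.fromRows_apply_inr, Matrix.of_apply, id]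
      fun_prop
  have hd : Differentiable ℂ (pluckerLift e) := by
    refine differentiable_pi.2 fun I => ?_
    exact ((hc _ _).mul (hc _ _)).sub ((hc _ _).mul (hc _ _))
  have := (hd Z).fderiv_restrictScalars ℝ
  rw [this]
  simp

/-- Testing against `i u` turns the form into the Fubini–Study metric, because the Plücker lift is
holomorphic. -/
theorem grForm_nondegenerate (p : Gr n) (u : GrModel n) (h : ∀ v : GrModel n, grForm n p u v = 0) :
    u = 0 := by
  have h1 := h (Complex.I • u)
  change fubiniStudy _ _ (fderiv ℝ (pluckerLift (chartIndex p)) _ (Complex.I • u)) = 0 at h1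
  rw [fderiv_pluckerLift_I_smul] at h1
  obtain ⟨c, hc⟩ := eq_smul_of_fubiniStudy_I (pluckerLift_ne_zero _ _) h1
  exact eq_zero_of_fderiv_pluckerLift hc

theorem isSymplecticForm_grForm (n : ℕ) : IsSymplecticForm (grForm n) where
  alternating p u := fubiniStudy_self _ _
  smooth := by
    intro E hE u v
    obtain ⟨e, rfl⟩ := (mem_atlas_iff E).1 hE
    refine ContDiff.contDiffOn (contDiff_iff_contDiffAt.2 fun Z => ?_)
    rw [funext (chartCoeff_grForm e u v)]
    exact contDiffAt_fubiniStudy (contDiff_pluckerLift e).contDiffAt (pluckerLift_ne_zero e Z) u v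
  closed := by
    intro E hE Z _ u v w
    obtain ⟨e, rfl⟩ := (mem_atlas_iff E).1 hE
    simp only [funext (chartCoeff_grForm e _ _)]
    exact fubiniStudy_closed (Eventually.of_forall fun _ => (contDiff_pluckerLift e).contDiffAt)
      (pluckerLift_ne_zero e Z) u v w
  nondegenerate p u h := grForm_nondegenerate p u h

/-! ### The Grassmann manifold is compact and Hausdorff -/

theorem minor_eq_det_mul (e : Numbering n) (A : Matrix (Fin n) (Fin 2) ℂ)
    (h : (top e A).det ≠ 0) (i j : Fin n) :
    minor A i j = (top e A).det * minor (graphFrame e (slope e A)) i j := by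
  conv_lhs => rw [← mul_top_eq e A h, minor_mul]

theorem slope_apply_zero (e : Numbering n) (A : Matrix (Fin n) (Fin 2) ℂ)
    (h : (top e A).det ≠ 0) (k : Fin (n - 2)) :
    slope e A k 0 = minor A (e (Sum.inr k)) (e (Sum.inl 1)) / (top e A).det := by
  rw [minor_eq_det_mul e A h, minor_graphFrame_one, mul_div_cancel_left₀ _ h]

theorem slope_apply_one (e : Numbering n) (A : Matrix (Fin n) (Fin 2) ℂ)
    (h : (top e A).det ≠ 0) (k : Fin (n - 2)) :
    slope e A k 1 = minor A (e (Sum.inl 0)) (e (Sum.inr k)) / (top e A).det := by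
  rw [minor_eq_det_mul e A h, minor_graphFrame_zero, mul_div_cancel_left₀ _ h]

/-- A plane is determined by its Plücker coordinates. -/
theorem eq_of_plucker_eq {A B : Matrix (Fin n) (Fin 2) ℂ} {L M : Gr n} (hA : IsFrame A L)
    (hB : IsFrame B M) {c : ℂ} (hc : c ≠ 0) (h : ∀ I, plucker B I = c * plucker A I) : L = M := by
  have hm := minor_eq_of_plucker_eq h
  obtain ⟨e, he⟩ := exists_mem_source L
  have hA0 := (mem_grHomeo_source_iff e hA).1 he
  have hdet : (top e B).det = c * (top e A).det := by
    rw [det_top_eq_minor, det_top_eq_minor, hm]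
  have hB0 : (top e B).det ≠ 0 := by rw [hdet]; exact mul_ne_zero hc hA0
  rw [← graph_slope_of_isFrame e hA hA0, ← graph_slope_of_isFrame e hB hB0]
  congr 1
  funext k j
  fin_cases j
  · change slope e A k 0 = slope e B k 0
    rw [slope_apply_zero e A hA0, slope_apply_zero e B hB0, hm, hdet, mul_div_mul_left _ _ hc]
  · change slope e A k 1 = slope e B k 1
    rw [slope_apply_one e A hA0, slope_apply_one e B hB0, hm, hdet, mul_div_mul_left _ _ hc]

theorem plucker_ne_zero {A : Matrix (Fin n) (Fin 2) ℂ} {L : Gr n} (hA : IsFrame A L) :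
    plucker A ≠ 0 := by
  obtain ⟨I, hI⟩ := exists_plucker_ne_zero hA
  exact fun h => hI (congrFun h I)

theorem sum_norm_sq_pos {ι : Type*} [Fintype ι] {z : ι → ℂ} (hz : z ≠ 0) :
    0 < ∑ i, ‖z i‖ ^ 2 := by
  obtain ⟨i, hi⟩ := Function.ne_iff.1 hz
  exact Finset.sum_pos' (fun _ _ => by positivity)
    ⟨i, Finset.mem_univ _, by have := norm_pos_iff.2 hi; positivity⟩

/-- The hermitian projection to the line of the Plücker vector. -/
def pluckerProj (L : Gr n) (I J : Pair n) : ℂ :=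
  plucker (frame L) I * star (plucker (frame L) J) / dotProduct (plucker (frame L)) (star (plucker (frame L)))

theorem pluckerProj_eq {A : Matrix (Fin n) (Fin 2) ℂ} {L : Gr n} (hA : IsFrame A L) (I J : Pair n) :
    pluckerProj L I J = plucker A I * star (plucker A J) / dotProduct (plucker A) (star (plucker A)) := by
  obtain ⟨g, hg, rfl⟩ := (isFrame_frame L).exists_mul hA
  have h0 : g.det ≠ 0 := hg.ne_zero
  have h1 : star g.det ≠ 0 := by simpa using h0
  have h2 := dotProduct_star_self_ne_zero (plucker_ne_zero (isFrame_frame L))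
  have h3 : plucker (frame L * g) = g.det • plucker (frame L) := funext fun I => plucker_mul _ _ I
  simp only [pluckerProj, h3, Pi.smul_apply, smul_eq_mul, star_mul', star_smul, smul_dotProduct,
    dotProduct_smul]
  field_simp

theorem continuous_pluckerProj : Continuous (pluckerProj (n := n)) := by
  have h : ContMDiff 𝓘(ℝ, GrModel n) 𝓘(ℝ, Pair n → Pair n → ℂ) ∞ (pluckerProj (n := n)) := by
    intro L
    obtain ⟨e, Z, rfl⟩ := exists_graph_eq L
    refine contMDiffAt_of_comp_graph ?_
    simp only [funext fun Z => funext fun I => funext fun J =>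
      pluckerProj_eq (isFrame_graphFrame e Z) I J]
    refine contMDiffAt_pi_space.2 fun I => contMDiffAt_pi_space.2 fun J => ?_
    have hP := (smoothFrameAt_graphFrame e Z).contDiffAt_plucker
    have hI := contDiffAt_pi.1 hP I
    have hJ := Complex.conjCLE.contDiff.contDiffAt.comp Z (contDiffAt_pi.1 hP J)
    exact (ContDiffAt.mul (hI.mul hJ) ((contDiffAt_dotProduct_star hP hP).inv
      (dotProduct_star_self_ne_zero (plucker_ne_zero (isFrame_graphFrame e Z))))).contMDiffAt
  exact h.continuous

/-- A nonzero column of the projection matrix is a multiple of the Plücker vector, which determines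
the plane. This embeds the Grassmann manifold in a Hausdorff space. -/
theorem injective_pluckerProj : Function.Injective (pluckerProj (n := n)) := by
  intro L M h
  have hL := isFrame_frame L
  have hM := isFrame_frame M
  have hNL := dotProduct_star_self_ne_zero (plucker_ne_zero hL)
  have hNM := dotProduct_star_self_ne_zero (plucker_ne_zero hM)
  obtain ⟨J, hJ⟩ := exists_plucker_ne_zero hL
  have hJ' : star (plucker (frame L) J) ≠ 0 := by simpa using hJ
  have h1 : ∀ I, plucker (frame L) I * star (plucker (frame L) J)
        / dotProduct (plucker (frame L)) (star (plucker (frame L)))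
      = plucker (frame M) I * star (plucker (frame M) J)
        / dotProduct (plucker (frame M)) (star (plucker (frame M))) := fun I =>
    congrFun (congrFun h I) J
  have hJM : star (plucker (frame M) J) ≠ 0 := by
    intro h0
    have := h1 J
    rw [h0, mul_zero, zero_div] at this
    exact div_ne_zero (mul_ne_zero hJ hJ') hNL this
  refine eq_of_plucker_eq hL hM (c := star (plucker (frame L) J)
    / dotProduct (plucker (frame L)) (star (plucker (frame L)))
    * dotProduct (plucker (frame M)) (star (plucker (frame M))) / star (plucker (frame M) J))
    (div_ne_zero (mul_ne_zero (div_ne_zero hJ' hNL) hNM) hJM) fun I => ?_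
  have := h1 I
  field_simp at this ⊢
  linear_combination -this

instance (n : ℕ) : T2Space (Gr n) :=
  T2Space.of_injective_continuous injective_pluckerProj continuous_pluckerProj

/-- Take as pivot the minor of largest absolute value: the entries of the slope are quotients of
other minors by it. Finitely many compact balls therefore cover the manifold. -/
theorem exists_norm_slope_le_one (L : Gr n) : ∃ e : Numbering n, ∃ Z : GrModel n,
    Z ∈ Metric.closedBall 0 1 ∧ graph e Z = L := by
  have hA := isFrame_frame L
  obtain ⟨i₀, j₀, h0⟩ := exists_minor_ne_zero hA
  have : Nonempty (Fin n × Fin n) := ⟨(i₀, j₀)⟩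
  obtain ⟨⟨i, j⟩, hmax⟩ := Finite.exists_max fun p : Fin n × Fin n => ‖minor (frame L) p.1 p.2‖
  have hpos : 0 < ‖minor (frame L) i j‖ := (norm_pos_iff.2 h0).trans_le (hmax (i₀, j₀))
  have hij : i ≠ j := by
    rintro rfl
    simp [minor_self] at hpos
  obtain ⟨e, h1, h2⟩ := exists_numbering i j hij
  have hd : (top e (frame L)).det = minor (frame L) i j := by rw [det_top_eq_minor, h1, h2]
  have hd0 : (top e (frame L)).det ≠ 0 := by rw [hd]; exact norm_pos_iff.1 hpos
  refine ⟨e, slope e (frame L), ?_, graph_slope e L hd0⟩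
  rw [mem_closedBall_zero_iff, pi_norm_le_iff_of_nonneg zero_le_one]
  intro k
  rw [pi_norm_le_iff_of_nonneg zero_le_one]
  intro c
  fin_cases c
  · change ‖slope e (frame L) k 0‖ ≤ 1
    rw [slope_apply_zero e _ hd0, norm_div, hd]
    exact (div_le_one hpos).2 (hmax (_, _))
  · change ‖slope e (frame L) k 1‖ ≤ 1
    rw [slope_apply_one e _ hd0, norm_div, hd]
    exact (div_le_one hpos).2 (hmax (_, _))

instance (n : ℕ) : CompactSpace (Gr n) where
  isCompact_univ := by
    have h : (Set.univ : Set (Gr n)) = ⋃ e : Numbering n, graph e '' Metric.closedBall 0 1 := by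
      refine (Set.eq_univ_of_forall fun L => ?_).symm
      obtain ⟨e, Z, hZ, rfl⟩ := exists_norm_slope_le_one L
      exact Set.mem_iUnion.2 ⟨e, Z, hZ, rfl⟩
    rw [h]
    exact isCompact_iUnion fun e =>
      (isCompact_closedBall _ _).image (contMDiff_graph e).continuous

/-! ### The moment map -/

/-- The linear function `v` at the vertex `Λ_I`. -/
def wt (v : Fin n → ℝ) (I : Pair n) : ℝ := v I.1.1 + v I.1.2

theorem sum_mul_vertex (v : Fin n → ℝ) (I : Pair n) : ∑ k, v k * vertex I k = wt v I := by
  have hne : I.1.1 ≠ I.1.2 := ne_of_lt I.2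
  have : ∀ k, v k * vertex I k = (if k = I.1.1 then v k else 0) + if k = I.1.2 then v k else 0 := by
    intro k
    by_cases h1 : k = I.1.1
    · have h2 : k ≠ I.1.2 := h1 ▸ hne
      simp [vertex, h1, hne]
    · simp [vertex, h1]
  simp [this, Finset.sum_add_distrib, wt]

/-- The average of `h` with weights `|zᵢ|²`. -/
def average {ι : Type*} [Fintype ι] (h : ι → ℝ) (z : ι → ℂ) : ℝ :=
  (∑ i, h i * ‖z i‖ ^ 2) / ∑ i, ‖z i‖ ^ 2

theorem momentMap_apply {L : Gr n} {A : Matrix (Fin n) (Fin 2) ℂ} (hA : IsFrame A L) (k : Fin n) :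
    momentMap L k = average (fun I => vertex I k) (plucker A) := by
  rw [momentMap_eq hA, average, div_eq_inv_mul]
  simp [mul_comm]

theorem sum_mul_momentMap {L : Gr n} {A : Matrix (Fin n) (Fin 2) ℂ} (hA : IsFrame A L)
    (v : Fin n → ℝ) : ∑ k, v k * momentMap L k = average (wt v) (plucker A) := by
  simp only [momentMap_apply hA, average, ← sum_mul_vertex, mul_div_assoc']
  rw [← Finset.sum_div]
  congr 1
  simp only [Finset.mul_sum, Finset.sum_mul]
  rw [Finset.sum_comm]
  exact Finset.sum_congr rfl fun _ _ => Finset.sum_congr rfl fun _ _ => by ring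

theorem contDiffAt_average {X ι : Type*} [NormedAddCommGroup X] [NormedSpace ℝ X] [Fintype ι]
    (h : ι → ℝ) {P : X → ι → ℂ} {x : X} (hP : ContDiffAt ℝ ∞ P x) (h0 : P x ≠ 0) :
    ContDiffAt ℝ ∞ (fun y => average h (P y)) x := by
  have h1 : ∀ i, ContDiffAt ℝ ∞ (fun y => ‖P y i‖ ^ 2) x := fun i => (contDiffAt_pi.1 hP i).norm_sq ℝ
  exact (ContDiffAt.sum fun i _ => contDiffAt_const.mul (h1 i)).div (ContDiffAt.sum fun i _ => h1 i)
    (sum_norm_sq_pos h0).ne'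

/-- The moment equation on the vector space of Plücker vectors. The vector with entries i hᵢ zᵢ is
the velocity of the rotation with weights `h`, and the two terms of the quotient rule are the two
terms of the form. -/
theorem fderiv_average {X ι : Type*} [NormedAddCommGroup X] [NormedSpace ℝ X] [Fintype ι]
    (h : ι → ℝ) {P : X → ι → ℂ} {x : X} (hP : ContDiffAt ℝ ∞ P x) (h0 : P x ≠ 0) (w : X) :
    fderiv ℝ (fun y => average h (P y)) x w
      = fubiniStudy (P x) (fun i => Complex.I * h i * P x i) (fderiv ℝ P x w) := by
  have hd := hP.differentiableAt (by simp : (∞ : WithTop ℕ∞) ≠ 0)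
  have h1 : ∀ i, HasFDerivAt (fun y => ‖P y i‖ ^ 2) _ x := fun i =>
    (hasFDerivAt_pi'.1 hd.hasFDerivAt i).norm_sq
  have hN := (sum_norm_sq_pos h0).ne'
  have h2 := HasFDerivAt.fun_sum (u := Finset.univ) fun i _ => (h1 i).const_mul (h i)
  have h3 := HasFDerivAt.fun_sum (u := Finset.univ) fun i _ => h1 i
  have h4 := h2.mul ((hasDerivAt_inv hN).hasFDerivAt.comp x h3)
  rw [show fderiv ℝ (fun y => average h (P y)) x = _ from h4.fderiv]
  have e1 : dotProduct (fun i => Complex.I * h i * P x i) (star (P x))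
      = Complex.I * ((∑ i, h i * ‖P x i‖ ^ 2 : ℝ) : ℂ) := by
    simp only [dotProduct, Pi.star_apply, Complex.star_def, mul_assoc, Complex.mul_conj,
      Complex.normSq_eq_norm_sq]
    push_cast
    rw [Finset.mul_sum]
  rw [fubiniStudy, e1, dotProduct_star_self_eq]
  have hr : ∀ i, inner ℝ (P x i) (fderiv ℝ P x w i) = (P x i * star (fderiv ℝ P x w i)).re := by
    intro i
    simp [Complex.inner, mul_comm]
  have e2 : (dotProduct (fun i => Complex.I * h i * P x i) (star (fderiv ℝ P x w))).im
      = ∑ i, h i * inner ℝ (P x i) (fderiv ℝ P x w i) := by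
    simp only [dotProduct, Pi.star_apply, Complex.im_sum, hr]
    refine Finset.sum_congr rfl fun i _ => ?_
    rw [mul_assoc, mul_assoc, Complex.I_mul_im, Complex.re_ofReal_mul]
  have e3 : (dotProduct (P x) (star (fderiv ℝ P x w))).re
      = ∑ i, inner ℝ (P x i) (fderiv ℝ P x w i) := by
    simp only [dotProduct, Pi.star_apply, Complex.re_sum, hr]
  rw [← Complex.ofReal_pow, mul_assoc, Complex.sub_im, Complex.div_ofReal_im,
    Complex.div_ofReal_im, Complex.I_mul_im, Complex.re_ofReal_mul, e2, e3]
  simp only [add_apply, smul_apply, sum_apply, ContinuousLinearMap.comp_apply, innerSL_apply_apply,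
    Function.comp_apply, ContinuousLinearMap.proj_apply, ContinuousLinearMap.toSpanSingleton_apply,
    smul_eq_mul, nsmul_eq_mul, ← Finset.mul_sum]
  simp only [mul_left_comm (h _), ← Finset.mul_sum]
  push_cast
  field_simp
  ring

theorem contMDiff_momentMap :
    ContMDiff 𝓘(ℝ, GrModel n) 𝓘(ℝ, Fin n → ℝ) ∞ (momentMap (n := n)) := by
  intro L
  obtain ⟨e, Z, rfl⟩ := exists_graph_eq L
  refine contMDiffAt_of_comp_graph ?_
  refine contMDiffAt_pi_space.2 fun k => ?_
  simp only [fun Z => momentMap_apply (isFrame_graphFrame e Z) k]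
  exact (contDiffAt_average _ (smoothFrameAt_graphFrame e Z).contDiffAt_plucker
    (plucker_ne_zero (isFrame_graphFrame e Z))).contMDiffAt

theorem isProperMap_momentMap : IsProperMap (momentMap (n := n)) :=
  contMDiff_momentMap.continuous.isProperMap

/-! ### The torus action is Hamiltonian -/

/-- The frame moved by the exponential of the Lie algebra of the torus. -/
def rotate (v : Fin n → ℝ) (A : Matrix (Fin n) (Fin 2) ℂ) : Matrix (Fin n) (Fin 2) ℂ :=
  scale (fun i => Complex.exp (v i * Complex.I)) A

theorem IsFrame.rotate {A : Matrix (Fin n) (Fin 2) ℂ} {L : Gr n} (hA : IsFrame A L)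
    (v : Fin n → ℝ) : IsFrame (rotate v A) (torusExp v • L) := by
  have := hA.scale_circle (torusExp v)
  simp only [torusExp, Circle.coe_exp] at this
  exact this

theorem torusExp_zero : torusExp (0 : Fin n → ℝ) = 1 := by
  funext i
  simp [torusExp]

section
variable {E' H' X : Type*} [NormedAddCommGroup E'] [NormedSpace ℝ E']
    [TopologicalSpace H'] {J : ModelWithCorners ℝ E' H'} [TopologicalSpace X] [ChartedSpace H' X]
    {x : X}

theorem SmoothFrameAt.scale {A : X → Matrix (Fin n) (Fin 2) ℂ} {t : X → Fin n → ℂ}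
    (hA : SmoothFrameAt J A x) (ht : ∀ i, ContMDiffAt J 𝓘(ℝ, ℂ) ∞ (fun y => t y i) x) :
    SmoothFrameAt J (fun y => SymplecticReduction.scale (t y) (A y)) x := fun i j =>
  contMDiffAt_cmul (ht i) (hA i j)

theorem SmoothFrameAt.scale_const {A : X → Matrix (Fin n) (Fin 2) ℂ} (hA : SmoothFrameAt J A x)
    (t : Fin n → ℂ) : SmoothFrameAt J (fun y => SymplecticReduction.scale t (A y)) x :=
  hA.scale (t := fun _ => t) fun _ => contMDiffAt_const

theorem contMDiffAt_cexp_mul_I {v : X → ℝ} (hv : ContMDiffAt J 𝓘(ℝ, ℝ) ∞ v x) :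
    ContMDiffAt J 𝓘(ℝ, ℂ) ∞ (fun y => Complex.exp (v y * Complex.I)) x := by
  have h : ContDiff ℝ ∞ fun s : ℝ => Complex.exp (s * Complex.I) :=
    (Complex.ofRealCLM.contDiff.mul contDiff_const).cexp
  exact (h.contMDiff.contMDiffAt).comp x hv

theorem SmoothFrameAt.rotate {A : X → Matrix (Fin n) (Fin 2) ℂ} {v : X → Fin n → ℝ}
    (hA : SmoothFrameAt J A x) (hv : ContMDiffAt J 𝓘(ℝ, Fin n → ℝ) ∞ v x) :
    SmoothFrameAt J (fun y => SymplecticReduction.rotate (v y) (A y)) x :=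
  hA.scale fun i => contMDiffAt_cexp_mul_I (contMDiffAt_pi_space.1 hv i)

end

theorem contMDiff_torusExp_smul :
    ContMDiff (𝓘(ℝ, Fin n → ℝ).prod 𝓘(ℝ, GrModel n)) 𝓘(ℝ, GrModel n) ∞
      (fun q : (Fin n → ℝ) × Gr n => torusExp q.1 • q.2) := by
  rintro ⟨v, L⟩
  obtain ⟨e, he⟩ := exists_mem_source L
  have hs : SmoothFrameAt (𝓘(ℝ, Fin n → ℝ).prod 𝓘(ℝ, GrModel n))
      (fun q : (Fin n → ℝ) × Gr n => rotate q.1 (graphFrame e (grHomeo e q.2))) (v, L) := by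
    refine SmoothFrameAt.rotate (fun i j => ?_) contMDiffAt_fst
    exact ((contDiff_graphFrame e i j).contMDiff.contMDiffAt).comp (v, L)
      ((contMDiffAt_grHomeo e he).comp (v, L) contMDiffAt_snd)
  refine hs.contMDiffAt ?_
  have hopen : ∀ᶠ q : (Fin n → ℝ) × Gr n in 𝓝 (v, L), q.2 ∈ (grHomeo e).source :=
    continuous_snd.continuousAt.eventually ((grHomeo e).open_source.mem_nhds he)
  filter_upwards [hopen] with q hq
  have h1 := (isFrame_graphFrame e (grHomeo e q.2)).rotate q.1
  rwa [show graph e (grHomeo e q.2) = q.2 from (grHomeo e).left_inv hq] at h1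

theorem contMDiff_smul (t : Fin n → ℂˣ) :
    ContMDiff 𝓘(ℝ, GrModel n) 𝓘(ℝ, GrModel n) ∞ (fun L : Gr n => t • L) := by
  intro L
  obtain ⟨e, Z, rfl⟩ := exists_graph_eq L
  refine contMDiffAt_of_comp_graph ?_
  exact ((smoothFrameAt_graphFrame e Z).scale_const fun i => (t i : ℂ)).contMDiffAt
    (Eventually.of_forall fun Z => (isFrame_graphFrame e Z).scale t)

theorem contMDiff_circle_smul (t : Fin n → Circle) :
    ContMDiff 𝓘(ℝ, GrModel n) 𝓘(ℝ, GrModel n) ∞ (fun L : Gr n => t • L) :=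
  contMDiff_smul fun i => Circle.toUnits (t i)

theorem mfderiv_graph_surjective (e : Numbering n) (Z : GrModel n) :
    Function.Surjective (mfderiv 𝓘(ℝ, GrModel n) 𝓘(ℝ, GrModel n) (graph e) Z) := by
  have h := mdifferentiable_of_mem_atlas (I := 𝓘(ℝ, GrModel n)) ((mem_atlas_iff (grHomeo e)).2 ⟨e, rfl⟩)
  exact h.symm.mfderiv_surjective (x := Z) (Set.mem_univ Z)

theorem hasFDerivAt_plucker_apply {X : Type*} [NormedAddCommGroup X] [NormedSpace ℝ X]
    {A : X → Matrix (Fin n) (Fin 2) ℂ} {x : X} (hA : SmoothFrameAt 𝓘(ℝ, X) A x) (I : Pair n) :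
    HasFDerivAt (fun y => plucker (A y) I)
      ((ContinuousLinearMap.proj I).comp (fderiv ℝ (fun y => plucker (A y)) x)) x :=
  hasFDerivAt_pi'.1 (hA.contDiffAt_plucker.differentiableAt (by simp)).hasFDerivAt I

theorem plucker_scale (t : Fin n → ℂ) (A : Matrix (Fin n) (Fin 2) ℂ) (I : Pair n) :
    plucker (scale t A) I = t I.1.1 * t I.1.2 * plucker A I := minor_scale _ _ _ _

theorem fubiniStudy_unitary {ι : Type*} [Fintype ι] (t z a b : ι → ℂ) (ht : ∀ i, ‖t i‖ = 1) :
    fubiniStudy (t * z) (t * a) (t * b) = fubiniStudy z a b := by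
  have h : ∀ a b : ι → ℂ, dotProduct (t * a) (star (t * b)) = dotProduct a (star b) := by
    intro a b
    refine Finset.sum_congr rfl fun i _ => ?_
    have h1 : t i * star (t i) = 1 := by
      rw [Complex.star_def, Complex.mul_conj, Complex.normSq_eq_norm_sq, ht]; simp
    simp only [Pi.mul_apply, Pi.star_apply, star_mul']
    linear_combination a i * star (b i) * h1
  simp only [fubiniStudy, h]

theorem fderiv_plucker_scale_const {X : Type*} [NormedAddCommGroup X] [NormedSpace ℝ X]
    {A : X → Matrix (Fin n) (Fin 2) ℂ} {x : X} (hA : SmoothFrameAt 𝓘(ℝ, X) A x) (t : Fin n → ℂ)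
    (u : X) : fderiv ℝ (fun y => plucker (scale t (A y))) x u
      = (fun I : Pair n => t I.1.1 * t I.1.2) * fderiv ℝ (fun y => plucker (A y)) x u := by
  have h : HasFDerivAt (fun y => plucker (scale t (A y))) _ x := hasFDerivAt_pi.2 fun I => by
    simp only [plucker_scale]
    exact (hasFDerivAt_plucker_apply hA I).const_mul (t I.1.1 * t I.1.2)
  rw [h.fderiv]
  funext I
  simp

/-- The compact torus acts on Plücker coordinates by diagonal unitary matrices, which preserve
hermitian products. -/
theorem grForm_smul (t : Fin n → Circle) (p : Gr n) (u v : TangentSpace 𝓘(ℝ, GrModel n) p) :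
    grForm n (t • p) (mfderiv 𝓘(ℝ, GrModel n) 𝓘(ℝ, GrModel n) (fun q : Gr n => t • q) p u)
      (mfderiv 𝓘(ℝ, GrModel n) 𝓘(ℝ, GrModel n) (fun q : Gr n => t • q) p v) = grForm n p u v := by
  obtain ⟨e, Z, rfl⟩ := exists_graph_eq p
  obtain ⟨u, rfl⟩ := mfderiv_graph_surjective e Z u
  obtain ⟨v, rfl⟩ := mfderiv_graph_surjective e Z v
  have hg := (contMDiff_graph e).mdifferentiable (by simp) Z
  have ht := (contMDiff_circle_smul t).mdifferentiable (by simp) (graph e Z)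
  rw [← mfderiv_comp_apply Z ht hg, ← mfderiv_comp_apply Z ht hg]
  have hA := smoothFrameAt_graphFrame e Z
  have hG : ∀ᶠ Z in 𝓝 Z, IsFrame (graphFrame e Z) (graph e Z) :=
    Eventually.of_forall fun Z => isFrame_graphFrame e Z
  have hA' : SmoothFrameAt 𝓘(ℝ, GrModel n)
    (fun Z => scale (fun i => (t i : ℂ)) (graphFrame e Z)) Z := hA.scale_const fun i => (t i : ℂ)
  have hG' : ∀ᶠ Z in 𝓝 Z, IsFrame (scale (fun i => (t i : ℂ)) (graphFrame e Z)) (t • graph e Z) :=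
    Eventually.of_forall fun Z => (isFrame_graphFrame e Z).scale_circle t
  refine (grForm_mfderiv hA' hG' hA' hG' rfl rfl u v).trans
    (Eq.trans ?_ (grForm_mfderiv hA hG hA hG rfl rfl u v).symm)
  have hz : plucker (scale (fun i => (t i : ℂ)) (graphFrame e Z))
    = (fun I : Pair n => (t I.1.1 : ℂ) * t I.1.2) * plucker (graphFrame e Z) :=
      funext fun I => plucker_scale _ _ I
  rw [hz]
  refine (congrArg₂ (fubiniStudy _) (fderiv_plucker_scale_const hA _ u)
    (fderiv_plucker_scale_const hA _ v)).trans ?_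
  exact fubiniStudy_unitary _ _ _ _ fun I => (norm_mul _ _).trans
    ((congrArg₂ (· * ·) (Circle.norm_coe _) (Circle.norm_coe _)).trans (one_mul 1))

theorem rotate_zero (A : Matrix (Fin n) (Fin 2) ℂ) : rotate 0 A = A := by
  ext i j
  simp [rotate, scale]

theorem fderiv_plucker_rotate (v : Fin n → ℝ) (A : Matrix (Fin n) (Fin 2) ℂ) :
    fderiv ℝ (fun θ : ℝ => plucker (rotate (θ • v) A)) 0 1
      = fun I => Complex.I * wt v I * plucker A I := by
  have h : HasDerivAt (fun θ : ℝ => plucker (rotate (θ • v) A))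
      (fun I => Complex.I * wt v I * plucker A I) 0 := by
    refine hasDerivAt_pi.2 fun I => ?_
    have h1 : ∀ i, HasDerivAt (fun θ : ℝ => Complex.exp (((θ • v) i : ℝ) * Complex.I))
        (v i * Complex.I) 0 := by
      intro i
      have h2 : HasDerivAt (fun θ : ℝ => (((θ • v) i : ℝ) : ℂ) * Complex.I) (v i * Complex.I) 0 := by
        simp only [Pi.smul_apply, smul_eq_mul, Complex.ofReal_mul, mul_assoc]
        simpa using (Complex.ofRealCLM.hasDerivAt (x := (0 : ℝ))).mul_const ((v i : ℂ) * Complex.I)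
      simpa using h2.cexp
    have h3 := ((h1 I.1.1).mul (h1 I.1.2)).mul_const (plucker A I)
    have h4 : ∀ θ : ℝ, plucker (rotate (θ • v) A) I
        = Complex.exp (((θ • v) I.1.1 : ℝ) * Complex.I)
          * Complex.exp (((θ • v) I.1.2 : ℝ) * Complex.I) * plucker A I := fun θ =>
      plucker_scale _ _ I
    refine (h3.congr_of_eventuallyEq (Eventually.of_forall h4)).congr_deriv ?_
    simp only [zero_smul, Pi.zero_apply, Complex.ofReal_zero, zero_mul, Complex.exp_zero, wt,
      Complex.ofReal_add]
    ring
  rw [fderiv_apply_one_eq_deriv, h.deriv]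

theorem smoothFrameAt_rotate_line (v : Fin n → ℝ) (A : Matrix (Fin n) (Fin 2) ℂ) (θ : ℝ) :
    SmoothFrameAt 𝓘(ℝ, ℝ) (fun θ : ℝ => rotate (θ • v) A) θ :=
  SmoothFrameAt.rotate (fun _ _ => contMDiffAt_const)
    ((contDiff_id.smul contDiff_const).contMDiff.contMDiffAt)

/-- The moment equation for the velocity of a family of planes. -/
theorem grForm_fundamentalField {Y : Type*} [NormedAddCommGroup Y] [NormedSpace ℝ Y]
    {B : Y → Matrix (Fin n) (Fin 2) ℂ} {H : Y → Gr n} {y : Y}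
    (hB : SmoothFrameAt 𝓘(ℝ, Y) B y) (hH : ∀ᶠ z in 𝓝 y, IsFrame (B z) (H z))
    (v : Fin n → ℝ) (w : Y) :
    grForm n (H y) (fundamentalField (GrModel n) v (H y))
        (mfderiv 𝓘(ℝ, Y) 𝓘(ℝ, GrModel n) H y w : GrModel n)
      = fderiv ℝ (fun y => average (wt v) (plucker (B y))) y w := by
  have h1 := grForm_mfderiv (G := fun θ : ℝ => torusExp (θ • v) • H y)
    (smoothFrameAt_rotate_line v (B y) 0)
    (Eventually.of_forall fun θ => hH.self_of_nhds.rotate (θ • v)) hB hH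
    (by rw [zero_smul, rotate_zero]) (p := H y)
    (by rw [zero_smul, torusExp_zero, one_smul]) 1 w
  refine h1.trans ?_
  rw [fderiv_plucker_rotate, zero_smul, rotate_zero,
    fderiv_average _ hB.contDiffAt_plucker (plucker_ne_zero hH.self_of_nhds)]

theorem isHamiltonianAction (n : ℕ) : IsHamiltonianAction (grForm n) (momentMap (n := n)) where
  smooth_action := contMDiff_torusExp_smul
  invariant := grForm_smul
  smooth_moment := contMDiff_momentMap
  moment := by
    intro v p Y
    obtain ⟨e, Z, rfl⟩ := exists_graph_eq p
    obtain ⟨w, rfl⟩ := mfderiv_graph_surjective e Z Y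
    have hg := (contMDiff_graph e).mdifferentiable (by simp) Z
    have hm : MDifferentiableAt 𝓘(ℝ, GrModel n) 𝓘(ℝ, ℝ)
        (fun q : Gr n => ∑ i, v i * momentMap q i) (graph e Z) := by
      have : ContDiff ℝ ∞ fun x : Fin n → ℝ => ∑ i, v i * x i := by fun_prop
      exact ((this.contMDiff.comp contMDiff_momentMap).mdifferentiable (by simp)) _
    rw [← mfderiv_comp_apply Z hm hg, mfderiv_eq_fderiv]
    refine (grForm_fundamentalField (smoothFrameAt_graphFrame e Z)
      (Eventually.of_forall fun Z => isFrame_graphFrame e Z) v w).trans ?_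
    congr 2
    funext Z
    exact (sum_mul_momentMap (isFrame_graphFrame e Z) v).symm

/-! ### Supports and stability -/

/-- The indices of the nonzero Plücker coordinates of a plane. -/
def supp (L : Gr n) : Set (Pair n) := {I | plucker (frame L) I ≠ 0}

theorem mem_supp_iff {A : Matrix (Fin n) (Fin 2) ℂ} {L : Gr n} (hA : IsFrame A L) (I : Pair n) :
    I ∈ supp L ↔ plucker A I ≠ 0 := by
  obtain ⟨g, hg, rfl⟩ := (isFrame_frame L).exists_mul hA
  rw [plucker_mul]
  exact ⟨fun h => mul_ne_zero hg.ne_zero h, fun h => right_ne_zero_of_mul h⟩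

theorem mem_stratum_iff (L : Gr n) (σ : Set (Pair n)) : L ∈ stratum σ ↔ supp L = σ :=
  Set.ext_iff.symm

theorem mem_strataUnion_iff (L : Gr n) (S : Set (Set (Pair n))) :
    L ∈ strataUnion S ↔ supp L ∈ S := by
  simp [strataUnion, mem_stratum_iff]

theorem plucker_units (t : Fin n → ℂˣ) (A : Matrix (Fin n) (Fin 2) ℂ) (I : Pair n) :
    plucker (scale (fun i => (t i : ℂ)) A) I = t I.1.1 * t I.1.2 * plucker A I :=
  plucker_scale _ _ _

theorem supp_smul (t : Fin n → ℂˣ) (L : Gr n) : supp (t • L) = supp L := by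
  ext I
  rw [mem_supp_iff ((isFrame_frame L).scale t), mem_supp_iff (isFrame_frame L), plucker_units]
  simp

/-- A diagonal entry of `pluckerProj` is |P^I|²/|P|², which is continuous, so a nonzero Plücker
coordinate stays nonzero nearby. -/
theorem eventually_supp_subset (L : Gr n) : ∀ᶠ M in 𝓝 L, supp L ⊆ supp M := by
  have h : ∀ (M : Gr n) I, I ∈ supp M ↔ pluckerProj M I I ≠ 0 := by
    intro M I
    have := dotProduct_star_self_ne_zero (plucker_ne_zero (isFrame_frame M))
    simp [pluckerProj, supp, -Complex.star_def, this]
  have h1 : ∀ᶠ M in 𝓝 L, ∀ I : Pair n, I ∈ supp L → I ∈ supp M := by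
    rw [eventually_all]
    intro I
    by_cases hI : I ∈ supp L
    · have hc : Continuous fun M : Gr n => pluckerProj M I I :=
        (continuous_apply I).comp ((continuous_apply I).comp continuous_pluckerProj)
      filter_upwards [hc.continuousAt.eventually_ne ((h L I).1 hI)] with M hM _
      exact (h M I).2 hM
    · exact Eventually.of_forall fun _ hI' => absurd hI' hI
  exact h1

theorem sum_vertex (I : Pair n) : ∑ k, vertex I k = 2 := by
  have := sum_mul_vertex (fun _ => 1) I
  simp only [one_mul, wt] at this
  rw [this]; norm_num

theorem sum_mul_eq_of_mem_polytope {σ : Set (Pair n)} {d : Fin n → ℝ} {a : ℝ}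
    (h : ∀ I ∈ σ, wt d I = a) {y : Fin n → ℝ} (hy : y ∈ polytope σ) : ∑ k, d k * y k = a := by
  have hconv : Convex ℝ {y : Fin n → ℝ | ∑ k, d k * y k = a} := by
    have hl : IsLinearMap ℝ fun y : Fin n → ℝ => ∑ k, d k * y k :=
      ⟨fun y z => by simp [mul_add, Finset.sum_add_distrib],
        fun c y => by simp [Finset.mul_sum, mul_left_comm]⟩
    exact convex_hyperplane hl a
  refine convexHull_min ?_ hconv hy
  rintro _ ⟨I, hI, rfl⟩
  exact (sum_mul_vertex d I).trans (h I hI)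

theorem sum_mul_le_of_mem_polytope {σ : Set (Pair n)} {d : Fin n → ℝ} {a : ℝ}
    (h : ∀ I ∈ σ, wt d I ≤ a) {y : Fin n → ℝ} (hy : y ∈ polytope σ) : ∑ k, d k * y k ≤ a := by
  have hconv : Convex ℝ {y : Fin n → ℝ | ∑ k, d k * y k ≤ a} := by
    have hl : IsLinearMap ℝ fun y : Fin n → ℝ => ∑ k, d k * y k :=
      ⟨fun y z => by simp [mul_add, Finset.sum_add_distrib],
        fun c y => by simp [Finset.mul_sum, mul_left_comm]⟩
    exact convex_halfSpace_le hl a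
  refine convexHull_min ?_ hconv hy
  rintro _ ⟨I, hI, rfl⟩
  exact (sum_mul_vertex d I).trans_le (h I hI)

theorem sum_eq_two_of_mem_polytope {σ : Set (Pair n)} {y : Fin n → ℝ} (hy : y ∈ polytope σ) :
    ∑ k, y k = 2 := by
  have := sum_mul_eq_of_mem_polytope (d := fun _ => 1) (a := 2)
    (fun I _ => by norm_num [wt]) hy
  simpa using this

/-! ### Interior points of polytopes, rigid supports and stabilisers -/

/-- `x` is an interior point of the polytope of `σ` relative to the hyperplane of the
hypersimplex. -/
def IsInner (x : Fin n → ℝ) (σ : Set (Pair n)) : Prop :=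
  ∃ ε > 0, ∀ w : Fin n → ℝ, ∑ k, w k = 0 → ‖w‖ < ε → x + w ∈ polytope σ

theorem IsInner.mono {x : Fin n → ℝ} {σ τ : Set (Pair n)} (h : IsInner x σ) (hst : σ ⊆ τ) :
    IsInner x τ := by
  obtain ⟨ε, h0, h1⟩ := h
  exact ⟨ε, h0, fun w hw hw' => convexHull_mono (Set.image_mono hst) (h1 w hw hw')⟩

theorem IsInner.mem {x : Fin n → ℝ} {σ : Set (Pair n)} (h : IsInner x σ) : x ∈ polytope σ := by
  obtain ⟨ε, h0, h1⟩ := h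
  simpa using h1 0 (by simp) (by simpa using h0)

theorem IsInner.sum_eq_two {x : Fin n → ℝ} {σ : Set (Pair n)} (h : IsInner x σ) :
    ∑ k, x k = 2 := sum_eq_two_of_mem_polytope h.mem

/-- Supports only grow near a plane, and a larger support has a larger polytope. -/
theorem isOpen_isInner_supp (x : Fin n → ℝ) : IsOpen {L : Gr n | IsInner x (supp L)} := by
  rw [isOpen_iff_eventually]
  intro L hL
  filter_upwards [eventually_supp_subset L] with M hM
  exact hL.mono hM

/-- The vertices of `σ` span the hyperplane of the hypersimplex. -/
def IsRigid (σ : Set (Pair n)) : Prop :=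
  ∀ (d : Fin n → ℝ) (a : ℝ), (∀ I ∈ σ, wt d I = a) → ∀ i j, d i = d j

/-- A linear function constant on the vertices is constant on the polytope, which contains both `x`
and the point `x + (ε / 2)(e_i - e_j)`. -/
theorem IsInner.isRigid {x : Fin n → ℝ} {σ : Set (Pair n)} (h : IsInner x σ) : IsRigid σ := by
  intro d a hd i j
  by_cases hij : i = j
  · rw [hij]
  obtain ⟨ε, h0, h1⟩ := h
  have hx := sum_mul_eq_of_mem_polytope hd (by simpa using h1 0 (by simp) (by simpa using h0))
  set w : Fin n → ℝ := Pi.single i (ε / 2) - Pi.single j (ε / 2) with hw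
  have hw0 : ∑ k, w k = 0 := by simp [hw]
  have hwn : ‖w‖ < ε := by
    rw [pi_norm_lt_iff h0]
    intro k
    simp only [hw, Pi.sub_apply, Pi.single_apply]
    by_cases hki : k = i
    · have : k ≠ j := fun h => hij (hki.symm.trans h)
      simp only [hki, if_true, if_neg hij, sub_zero, Real.norm_eq_abs, abs_of_pos (half_pos h0)]
      linarith
    · by_cases hkj : k = j
      · simp only [if_neg hki, if_pos hkj, zero_sub, norm_neg, Real.norm_eq_abs,
          abs_of_pos (half_pos h0)]
        linarith
      · simp [hki, hkj, h0]
  have hxw := sum_mul_eq_of_mem_polytope hd (h1 w hw0 hwn)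
  simp only [Pi.add_apply, mul_add, Finset.sum_add_distrib, hx] at hxw
  have h2 : ∑ k, d k * w k = d i * (ε / 2) - d j * (ε / 2) := by
    simp [hw, mul_sub, Finset.sum_sub_distrib, Pi.single_apply]
  rw [h2] at hxw
  have h3 : (d i - d j) * (ε / 2) = 0 := by linarith
  have := (mul_eq_zero.1 h3).resolve_right (half_pos h0).ne'
  linarith

theorem minor_mul_minor (A : Matrix (Fin n) (Fin 2) ℂ) (i j a b : Fin n) :
    minor A i j * minor A a b = minor A i a * minor A j b - minor A i b * minor A j a := by
  simp only [minor]; ring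

theorem plucker_mem_supp {A : Matrix (Fin n) (Fin 2) ℂ} {L : Gr n} (hA : IsFrame A L)
    {I : Pair n} (hI : I ∈ supp L) : minor A I.1.1 I.1.2 ≠ 0 := (mem_supp_iff hA I).1 hI

/-- A plane with a rigid support has no zero row and three pairwise independent rows. -/
theorem IsRigid.exists_rows {A : Matrix (Fin n) (Fin 2) ℂ} {L : Gr n} (hA : IsFrame A L)
    (h : IsRigid (supp L)) : ∃ i j k, minor A i j ≠ 0 ∧ minor A i k ≠ 0 ∧ minor A j k ≠ 0 ∧
      ∀ l, minor A i l ≠ 0 ∨ minor A j l ≠ 0 := by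
  classical
  obtain ⟨i, j, hij⟩ := exists_minor_ne_zero hA
  -- Otherwise each row is parallel to row `i` or to row `j`. By the Plücker relation a nonzero
  -- minor uses exactly one row parallel to row `i`, so the indicator function of those rows has
  -- weight 1 on the support but differs at `i` and `j`, against rigidity.
  have hk : ∃ k, minor A i k ≠ 0 ∧ minor A j k ≠ 0 := by
    by_contra! H
    have := h (fun k => if minor A i k = 0 then 1 else 0) 1 (fun I hI => ?_) i j
    · simp [minor_self, hij] at this
    · have hI' := plucker_mem_supp hA hI
      have hrel := minor_mul_minor A i j I.1.1 I.1.2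
      have hne : minor A i j * minor A I.1.1 I.1.2 ≠ 0 := mul_ne_zero hij hI'
      simp only [wt]
      by_cases h1 : minor A i I.1.1 = 0 <;> by_cases h2 : minor A i I.1.2 = 0
      · rw [h1, h2] at hrel; simp at hrel; simp_all
      · simp [h1, h2]
      · simp [h1, h2]
      · rw [H _ h1, H _ h2] at hrel; simp at hrel; simp_all
  obtain ⟨k, hik, hjk⟩ := hk
  refine ⟨i, j, k, hij, hik, hjk, fun l => ?_⟩
  -- If row `l` is dependent on both independent rows `i` and `j`, it is zero. Then `l` occurs in no
  -- index of the support and the indicator function of `l` contradicts rigidity.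
  by_contra! H
  have hil : i ≠ l := by
    rintro rfl
    rw [minor_swap] at hij
    simp [H.2] at hij
  have := h (fun k => if k = l then 1 else 0) 0 (fun I hI => ?_) i l
  · simp [hil] at this
  · have hI' := plucker_mem_supp hA hI
    have hz : ∀ m, minor A m l = 0 := by
      intro m
      have hrel := minor_mul_minor A i j m l
      rw [H.1, H.2] at hrel
      simpa [hij] using hrel
    have h1 : I.1.1 ≠ l := by
      intro h1
      rw [h1, minor_swap, hz] at hI'
      simp at hI'
    have h2 : I.1.2 ≠ l := by
      intro h2
      rw [h2, hz] at hI'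
      simp at hI'
    simp [wt, h1, h2]

theorem minor_smul_eq_of_smul_eq {A : Matrix (Fin n) (Fin 2) ℂ} {L : Gr n} (hA : IsFrame A L)
    {t : Fin n → ℂˣ} (ht : t • L = L) :
    ∃ c : ℂ, ∀ i j, (t i : ℂ) * t j * minor A i j = c * minor A i j := by
  have h1 := hA.scale t
  rw [ht] at h1
  obtain ⟨g, hg, hgA⟩ := hA.exists_mul h1
  refine ⟨g.det, fun i j => ?_⟩
  rw [← minor_scale (fun i => (t i : ℂ)), hgA, minor_mul]

/-- The stabilizer of a plane with a rigid support is the diagonal. -/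
theorem IsRigid.eq_of_smul_eq {L : Gr n} (h : IsRigid (supp L)) {t : Fin n → ℂˣ}
    (ht : t • L = L) (a b : Fin n) : t a = t b := by
  have hA := isFrame_frame L
  obtain ⟨i, j, k, hij, hik, hjk, hl⟩ := h.exists_rows hA
  obtain ⟨c, hc⟩ := minor_smul_eq_of_smul_eq hA ht
  have key : ∀ a b, minor (frame L) a b ≠ 0 → (t a : ℂ) * t b = c := fun a b hab =>
    mul_right_cancel₀ hab (hc a b)
  have h1 := key i j hij
  have h2 := key i k hik
  have h3 := key j k hjk
  -- The product t_a t_b is the same for all pairs in the support. The three pairs among `i`, `j`,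
  -- `k` make these entries equal, and any other row is linked to `i` or to `j`.
  have e1 : (t j : ℂ) = t k := mul_left_cancel₀ (t i).ne_zero (h1.trans h2.symm)
  have e2 : (t i : ℂ) = t j := mul_right_cancel₀ (t k).ne_zero (h2.trans h3.symm)
  have e3 : ∀ l, (t l : ℂ) = t i := by
    intro l
    rcases hl l with h | h
    · exact mul_left_cancel₀ (t i).ne_zero ((key i l h).trans (by rw [← h1, ← e2]))
    · exact mul_left_cancel₀ (t j).ne_zero ((key j l h).trans (by rw [← h1, mul_comm]))
  exact Units.ext ((e3 a).trans (e3 b).symm)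

theorem smul_eq_of_const {t : Fin n → ℂˣ} (ht : ∀ i j, t i = t j) (L : Gr n) : t • L = L := by
  have hA := isFrame_frame L
  obtain ⟨i, j, hij⟩ := exists_minor_ne_zero hA
  refine ((hA.smul (t i).ne_zero).unique (L := L) ?_).symm
  convert hA.scale t using 1
  ext a b
  simp [scale, ht a i]

/-! ### Chambers -/

/-- The vectors with sum of coordinates zero. -/
def zeroSum (n : ℕ) : Submodule ℝ (Fin n → ℝ) :=
  LinearMap.ker (∑ k, LinearMap.proj (R := ℝ) (φ := fun _ : Fin n => ℝ) k)

theorem mem_zeroSum {w : Fin n → ℝ} : w ∈ zeroSum n ↔ ∑ k, w k = 0 := by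
  simp [zeroSum, LinearMap.mem_ker, LinearMap.sum_apply]

theorem intrinsicInterior_of_forall_mem {s : Set (Fin n → ℝ)} {x : Fin n → ℝ} (hx : x ∈ s) {ε : ℝ}
    (hε : 0 < ε) (h : ∀ y ∈ affineSpan ℝ s, dist y x < ε → y ∈ s) : x ∈ intrinsicInterior ℝ s := by
  refine mem_intrinsicInterior.2 ⟨⟨x, subset_affineSpan ℝ s hx⟩, ?_, rfl⟩
  rw [mem_interior_iff_mem_nhds, Metric.mem_nhds_iff]
  exact ⟨ε, hε, fun y hy => h y y.2 hy⟩

theorem IsInner.mem_intrinsicInterior {x : Fin n → ℝ} {σ : Set (Pair n)} (h : IsInner x σ) :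
    x ∈ intrinsicInterior ℝ (polytope σ) := by
  have hx := h.mem
  obtain ⟨ε, h0, h1⟩ := h
  refine intrinsicInterior_of_forall_mem hx h0 fun y hy hyx => ?_
  have hsum : ∑ k, y k = 2 := by
    have hle : affineSpan ℝ (polytope σ) ≤ AffineSubspace.mk' x (zeroSum n) := by
      refine affineSpan_le.2 fun z hz => AffineSubspace.mem_mk'.2 ?_
      rw [vsub_eq_sub, mem_zeroSum]
      simp [Finset.sum_sub_distrib, sum_eq_two_of_mem_polytope hz, sum_eq_two_of_mem_polytope hx]
    have := AffineSubspace.mem_mk'.1 (hle hy)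
    rw [vsub_eq_sub, mem_zeroSum] at this
    simp only [Pi.sub_apply, Finset.sum_sub_distrib, sum_eq_two_of_mem_polytope hx] at this
    linarith
  have := h1 (y - x) (by simp [Finset.sum_sub_distrib, hsum, sum_eq_two_of_mem_polytope hx])
    (by rwa [← dist_eq_norm])
  simpa using this

/-- A convex combination with positive coefficients lies in the relative interior. -/
theorem sum_smul_mem_intrinsicInterior {σ : Set (Pair n)} {c : Pair n → ℝ} (hc : ∀ I, 0 ≤ c I)
    (hσ : ∀ I, c I ≠ 0 ↔ I ∈ σ) (h1 : ∑ I, c I = 1) :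
    ∑ I, c I • vertex I ∈ intrinsicInterior ℝ (polytope σ) := by
  classical
  set x := ∑ I, c I • vertex I with hx
  -- `T` describes the directions of the affine span by relative changes of the coefficients. A
  -- bounded right inverse `R` realises a small displacement by a small relative change.
  let T : (Pair n → ℝ) →ₗ[ℝ] (Fin n → ℝ) :=
    ∑ I, (LinearMap.proj (R := ℝ) (φ := fun _ : Pair n => ℝ) I).smulRight (c I • (vertex I - x))
  have hT : ∀ δ, T δ = ∑ I, δ I • c I • (vertex I - x) := fun δ => by simp [T]
  obtain ⟨R, hR⟩ := T.rangeRestrict.exists_rightInverse_of_surjective T.range_rangeRestrict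
  have hR' : ∀ w, T (R w) = w := fun w =>
    congrArg Subtype.val (DFunLike.congr_fun hR w)
  obtain ⟨K, hK, hKb⟩ := (LinearMap.toContinuousLinearMap R).bound
  have hmem : ∀ a : Pair n → ℝ, (∀ I, 0 ≤ a I) → (∀ I, I ∉ σ → a I = 0) → ∑ I, a I = 1 →
      ∑ I, a I • vertex I ∈ polytope σ := by
    intro a ha ha0 ha1
    have hs : ∑ I with a I ≠ 0, a I • vertex I = ∑ I, a I • vertex I :=
      Finset.sum_filter_of_ne fun I _ h h0 => h (by rw [h0, zero_smul])
    rw [← hs]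
    refine (convex_convexHull ℝ _).sum_mem (fun I _ => ha I) ?_ fun I hI => ?_
    · rw [← ha1]
      exact Finset.sum_filter_of_ne fun I _ h => h
    · refine subset_convexHull ℝ _ ⟨I, ?_, rfl⟩
      by_contra h
      exact (Finset.mem_filter.1 hI).2 (ha0 I h)
  have hc0 : ∀ I, I ∉ σ → c I = 0 := fun I hI => by
    by_contra h
    exact hI ((hσ I).1 h)
  -- With `K` a bound for `R`, this radius keeps every relative change `δ I` at most 1/2 in absolute
  -- value.
  refine intrinsicInterior_of_forall_mem (hmem c hc hc0 h1) (ε := 1 / (2 * K)) (by positivity)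
    fun y hy hyx => ?_
  have hyT : y - x ∈ LinearMap.range T := by
    have hle : affineSpan ℝ (polytope σ) ≤ AffineSubspace.mk' x (LinearMap.range T) := by
      rw [polytope, affineSpan_convexHull]
      refine affineSpan_le.2 ?_
      rintro _ ⟨I, hI, rfl⟩
      refine AffineSubspace.mem_mk'.2 ?_
      rw [vsub_eq_sub]
      refine ⟨Pi.single I (c I)⁻¹, ?_⟩
      rw [hT, Finset.sum_eq_single I]
      · rw [Pi.single_eq_same, smul_smul, inv_mul_cancel₀ ((hσ I).2 hI), one_smul]
      · intro J _ hJ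
        rw [Pi.single_eq_of_ne hJ, zero_smul]
      · simp
    exact AffineSubspace.mem_mk'.1 (hle hy)
  set δ := R ⟨y - x, hyT⟩ with hδ
  have hTδ : T δ = y - x := hR' _
  have hδn : ‖δ‖ ≤ 1 / 2 := by
    refine (hKb ⟨y - x, hyT⟩).trans ?_
    rw [dist_eq_norm] at hyx
    calc K * ‖(⟨y - x, hyT⟩ : LinearMap.range T)‖ = K * ‖y - x‖ := rfl
      _ ≤ K * (1 / (2 * K)) := by gcongr
      _ = 1 / 2 := by field_simp
  have hδI : ∀ I, |δ I| ≤ 1 / 2 := fun I => (norm_le_pi_norm δ I).trans hδn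
  set s := ∑ I, c I * δ I with hs
  have hsle : s ≤ 1 / 2 := by
    calc s ≤ ∑ I, c I * (1 / 2) :=
          Finset.sum_le_sum fun I _ => mul_le_mul_of_nonneg_left (le_of_abs_le (hδI I)) (hc I)
      _ = 1 / 2 := by rw [← Finset.sum_mul, h1, one_mul]
  -- Subtracting the mean `s` of `δ` restores total weight 1 and does not move the point, because
  -- the vertices are taken relative to `x`. The bounds 1/2 on `δ` and `s` keep the coefficients
  -- nonnegative.
  have hy : y = ∑ I, (c I * (1 + δ I - s)) • vertex I := by
    have : y = x + T δ := by rw [hTδ]; abel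
    rw [this, hT]
    simp only [smul_sub, smul_smul, Finset.sum_sub_distrib, mul_sub, mul_add, mul_one, sub_smul,
      add_smul, Finset.sum_add_distrib, ← hx]
    have e1 : ∑ I, (δ I * c I) • x = s • x := by
      rw [← Finset.sum_smul]; simp only [hs, mul_comm]
    have e2 : ∑ I, (c I * s) • vertex I = s • x := by
      simp only [hx, Finset.smul_sum, smul_smul, mul_comm]
    rw [e1, e2]
    simp only [mul_comm (δ _)]
    abel
  rw [hy]
  refine hmem _ (fun I => mul_nonneg (hc I) ?_) (fun I hI => by rw [hc0 I hI, zero_mul]) ?_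
  · have := neg_le_of_abs_le (hδI I)
    linarith
  · simp only [mul_sub, mul_add, mul_one, Finset.sum_sub_distrib, Finset.sum_add_distrib, h1, ← hs,
      ← Finset.sum_mul]
    ring

/-- The moment map is a convex combination of the vertices whose coefficients are positive exactly
on the support. -/
theorem momentMap_mem_intrinsicInterior (L : Gr n) :
    momentMap L ∈ intrinsicInterior ℝ (polytope (supp L)) := by
  have hN := sum_norm_sq_pos (plucker_ne_zero (isFrame_frame L))
  have h := sum_smul_mem_intrinsicInterior (σ := supp L)
    (c := fun I => (∑ I : Pair n, ‖plucker (frame L) I‖ ^ 2)⁻¹ * ‖plucker (frame L) I‖ ^ 2)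
    (fun I => by positivity) (fun I => by simp [supp, hN.ne'])
    (by rw [← Finset.mul_sum, inv_mul_cancel₀ hN.ne'])
  simpa only [momentMap, Finset.smul_sum, smul_smul] using h

theorem sum_momentMap (L : Gr n) : ∑ k, momentMap L k = 2 :=
  sum_eq_two_of_mem_polytope (intrinsicInterior_subset (momentMap_mem_intrinsicInterior L))

/-! ### Full-dimensional chambers and their stable planes -/

section Chamber
variable {S : Set (Set (Pair n))} {C : Set (Fin n → ℝ)}

theorem IsChamber.subset_intrinsicInterior (hC : IsChamber S C) {σ : Set (Pair n)} (hσ : σ ∈ S) :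
    C ⊆ intrinsicInterior ℝ (polytope σ) := fun x hx => by
  rw [hC.eq_inter] at hx
  exact hx.2 σ hσ

theorem IsChamber.mem_of_mem_intrinsicInterior (hC : IsChamber S C) {x : Fin n → ℝ} (hx : x ∈ C)
    {L : Gr n} (h : x ∈ intrinsicInterior ℝ (polytope (supp L))) : supp L ∈ S := by
  by_contra hS
  exact Set.disjoint_left.1 (hC.disjoint _ ⟨L, (mem_stratum_iff L _).2 rfl⟩ hS) hx h

theorem finrank_zeroSum_add_one (hn : 0 < n) : Module.finrank ℝ (zeroSum n) + 1 = n := by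
  set f : (Fin n → ℝ) →ₗ[ℝ] ℝ := ∑ k, LinearMap.proj (R := ℝ) (φ := fun _ : Fin n => ℝ) k with hf
  have h := LinearMap.finrank_range_add_finrank_ker f
  have hs : LinearMap.range f = ⊤ := by
    refine LinearMap.range_eq_top.2 fun a => ⟨Pi.single ⟨0, hn⟩ a, ?_⟩
    simp [hf, LinearMap.sum_apply]
  rw [hs, finrank_top, Module.finrank_self, Module.finrank_fintype_fun_eq_card,
    Fintype.card_fin] at h
  change Module.finrank ℝ (LinearMap.ker f) + 1 = n
  omega

theorem vectorSpan_le_zeroSum {s : Set (Fin n → ℝ)} (hs : ∀ x ∈ s, ∑ k, x k = 2) :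
    vectorSpan ℝ s ≤ zeroSum n := by
  rw [vectorSpan, Submodule.span_le]
  rintro _ ⟨x, hx, y, hy, rfl⟩
  rw [SetLike.mem_coe, mem_zeroSum]
  simp [Finset.sum_sub_distrib, hs x hx, hs y hy]

/-- The chamber lies in P_σ and its differences span all directions of the hyperplane, by the
dimension hypothesis. So the affine span of P_σ contains a neighbourhood in the hyperplane, and
relative interior becomes interior. -/
theorem IsChamber.isInner (hC : IsChamber S C)
    (hdim : Module.finrank ℝ (vectorSpan ℝ C) + 1 = n) {x : Fin n → ℝ} (hx : x ∈ C)
    {σ : Set (Pair n)} (hσ : σ ∈ S) : IsInner x σ := by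
  have hsum : ∀ y ∈ C, ∑ k, y k = 2 := fun y hy =>
    sum_eq_two_of_mem_polytope (intrinsicInterior_subset (hC.subset_intrinsicInterior hσ hy))
  have heq : vectorSpan ℝ C = zeroSum n := by
    refine Submodule.eq_of_le_of_finrank_eq (vectorSpan_le_zeroSum hsum) ?_
    have := finrank_zeroSum_add_one (n := n) (by omega)
    omega
  have hle : zeroSum n ≤ (affineSpan ℝ (polytope σ)).direction := by
    rw [← heq, direction_affineSpan]
    exact vectorSpan_mono ℝ ((hC.subset_intrinsicInterior hσ).trans intrinsicInterior_subset)
  obtain ⟨y, hy, rfl⟩ := mem_intrinsicInterior.1 (hC.subset_intrinsicInterior hσ hx)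
  rw [mem_interior_iff_mem_nhds, Metric.mem_nhds_iff] at hy
  obtain ⟨ε, h0, h1⟩ := hy
  refine ⟨ε, h0, fun w hw hwn => ?_⟩
  have hmem : (y : Fin n → ℝ) + w ∈ affineSpan ℝ (polytope σ) := by
    have := AffineSubspace.vadd_mem_of_mem_direction (hle (mem_zeroSum.2 hw)) y.2
    rwa [vadd_eq_add, add_comm] at this
  refine h1 (a := ⟨_, hmem⟩) ?_
  change dist ((y : Fin n → ℝ) + w) y < ε
  simpa [dist_eq_norm] using hwn

/-- An interior point is a relative interior point, so disjointness of the chamber from the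
polytopes outside `S` gives one direction; the full dimension of the chamber gives the other. The
left side does not mention `x`. -/
theorem IsChamber.mem_iff (hC : IsChamber S C)
    (hdim : Module.finrank ℝ (vectorSpan ℝ C) + 1 = n) {x : Fin n → ℝ} (hx : x ∈ C) (L : Gr n) :
    L ∈ strataUnion S ↔ IsInner x (supp L) := by
  rw [mem_strataUnion_iff]
  exact ⟨fun h => hC.isInner hdim hx h, fun h =>
    hC.mem_of_mem_intrinsicInterior hx h.mem_intrinsicInterior⟩

theorem IsChamber.mem_of_momentMap_eq (hC : IsChamber S C) {x : Fin n → ℝ} (hx : x ∈ C)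
    {L : Gr n} (h : momentMap L = x) : L ∈ strataUnion S :=
  (mem_strataUnion_iff L S).2 (hC.mem_of_mem_intrinsicInterior hx
    (h ▸ momentMap_mem_intrinsicInterior L))

theorem exists_supp_eq_singleton (I : Pair n) : ∃ L : Gr n, supp L = {I} := by
  classical
  have hne : I.1.1 ≠ I.1.2 := ne_of_lt I.2
  let A : Matrix (Fin n) (Fin 2) ℂ := Matrix.of fun k j =>
    if j = 0 then (if k = I.1.1 then 1 else 0) else (if k = I.1.2 then 1 else 0)
  have hA1 : minor A I.1.1 I.1.2 ≠ 0 := by simp [minor, A, hne]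
  obtain ⟨L, hL⟩ := isFrame_of_minor_ne_zero hA1
  refine ⟨L, ?_⟩
  ext J
  rw [mem_supp_iff hL, Set.mem_singleton_iff]
  constructor
  · intro h
    have hJ := J.2
    have hI := I.2
    simp only [plucker, A, Matrix.of_apply, if_true, if_neg (one_ne_zero : (1 : Fin 2) ≠ 0)] at h
    by_cases h1 : J.1.1 = I.1.1 <;> by_cases h2 : J.1.2 = I.1.2
    · exact Subtype.ext (Prod.ext h1 h2)
    · simp [h1, h2, hne] at h
    · simp only [h1, h2, if_false, zero_mul, zero_sub, if_true, neg_ne_zero] at h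
      simp [hne.symm] at h
    · simp only [h1, h2, if_false, zero_mul, zero_sub, neg_ne_zero, mul_ne_zero_iff] at h
      obtain ⟨h3, h4⟩ := h
      have h5 : J.1.1 = I.1.2 := by by_contra h'; simp [h'] at h3
      have h6 : J.1.2 = I.1.1 := by by_contra h'; simp [h'] at h4
      rw [h5, h6] at hJ
      exact absurd hJ (lt_asymm hI)
  · rintro rfl
    exact hA1

/-- If `S` were empty, the chamber would be the whole hypersimplex and contain a vertex. But a
vertex is the relative interior of its own one-point polytope, which is admissible. -/
theorem IsChamber.nonempty_strataUnion (hC : IsChamber S C) : (strataUnion S).Nonempty := by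
  obtain ⟨x, hx⟩ := hC.nonempty
  have hx' := hx
  rw [hC.eq_inter] at hx'
  have hne : (Set.range (vertex (n := n))).Nonempty := convexHull_nonempty_iff.1 ⟨x, hx'.1⟩
  obtain ⟨_, I, rfl⟩ := hne
  obtain ⟨L, hL⟩ := exists_supp_eq_singleton I
  by_contra hS
  have hS' : S = ∅ := by
    rw [Set.eq_empty_iff_forall_notMem]
    intro σ hσ
    obtain ⟨M, hM⟩ := hC.admissible σ hσ
    exact hS ⟨M, (mem_strataUnion_iff M S).2 (by rwa [(mem_stratum_iff M σ).1 hM])⟩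
  have hI : vertex I ∈ C := by
    rw [hC.eq_inter, hS']
    exact ⟨subset_convexHull ℝ _ ⟨I, rfl⟩, by simp⟩
  have := hC.mem_of_mem_intrinsicInterior hI (L := L) (by simp [hL, polytope])
  rw [hS'] at this
  exact this

end Chamber

/-! ### Moving a stable plane to a level set of the moment map -/

/-- The (unnormalised) equation for the moment map to be `x` after rescaling by `exp s`, for a
plane whose Plücker coordinates have absolute values squared `c`. -/
def scaledMoment (x : Fin n → ℝ) (c : Pair n → ℝ) (s : Fin n → ℝ) : Fin n → ℝ :=
  ∑ I, (c I * Real.exp (2 * wt s I)) • (vertex I - x)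

/-- The support of a vector of weights. -/
def weightSupp (c : Pair n → ℝ) : Set (Pair n) := {I | c I ≠ 0}

theorem wt_add (s d : Fin n → ℝ) (I : Pair n) : wt (s + d) I = wt s I + wt d I := by
  simp only [wt, Pi.add_apply]; ring

theorem sum_mul_scaledMoment (x : Fin n → ℝ) (c : Pair n → ℝ) (s d : Fin n → ℝ) :
    ∑ k, d k * scaledMoment x c s k
      = ∑ I, c I * Real.exp (2 * wt s I) * (wt d I - ∑ k, d k * x k) := by
  simp only [scaledMoment, Finset.sum_apply, Pi.smul_apply, Pi.sub_apply, smul_eq_mul,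
    Finset.mul_sum]
  rw [Finset.sum_comm]
  refine Finset.sum_congr rfl fun I _ => ?_
  rw [← sum_mul_vertex d I, ← Finset.sum_sub_distrib, Finset.mul_sum]
  exact Finset.sum_congr rfl fun k _ => by ring

theorem sum_scaledMoment {x : Fin n → ℝ} (hx : ∑ k, x k = 2) (c : Pair n → ℝ) (s : Fin n → ℝ) :
    ∑ k, scaledMoment x c s k = 0 := by
  have := sum_mul_scaledMoment x c s fun _ => 1
  simp only [one_mul, hx, wt] at this
  rw [this]
  norm_num

/-- Uniqueness in the Kempf–Ness argument. Pairing both equations with `d = s' - s` and combining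
them gives a sum of terms proportional to (exp(2y) - 1) y ≥ 0 with y = wt d I - a. All vanish, so
`wt d` is constant on the support, and rigidity makes `d` constant. -/
theorem eq_const_of_scaledMoment_eq_zero {x : Fin n → ℝ} {c : Pair n → ℝ} (hc : ∀ I, 0 ≤ c I)
    (hr : IsRigid (weightSupp c)) {s s' : Fin n → ℝ} (hs : scaledMoment x c s = 0)
    (hs' : scaledMoment x c s' = 0) (i j : Fin n) : s' i - s i = s' j - s j := by
  set d : Fin n → ℝ := s' - s with hd
  set a := ∑ k, d k * x k with ha
  have h1 := sum_mul_scaledMoment x c s d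
  have h2 := sum_mul_scaledMoment x c s' d
  simp only [hs, hs', Pi.zero_apply, mul_zero, Finset.sum_const_zero, ← ha] at h1 h2
  have hs'd : s' = s + d := by rw [hd]; abel
  have h3 : ∑ I, c I * Real.exp (2 * wt s I) * ((Real.exp (2 * (wt d I - a)) - 1) * (wt d I - a))
      = 0 := by
    -- The factor exp(-2a) weights the equation at `s'` so that its difference with the one at `s`
    -- has terms of one sign.
    have : ∀ I, c I * Real.exp (2 * wt s I) * ((Real.exp (2 * (wt d I - a)) - 1) * (wt d I - a))
        = Real.exp (-(2 * a)) * (c I * Real.exp (2 * wt s' I) * (wt d I - a))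
          - c I * Real.exp (2 * wt s I) * (wt d I - a) := by
      intro I
      have e1 : Real.exp (2 * (wt d I - a)) = Real.exp (2 * wt d I) * Real.exp (-(2 * a)) := by
        rw [← Real.exp_add]; ring_nf
      have e2 : Real.exp (2 * wt s' I) = Real.exp (2 * wt s I) * Real.exp (2 * wt d I) := by
        rw [hs'd, wt_add, ← Real.exp_add]; ring_nf
      rw [e1, e2]; ring
    simp only [this, Finset.sum_sub_distrib, ← Finset.mul_sum, ← h1, ← h2]
    simp
  have hnn : ∀ y : ℝ, 0 ≤ (Real.exp (2 * y) - 1) * y := by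
    intro y
    rcases le_total 0 y with hy | hy
    · exact mul_nonneg (sub_nonneg.2 (Real.one_le_exp (by linarith))) hy
    · exact mul_nonneg_of_nonpos_of_nonpos (sub_nonpos.2 (Real.exp_le_one_iff.2 (by linarith))) hy
  rw [Finset.sum_eq_zero_iff_of_nonneg fun I _ =>
    mul_nonneg (mul_nonneg (hc I) (Real.exp_pos _).le) (hnn _)] at h3
  refine hr d a (fun I hI => ?_) i j
  have h4 := h3 I (Finset.mem_univ I)
  rcases mul_eq_zero.1 h4 with h5 | h5
  · exact absurd h5 (mul_ne_zero hI (Real.exp_pos _).ne')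
  · rcases mul_eq_zero.1 h5 with h6 | h6
    · have := (Real.exp_eq_one_iff _).1 (sub_eq_zero.1 h6)
      linarith
    · linarith

theorem norm_sq_le_sum_mul_self (s : Fin n → ℝ) : ‖s‖ ^ 2 ≤ ∑ k, s k * s k := by
  have h0 : 0 ≤ ∑ k, s k * s k := Finset.sum_nonneg fun k _ => mul_self_nonneg _
  rw [← Real.le_sqrt (norm_nonneg _) h0, pi_norm_le_iff_of_nonneg (Real.sqrt_nonneg _)]
  intro k
  rw [Real.norm_eq_abs, ← Real.sqrt_mul_self_eq_abs]
  exact Real.sqrt_le_sqrt (Finset.single_le_sum (f := fun k => s k * s k)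
    (fun k _ => mul_self_nonneg _) (Finset.mem_univ k))

/-- In every direction some vertex is uniformly further than `x`. -/
theorem IsInner.exists_le_wt {x : Fin n → ℝ} {σ : Set (Pair n)} (h : IsInner x σ) :
    ∃ δ > 0, ∀ s : Fin n → ℝ, ∑ k, s k = 0 → ∃ I ∈ σ, δ * ‖s‖ ≤ wt s I - ∑ k, s k * x k := by
  have hx := h.mem
  obtain ⟨ε, h0, h1⟩ := h
  refine ⟨ε / 2, half_pos h0, fun s hs => ?_⟩
  have hσ : σ.Nonempty := by
    have : (polytope σ).Nonempty := ⟨x, hx⟩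
    exact (convexHull_nonempty_iff.1 this).of_image
  by_cases hs0 : s = 0
  · obtain ⟨I, hI⟩ := hσ
    exact ⟨I, hI, by simp [hs0, wt]⟩
  have hn : 0 < ‖s‖ := norm_pos_iff.2 hs0
  by_contra! H
  have hle : ∀ I ∈ σ, wt s I ≤ ε / 2 * ‖s‖ + ∑ k, s k * x k - 0 := fun I hI => by
    have := H I hI; linarith
  -- Move from `x` by ε/2 in the direction of `s`: the point stays in the polytope, and the linear
  -- function `s` grows by at least ε/2 ‖s‖, so some vertex lies at least that high.
  have hw := h1 ((ε / 2 / ‖s‖) • s) (by simp [← Finset.mul_sum, hs])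
    (by rw [norm_smul, Real.norm_of_nonneg (by positivity), div_mul_cancel₀ _ hn.ne']; linarith)
  obtain ⟨I₀, hI₀, hmax⟩ : ∃ I₀ ∈ σ, ∀ I ∈ σ, wt s I ≤ wt s I₀ :=
    Set.exists_max_image σ (wt s) (Set.toFinite σ) hσ
  have h2 := sum_mul_le_of_mem_polytope hmax hw
  have h3 : ∑ k, s k * (x + (ε / 2 / ‖s‖) • s) k
      = ∑ k, s k * x k + ε / 2 / ‖s‖ * ∑ k, s k * s k := by
    simp only [Pi.add_apply, Pi.smul_apply, smul_eq_mul, mul_add, Finset.sum_add_distrib,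
      Finset.mul_sum]
    congr 1
    exact Finset.sum_congr rfl fun k _ => by ring
  rw [h3] at h2
  have h4 : ε / 2 * ‖s‖ ≤ ε / 2 / ‖s‖ * ∑ k, s k * s k := by
    calc ε / 2 * ‖s‖ = ε / 2 / ‖s‖ * ‖s‖ ^ 2 := by field_simp
      _ ≤ _ := by gcongr; exact norm_sq_le_sum_mul_self s
  have := H I₀ hI₀
  linarith

/-! ### Existence of the rescaling by minimising an energy -/

/-- The function whose critical points solve the moment equation. -/
def energy (x : Fin n → ℝ) (c : Pair n → ℝ) (s : Fin n → ℝ) : ℝ :=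
  ∑ I, c I * Real.exp (2 * (wt s I - ∑ k, s k * x k)) + (∑ k, s k) ^ 2

/-- Split `s` into its mean and the part `s₀` with sum zero. Some vertex of the support lies at
height at least δ ‖s₀‖ above `x`, so its exponential controls `s₀`; the square controls the mean.
The inequality exp y ≥ 1 + y already gives linear growth. -/
theorem tendsto_energy {x : Fin n → ℝ} {c : Pair n → ℝ} (hc : ∀ I, 0 ≤ c I)
    (h : IsInner x (weightSupp c)) :
    Tendsto (energy x c) (cocompact (Fin n → ℝ)) atTop := by
  obtain ⟨δ, hδ, hI⟩ := h.exists_le_wt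
  have hx2 := h.sum_eq_two
  have hn : 0 < n := by
    rcases Nat.eq_zero_or_pos n with rfl | hn
    · simp at hx2
    · exact hn
  have hn' : (0 : ℝ) < n := by exact_mod_cast hn
  have hfin : ∃ m > 0, ∀ I ∈ weightSupp c, m ≤ c I := by
    have hne : (weightSupp c).Nonempty := by
      obtain ⟨I, hI, _⟩ := hI 0 (by simp)
      exact ⟨I, hI⟩
    obtain ⟨I₀, hI₀, hmin⟩ := Set.exists_min_image (weightSupp c) c (Set.toFinite _) hne
    exact ⟨c I₀, lt_of_le_of_ne (hc I₀) (Ne.symm hI₀), hmin⟩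
  obtain ⟨m, hm, hmc⟩ := hfin
  -- The smaller of the growth rates in the two parts, 2mδ for `s₀` and 1 for the mean.
  set η := min (2 * m * δ) 1 with hη
  have hη0 : 0 < η := lt_min (by positivity) one_pos
  have hbound : ∀ s : Fin n → ℝ, η * ‖s‖ - 1 ≤ energy x c s := by
    intro s
    set a := (∑ k, s k) / n with ha
    have hsa : ∑ k, s k = n * a := by rw [ha]; field_simp
    set s₀ : Fin n → ℝ := fun k => s k - a with hs₀
    have hs₀0 : ∑ k, s₀ k = 0 := by simp [hs₀, Finset.sum_sub_distrib, hsa]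
    obtain ⟨I, hIσ, hIle⟩ := hI s₀ hs₀0
    have hwt : wt s₀ I - ∑ k, s₀ k * x k = wt s I - ∑ k, s k * x k := by
      simp only [hs₀, wt, sub_mul, Finset.sum_sub_distrib, ← Finset.mul_sum, hx2]
      ring
    rw [hwt] at hIle
    have h1 : 2 * m * δ * ‖s₀‖ ≤ ∑ I, c I * Real.exp (2 * (wt s I - ∑ k, s k * x k)) := by
      calc 2 * m * δ * ‖s₀‖ = m * (2 * (δ * ‖s₀‖)) := by ring
        _ ≤ c I * Real.exp (2 * (wt s I - ∑ k, s k * x k)) := by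
          refine mul_le_mul (hmc I hIσ) ?_ (by positivity) (hc I)
          have := Real.add_one_le_exp (2 * (wt s I - ∑ k, s k * x k))
          linarith
        _ ≤ _ := Finset.single_le_sum
          (f := fun I => c I * Real.exp (2 * (wt s I - ∑ k, s k * x k)))
          (fun I _ => mul_nonneg (hc I) (Real.exp_pos _).le) (Finset.mem_univ I)
    have h2 : |a| - 1 ≤ (∑ k, s k) ^ 2 := by
      have h3 : |a| ≤ |∑ k, s k| := by
        rw [hsa, abs_mul, Nat.abs_cast]
        have : (1 : ℝ) ≤ n := by exact_mod_cast hn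
        nlinarith [abs_nonneg a]
      nlinarith [sq_abs (∑ k, s k), abs_nonneg (∑ k, s k), sq_nonneg (|∑ k, s k| - 1)]
    have h4 : ‖s‖ ≤ ‖s₀‖ + |a| := by
      rw [pi_norm_le_iff_of_nonneg (by positivity)]
      intro k
      have : s k = s₀ k + a := by simp [hs₀]
      rw [this]
      exact (norm_add_le _ _).trans (add_le_add (norm_le_pi_norm s₀ k) le_rfl)
    have h5 : η * ‖s‖ ≤ 2 * m * δ * ‖s₀‖ + |a| := by
      calc η * ‖s‖ ≤ η * (‖s₀‖ + |a|) := by gcongr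
        _ = η * ‖s₀‖ + η * |a| := by ring
        _ ≤ 2 * m * δ * ‖s₀‖ + 1 * |a| := by
          gcongr
          · exact min_le_left _ _
          · exact min_le_right _ _
        _ = _ := by ring
    rw [energy]
    linarith
  refine tendsto_atTop_mono hbound ?_
  exact tendsto_atTop_add_const_right _ _ (tendsto_norm_cocompact_atTop.const_mul_atTop hη0)

/-- At a minimum of the energy each partial derivative is a positive multiple of the moment equation
plus 2 ∑ s. Summing over the coordinates removes the moment part, because the coordinates of each
Λ_I - x add up to zero. So ∑ s = 0 and then the moment equation holds. -/
theorem exists_scaledMoment_eq_zero {x : Fin n → ℝ} {c : Pair n → ℝ} (hc : ∀ I, 0 ≤ c I)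
    (h : IsInner x (weightSupp c)) : ∃ s : Fin n → ℝ, ∑ k, s k = 0 ∧ scaledMoment x c s = 0 := by
  have hx2 := h.sum_eq_two
  have hn : (n : ℝ) ≠ 0 := by
    rintro h0
    have : n = 0 := by exact_mod_cast h0
    subst this
    simp at hx2
  have hcont : Continuous (energy x c) := by
    unfold energy wt
    fun_prop
  obtain ⟨s, hs⟩ := hcont.exists_forall_le (tendsto_energy hc h)
  have hcrit : ∀ k, (∑ I, c I * (Real.exp (2 * (wt s I - ∑ k, s k * x k))
      * (2 * (vertex I k - x k)))) + 2 * ∑ k, s k = 0 := by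
    intro k
    let d : Fin n → ℝ := Pi.single k 1
    have hd1 : ∀ I, wt d I = vertex I k := by
      intro I
      rw [← sum_mul_vertex]
      simp [d, Pi.single_apply]
    have hd2 : ∑ j, d j * x j = x k := by simp [d, Pi.single_apply]
    have hd3 : ∑ j, d j = 1 := by simp [d]
    have heq : ∀ t : ℝ, energy x c (s + t • d)
        = ∑ I, c I * Real.exp (2 * (wt s I - ∑ k, s k * x k) + t * (2 * (vertex I k - x k)))
          + (∑ k, s k + t) ^ 2 := by
      intro t
      have e1 : ∀ I, wt (s + t • d) I = wt s I + t * vertex I k := fun I => by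
        rw [wt_add, ← hd1]; simp only [wt, Pi.smul_apply, smul_eq_mul]; ring
      have e2 : ∑ j, (s + t • d) j * x j = ∑ j, s j * x j + t * x k := by
        simp only [Pi.add_apply, Pi.smul_apply, smul_eq_mul, add_mul, Finset.sum_add_distrib,
          mul_assoc, ← Finset.mul_sum, hd2]
      have e3 : ∑ j, (s + t • d) j = ∑ j, s j + t := by
        simp only [Pi.add_apply, Pi.smul_apply, smul_eq_mul, Finset.sum_add_distrib,
          ← Finset.mul_sum, hd3, mul_one]
      simp only [energy, e1, e2, e3]
      congr 1
      refine Finset.sum_congr rfl fun I _ => ?_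
      congr 2
      ring
    have hder : HasDerivAt (fun t : ℝ => energy x c (s + t • d))
        ((∑ I, c I * (Real.exp (2 * (wt s I - ∑ k, s k * x k))
          * (2 * (vertex I k - x k)))) + 2 * ∑ k, s k) 0 := by
      simp only [heq]
      have h1 : ∀ I, HasDerivAt (fun t : ℝ => c I * Real.exp (2 * (wt s I - ∑ k, s k * x k)
          + t * (2 * (vertex I k - x k)))) (c I * (Real.exp (2 * (wt s I - ∑ k, s k * x k))
          * (2 * (vertex I k - x k)))) 0 := by
        intro I
        have h2 : HasDerivAt (fun t : ℝ => 2 * (wt s I - ∑ k, s k * x k)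
          + t * (2 * (vertex I k - x k))) (2 * (vertex I k - x k)) 0 := by
          simpa using ((hasDerivAt_id (0 : ℝ)).mul_const (2 * (vertex I k - x k))).const_add
            (2 * (wt s I - ∑ k, s k * x k))
        simpa using h2.exp.const_mul (c I)
      have h3 : HasDerivAt (fun t : ℝ => (∑ k, s k + t) ^ 2) (2 * ∑ k, s k) 0 := by
        simpa using ((hasDerivAt_id (0 : ℝ)).const_add (∑ k, s k)).fun_pow 2
      exact (HasDerivAt.fun_sum fun I _ => h1 I).add h3
    have hmin : IsLocalMin (fun t : ℝ => energy x c (s + t • d)) 0 :=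
      Eventually.of_forall fun t => by simpa using hs (s + t • d)
    exact hmin.hasDerivAt_eq_zero hder
  have hfac : ∀ k, ∑ I, c I * (Real.exp (2 * (wt s I - ∑ k, s k * x k))
      * (2 * (vertex I k - x k)))
      = 2 * Real.exp (-(2 * ∑ k, s k * x k)) * scaledMoment x c s k := by
    intro k
    simp only [scaledMoment, Finset.sum_apply, Pi.smul_apply, Pi.sub_apply, smul_eq_mul]
    rw [Finset.mul_sum]
    refine Finset.sum_congr rfl fun I _ => ?_
    have : Real.exp (2 * (wt s I - ∑ k, s k * x k))
        = Real.exp (2 * wt s I) * Real.exp (-(2 * ∑ k, s k * x k)) := by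
      rw [← Real.exp_add]; ring_nf
    rw [this]; ring
  simp only [hfac] at hcrit
  have hsum : ∑ k, s k = 0 := by
    have h1 := Finset.sum_congr rfl fun k (_ : k ∈ Finset.univ) => hcrit k
    simp only [Finset.sum_add_distrib, ← Finset.mul_sum, sum_scaledMoment hx2, Finset.sum_const,
      Finset.card_univ, Fintype.card_fin, nsmul_eq_mul] at h1
    simpa [hn] using h1
  refine ⟨s, hsum, funext fun k => ?_⟩
  have := hcrit k
  rw [hsum, mul_zero, add_zero] at this
  exact (mul_eq_zero.1 this).resolve_left (by positivity)

/-! ### Smooth dependence of the solution on the weights -/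

/-- The moment equation together with the normalisation of the solution. -/
def normalizedMoment (x : Fin n → ℝ) (q : (Pair n → ℝ) × (Fin n → ℝ)) : Fin n → ℝ :=
  scaledMoment x q.1 q.2 + fun _ => ∑ k, q.2 k

/-- The moment equation takes values in the vectors with sum zero and the added term is diagonal, so
the two parts vanish separately. The normalisation makes the system square. -/
theorem normalizedMoment_eq_zero_iff {x : Fin n → ℝ} (hx : ∑ k, x k = 2) (c : Pair n → ℝ)
    (s : Fin n → ℝ) :
    normalizedMoment x (c, s) = 0 ↔ ∑ k, s k = 0 ∧ scaledMoment x c s = 0 := by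
  have hn : (n : ℝ) ≠ 0 := by
    rintro h0
    have : n = 0 := by exact_mod_cast h0
    subst this
    simp at hx
  constructor
  · intro h
    have h1 : ∑ k, normalizedMoment x (c, s) k = 0 := by rw [h]; simp
    simp only [normalizedMoment, Pi.add_apply, Finset.sum_add_distrib, sum_scaledMoment hx,
      Finset.sum_const, Finset.card_univ, Fintype.card_fin, nsmul_eq_mul] at h1
    have h2 : ∑ k, s k = 0 := by simpa [hn] using h1
    refine ⟨h2, ?_⟩
    rw [← h, normalizedMoment]
    funext k
    simp [h2]
  · rintro ⟨h1, h2⟩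
    rw [normalizedMoment]
    funext k
    simp [h1, h2]

theorem contDiff_normalizedMoment (x : Fin n → ℝ) : ContDiff ℝ ∞ (normalizedMoment x) := by
  refine contDiff_pi.2 fun k => ?_
  simp only [normalizedMoment, scaledMoment, wt, Pi.add_apply, Finset.sum_apply, Pi.smul_apply,
    Pi.sub_apply, smul_eq_mul]
  fun_prop

theorem hasDerivAt_normalizedMoment (x : Fin n → ℝ) (c : Pair n → ℝ) (s d : Fin n → ℝ) :
    HasDerivAt (fun t : ℝ => normalizedMoment x (c, s + t • d))
      ((∑ I, (c I * (Real.exp (2 * wt s I) * (2 * wt d I))) • (vertex I - x))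
        + fun _ => ∑ k, d k) 0 := by
  have h1 : ∀ I, HasDerivAt (fun t : ℝ => c I * Real.exp (2 * wt (s + t • d) I))
      (c I * (Real.exp (2 * wt s I) * (2 * wt d I))) 0 := by
    intro I
    have h2 : ∀ t : ℝ, wt (s + t • d) I = wt s I + t * wt d I := fun t => by
      simp only [wt, Pi.add_apply, Pi.smul_apply, smul_eq_mul]; ring
    have h3 : HasDerivAt (fun t : ℝ => 2 * wt (s + t • d) I) (2 * wt d I) 0 := by
      simp only [h2]
      simpa using (((hasDerivAt_id (0 : ℝ)).mul_const (wt d I)).const_add (wt s I)).const_mul 2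
    simpa using h3.exp.const_mul (c I)
  have h4 : HasDerivAt (fun t : ℝ => fun _ : Fin n => ∑ k, (s + t • d) k)
      (fun _ => ∑ k, d k) 0 := by
    refine hasDerivAt_pi.2 fun _ => HasDerivAt.fun_sum fun k _ => ?_
    simpa using ((hasDerivAt_id (0 : ℝ)).mul_const (d k)).const_add (s k)
  exact (HasDerivAt.fun_sum fun I _ => (h1 I).smul_const _).add h4

/-- Infinitesimal uniqueness: the linearised equation paired with `d` yields a vanishing sum of
positive multiples of (wt d I - a)² over the support, so rigidity makes `d` constant, and its sum is
zero. -/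
theorem injective_fderiv_normalizedMoment {x : Fin n → ℝ} (hx : ∑ k, x k = 2) {c : Pair n → ℝ}
    (hc : ∀ I, 0 ≤ c I) (hr : IsRigid (weightSupp c)) {s : Fin n → ℝ}
    (hs : scaledMoment x c s = 0) {d : Fin n → ℝ}
    (hd : fderiv ℝ (normalizedMoment x) (c, s) (0, d) = 0) : d = 0 := by
  have hn : (n : ℝ) ≠ 0 := by
    rintro h0
    have : n = 0 := by exact_mod_cast h0
    subst this
    simp at hx
  have h1 : HasDerivAt (fun t : ℝ => normalizedMoment x (c, s + t • d)) 0 0 := by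
    have h2 : HasDerivAt (fun t : ℝ => (c, s + t • d)) ((0 : Pair n → ℝ), d) 0 := by
      refine (hasDerivAt_const (0 : ℝ) c).prodMk ?_
      simpa using ((hasDerivAt_id (0 : ℝ)).smul_const d).const_add s
    have h3 := ((contDiff_normalizedMoment x).differentiable (by simp)
      (c, s + (0 : ℝ) • d)).hasFDerivAt.comp_hasDerivAt (0 : ℝ) h2
    rwa [zero_smul, add_zero, hd] at h3
  have h2 := (hasDerivAt_normalizedMoment x c s d).unique h1
  set a := ∑ k, d k * x k with ha
  have hvx : ∀ I : Pair n, ∑ k, (vertex I k - x k) = 0 := fun I => by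
    rw [Finset.sum_sub_distrib, sum_vertex, hx, sub_self]
  have hsum : ∑ k, d k = 0 := by
    have h3 : ∑ k, ((∑ I, (c I * (Real.exp (2 * wt s I) * (2 * wt d I))) • (vertex I - x))
        + fun _ => ∑ k, d k : Fin n → ℝ) k = 0 := by rw [h2]; simp
    simp only [Pi.add_apply, Finset.sum_apply, Pi.smul_apply, Pi.sub_apply, smul_eq_mul,
      Finset.sum_add_distrib, Finset.sum_const, Finset.card_univ, Fintype.card_fin,
      nsmul_eq_mul] at h3
    rw [Finset.sum_comm] at h3
    simp only [← Finset.mul_sum, hvx, mul_zero, Finset.sum_const_zero, zero_add] at h3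
    exact (mul_eq_zero.1 h3).resolve_left hn
  have hpair : ∑ I, c I * (Real.exp (2 * wt s I) * (2 * wt d I)) * (wt d I - a) = 0 := by
    have h3 : ∑ k, d k * ((∑ I, (c I * (Real.exp (2 * wt s I) * (2 * wt d I))) • (vertex I - x))
        + fun _ => ∑ k, d k : Fin n → ℝ) k = 0 := by rw [h2]; simp
    rw [hsum] at h3
    simp only [Pi.add_apply, Finset.sum_apply, Pi.smul_apply, Pi.sub_apply, smul_eq_mul, add_zero,
      Finset.mul_sum] at h3
    rw [Finset.sum_comm] at h3
    rw [← h3]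
    refine Finset.sum_congr rfl fun I _ => ?_
    rw [ha, ← sum_mul_vertex d I, ← Finset.sum_sub_distrib, Finset.mul_sum]
    exact Finset.sum_congr rfl fun k _ => by ring
  have hpair0 := sum_mul_scaledMoment x c s d
  simp only [hs, Pi.zero_apply, mul_zero, Finset.sum_const_zero, ← ha] at hpair0
  have hsq : ∑ I, c I * Real.exp (2 * wt s I) * (wt d I - a) ^ 2 = 0 := by
    have : ∀ I, c I * Real.exp (2 * wt s I) * (wt d I - a) ^ 2
        = 1 / 2 * (c I * (Real.exp (2 * wt s I) * (2 * wt d I)) * (wt d I - a))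
          - a * (c I * Real.exp (2 * wt s I) * (wt d I - a)) := fun I => by ring
    simp only [this, Finset.sum_sub_distrib, ← Finset.mul_sum, hpair, ← hpair0]
    simp
  rw [Finset.sum_eq_zero_iff_of_nonneg fun I _ =>
    mul_nonneg (mul_nonneg (hc I) (Real.exp_pos _).le) (sq_nonneg _)] at hsq
  have hconst := hr d a fun I hI => by
    have := hsq I (Finset.mem_univ I)
    have h3 : c I * Real.exp (2 * wt s I) ≠ 0 := mul_ne_zero hI (Real.exp_pos _).ne'
    have h4 := (mul_eq_zero.1 this).resolve_left h3
    have h5 := pow_eq_zero_iff (two_ne_zero) |>.1 h4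
    linarith
  funext i
  have h3 : ∑ k, d k = n * d i := by
    rw [Finset.sum_congr rfl fun k _ => hconst k i]
    simp
  rw [hsum] at h3
  simpa [hn] using h3.symm

/-- The solution of the moment equation depends smoothly on the weights. -/
theorem exists_contDiffAt_solution {x : Fin n → ℝ} (hx : ∑ k, x k = 2) {c : Pair n → ℝ}
    (hc : ∀ I, 0 ≤ c I) (hr : IsRigid (weightSupp c)) {s : Fin n → ℝ} (hs0 : ∑ k, s k = 0)
    (hs : scaledMoment x c s = 0) :
    ∃ ψ : (Pair n → ℝ) → Fin n → ℝ, ContDiffAt ℝ ∞ ψ c ∧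
      ∀ᶠ c' in 𝓝 c, ∑ k, ψ c' k = 0 ∧ scaledMoment x c' (ψ c') = 0 := by
  have hF : ContDiffAt ℝ ∞ (normalizedMoment x) (c, s) := (contDiff_normalizedMoment x).contDiffAt
  have hinj : Function.Injective (fderiv ℝ (normalizedMoment x) (c, s) ∘L .inr ℝ _ (Fin n → ℝ)) := by
    rw [injective_iff_map_eq_zero]
    intro d hd
    exact injective_fderiv_normalizedMoment hx hc hr hs hd
  have hinv : (fderiv ℝ (normalizedMoment x) (c, s) ∘L .inr ℝ _ (Fin n → ℝ)).IsInvertible :=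
    ⟨(LinearEquiv.ofInjectiveEndo (fderiv ℝ (normalizedMoment x) (c, s)
      ∘L .inr ℝ _ (Fin n → ℝ)).toLinearMap hinj).toContinuousLinearEquiv, by ext; rfl⟩
  refine ⟨hF.implicitFunction (by simp) hinv, hF.contDiffAt_implicitFunction (by simp) hinv, ?_⟩
  have h0 : normalizedMoment x (c, s) = 0 := (normalizedMoment_eq_zero_iff hx c s).2 ⟨hs0, hs⟩
  filter_upwards [hF.eventually_apply_implicitFunction (by simp) hinv] with c' hc'
  exact (normalizedMoment_eq_zero_iff hx _ _).1 (hc'.trans h0)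

/-! ### The retraction to a level set -/

/-- The planes which are stable for `x`. -/
def stable (x : Fin n → ℝ) : Set (Gr n) := {L | IsInner x (supp L)}

theorem isOpen_stable (x : Fin n → ℝ) : IsOpen (stable x) := isOpen_isInner_supp x

/-- The squares of the absolute values of the Plücker coordinates. -/
def weights (A : Matrix (Fin n) (Fin 2) ℂ) (I : Pair n) : ℝ := ‖plucker A I‖ ^ 2

theorem weights_nonneg (A : Matrix (Fin n) (Fin 2) ℂ) (I : Pair n) : 0 ≤ weights A I := by
  unfold weights; positivity

theorem weightSupp_weights {A : Matrix (Fin n) (Fin 2) ℂ} {L : Gr n} (hA : IsFrame A L) :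
    weightSupp (weights A) = supp L := by
  ext I
  rw [mem_supp_iff hA]
  simp [weightSupp, weights]

theorem scaledMoment_weights_mul (x : Fin n → ℝ) (A : Matrix (Fin n) (Fin 2) ℂ)
    (g : Matrix (Fin 2) (Fin 2) ℂ) (s : Fin n → ℝ) :
    scaledMoment x (weights (A * g)) s = ‖g.det‖ ^ 2 • scaledMoment x (weights A) s := by
  simp only [scaledMoment, Finset.smul_sum, smul_smul, weights, plucker_mul, norm_mul, mul_pow,
    mul_assoc]

theorem scaledMoment_weights_eq_zero_iff {x : Fin n → ℝ} {A B : Matrix (Fin n) (Fin 2) ℂ}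
    {L : Gr n} (hA : IsFrame A L) (hB : IsFrame B L) (s : Fin n → ℝ) :
    scaledMoment x (weights A) s = 0 ↔ scaledMoment x (weights B) s = 0 := by
  obtain ⟨g, hg, rfl⟩ := hA.exists_mul hB
  have h0 : ‖g.det‖ ^ 2 ≠ 0 := by simpa using hg.ne_zero
  rw [scaledMoment_weights_mul, smul_eq_zero]
  exact ⟨Or.inr, fun h => h.resolve_left h0⟩

/-- The positive real elements of the complex torus. -/
def expUnits (s : Fin n → ℝ) (i : Fin n) : ℂˣ :=
  Units.mk0 (Real.exp (s i) : ℂ) (by exact_mod_cast (Real.exp_pos _).ne')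

theorem momentMap_eq_iff {x : Fin n → ℝ} {A : Matrix (Fin n) (Fin 2) ℂ} {L : Gr n}
    (hA : IsFrame A L) : momentMap L = x ↔ scaledMoment x (weights A) 0 = 0 := by
  have hN := sum_norm_sq_pos (plucker_ne_zero hA)
  rw [momentMap_eq hA, inv_smul_eq_iff₀ hN.ne', ← sub_eq_zero, scaledMoment]
  simp [wt, weights, smul_sub, Finset.sum_smul]

theorem weights_expUnits (s : Fin n → ℝ) (A : Matrix (Fin n) (Fin 2) ℂ) (I : Pair n) :
    weights (scale (fun i => (expUnits s i : ℂ)) A) I = weights A I * Real.exp (2 * wt s I) := by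
  have : 2 * wt s I = s I.1.1 + s I.1.1 + (s I.1.2 + s I.1.2) := by simp only [wt]; ring
  rw [weights, plucker_units, weights, norm_mul, norm_mul, this, Real.exp_add, Real.exp_add,
    Real.exp_add]
  simp only [expUnits, Units.val_mk0, Complex.norm_real, Real.norm_eq_abs, Real.abs_exp]
  ring

theorem scaledMoment_expUnits (x : Fin n → ℝ) (s s' : Fin n → ℝ) (A : Matrix (Fin n) (Fin 2) ℂ) :
    scaledMoment x (weights (scale (fun i => (expUnits s i : ℂ)) A)) s'
      = scaledMoment x (weights A) (s + s') := by
  simp only [scaledMoment, weights_expUnits, wt_add, mul_add, Real.exp_add, mul_assoc]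

theorem momentMap_expUnits_iff {x : Fin n → ℝ} {A : Matrix (Fin n) (Fin 2) ℂ} {L : Gr n}
    (hA : IsFrame A L) (s : Fin n → ℝ) :
    momentMap (expUnits s • L) = x ↔ scaledMoment x (weights A) s = 0 := by
  rw [momentMap_eq_iff (hA.scale (expUnits s)), scaledMoment_expUnits, add_zero]

open Classical in
/-- The logarithm of the rescaling that moves a stable plane to the level set at `x`. -/
def logScale (x : Fin n → ℝ) (L : Gr n) : Fin n → ℝ :=
  if h : ∃ s : Fin n → ℝ, ∑ k, s k = 0 ∧ scaledMoment x (weights (frame L)) s = 0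
  then h.choose else 0

theorem logScale_spec {x : Fin n → ℝ} {L : Gr n} (hL : L ∈ stable x) :
    ∑ k, logScale x L k = 0 ∧ scaledMoment x (weights (frame L)) (logScale x L) = 0 := by
  have h := exists_scaledMoment_eq_zero (x := x) (weights_nonneg (frame L))
    (by rw [weightSupp_weights (isFrame_frame L)]; exact hL)
  rw [logScale, dif_pos h]
  exact h.choose_spec

theorem eq_of_sum_eq_of_sub_const {s s' : Fin n → ℝ} (h : ∀ i j, s' i - s i = s' j - s j)
    (hs : ∑ k, s k = ∑ k, s' k) : s' = s := by
  funext i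
  have h1 : ∑ k, (s' k - s k) = n * (s' i - s i) := by
    rw [Finset.sum_congr rfl fun k _ => h k i]
    simp [mul_sub]
  rw [Finset.sum_sub_distrib, hs, sub_self] at h1
  have hn : (n : ℝ) ≠ 0 := by
    have := i.pos
    exact_mod_cast this.ne'
  have := (mul_eq_zero.1 h1.symm).resolve_left hn
  linarith

theorem eq_logScale {x : Fin n → ℝ} {L : Gr n} (hL : L ∈ stable x) {A : Matrix (Fin n) (Fin 2) ℂ}
    (hA : IsFrame A L) {s : Fin n → ℝ} (hs0 : ∑ k, s k = 0)
    (hs : scaledMoment x (weights A) s = 0) : logScale x L = s := by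
  have h := logScale_spec hL
  refine eq_of_sum_eq_of_sub_const (fun i j => ?_) (hs0.trans h.1.symm)
  refine eq_const_of_scaledMoment_eq_zero (weights_nonneg A) ?_ hs
    ((scaledMoment_weights_eq_zero_iff (isFrame_frame L) hA _).1 h.2) i j
  rw [weightSupp_weights hA]
  exact IsInner.isRigid hL

/-- By uniqueness the chosen solution coincides near L with the implicit function evaluated at the
weights of a smooth frame. -/
theorem contMDiffAt_logScale {x : Fin n → ℝ} {L : Gr n} (hL : L ∈ stable x) :
    ContMDiffAt 𝓘(ℝ, GrModel n) 𝓘(ℝ, Fin n → ℝ) ∞ (logScale x) L := by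
  obtain ⟨e, Z, rfl⟩ := exists_graph_eq L
  refine contMDiffAt_of_comp_graph ?_
  have hx : ∑ k, x k = 2 := IsInner.sum_eq_two hL
  have h := logScale_spec hL
  have hA := isFrame_graphFrame e Z
  obtain ⟨ψ, hψ, hψ'⟩ := exists_contDiffAt_solution hx (weights_nonneg (graphFrame e Z))
    (by rw [weightSupp_weights hA]; exact IsInner.isRigid hL) h.1
    ((scaledMoment_weights_eq_zero_iff (isFrame_frame _) hA _).1 h.2)
  have hw : ContDiffAt ℝ ∞ (fun Z => weights (graphFrame e Z)) Z := contDiffAt_pi.2 fun I =>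
    (contDiffAt_pi.1 (smoothFrameAt_graphFrame e Z).contDiffAt_plucker I).norm_sq ℝ
  refine ((hψ.comp Z hw).congr_of_eventuallyEq ?_).contMDiffAt
  have hst : ∀ᶠ Z' in 𝓝 Z, graph e Z' ∈ stable x :=
    (contMDiff_graph e).continuous.continuousAt.eventually ((isOpen_stable x).mem_nhds hL)
  filter_upwards [hw.continuousAt.eventually hψ', hst] with Z' hZ' hZs
  exact eq_logScale hZs (isFrame_graphFrame e Z') hZ'.1 hZ'.2

/-- The retraction of the stable planes to the level set at `x`. -/
def retract (x : Fin n → ℝ) (L : Gr n) : Gr n := expUnits (logScale x L) • L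

theorem momentMap_retract {x : Fin n → ℝ} {L : Gr n} (hL : L ∈ stable x) :
    momentMap (retract x L) = x :=
  (momentMap_expUnits_iff (isFrame_frame L) _).2 (logScale_spec hL).2

theorem smul_mem_stable_iff {x : Fin n → ℝ} (t : Fin n → ℂˣ) (L : Gr n) :
    t • L ∈ stable x ↔ L ∈ stable x := by
  simp only [stable, Set.mem_ofPred_eq, supp_smul]

theorem retract_mem_stable_iff {x : Fin n → ℝ} (L : Gr n) :
    retract x L ∈ stable x ↔ L ∈ stable x := smul_mem_stable_iff _ L

theorem expUnits_zero : expUnits (0 : Fin n → ℝ) = 1 := by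
  funext i
  ext
  simp [expUnits]

theorem retract_eq_self {x : Fin n → ℝ} {L : Gr n} (hL : L ∈ stable x) (h : momentMap L = x) :
    retract x L = L := by
  have := eq_logScale hL (isFrame_frame L) (s := 0) (by simp)
    ((momentMap_eq_iff (isFrame_frame L)).1 h)
  rw [retract, this, expUnits_zero, one_smul]

/-! ### Polar decomposition of the torus and equivariance of the retraction -/

/-- The phases of an element of the complex torus. -/
def phase (t : Fin n → ℂˣ) (i : Fin n) : Circle := Circle.exp (Complex.arg (t i))

theorem expUnits_mul_phase (t : Fin n → ℂˣ) (i : Fin n) :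
    t i = expUnits (fun i => Real.log ‖(t i : ℂ)‖) i * Circle.toUnits (phase t i) := by
  ext
  have h : 0 < ‖(t i : ℂ)‖ := norm_pos_iff.2 (t i).ne_zero
  simp only [expUnits, phase, Units.val_mul, Units.val_mk0, Real.exp_log h]
  exact (Complex.norm_mul_exp_arg_mul_I (t i : ℂ)).symm

theorem expUnits_add (s s' : Fin n → ℝ) (i : Fin n) :
    expUnits (s + s') i = expUnits s i * expUnits s' i := by
  ext
  simp [expUnits, Complex.exp_add]

/-- The retraction is equivariant. -/
theorem retract_smul {x : Fin n → ℝ} {L : Gr n} (hL : L ∈ stable x) (t : Fin n → ℂˣ) :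
    retract x (t • L) = phase t • retract x L := by
  set r : Fin n → ℝ := fun i => Real.log ‖(t i : ℂ)‖ with hr
  have hA := isFrame_frame L
  have h := logScale_spec hL
  have h' := logScale_spec ((smul_mem_stable_iff t L).2 hL)
  rw [scaledMoment_weights_eq_zero_iff (isFrame_frame _) (hA.scale t)] at h'
  -- The moment equation sees only absolute values of Plücker coordinates, so `t` may be replaced by
  -- its positive part exp r.
  have hw : weights (scale (fun i => (t i : ℂ)) (frame L))
      = weights (scale (fun i => (expUnits r i : ℂ)) (frame L)) := by
    funext I
    have hn : ∀ i, ‖(expUnits r i : ℂ)‖ = ‖(t i : ℂ)‖ := fun i => by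
      have h : 0 < ‖(t i : ℂ)‖ := norm_pos_iff.2 (t i).ne_zero
      simp [expUnits, hr, Real.exp_log h]
    simp only [weights, plucker_units, norm_mul, hn]
  rw [hw, scaledMoment_expUnits] at h'
  have hconst := eq_const_of_scaledMoment_eq_zero (weights_nonneg _)
    (by rw [weightSupp_weights hA]; exact IsInner.isRigid hL) h.2 h'.2
  -- By uniqueness the two solutions differ by a multiple of (1, …, 1), and a constant element of
  -- the torus acts trivially.
  have hq : ∀ i j, expUnits (r + logScale x (t • L) - logScale x L) i
      = expUnits (r + logScale x (t • L) - logScale x L) j := by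
    intro i j
    ext
    simp only [expUnits, Units.val_mk0, Pi.sub_apply, hconst i j]
  have hfac : expUnits (logScale x (t • L)) * t
      = expUnits (r + logScale x (t • L) - logScale x L)
        * ((fun i => Circle.toUnits (phase t i)) * expUnits (logScale x L)) := by
    funext i
    have e1 : expUnits (r + logScale x (t • L) - logScale x L) i * expUnits (logScale x L) i
        = expUnits r i * expUnits (logScale x (t • L)) i := by
      rw [← expUnits_add, ← expUnits_add, sub_add_cancel]
    simp only [Pi.mul_apply]
    rw [mul_left_comm, e1, mul_left_comm]
    conv_lhs => rw [expUnits_mul_phase t i]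
    rw [mul_comm (expUnits _ i), mul_comm (expUnits _ i), ← hr, mul_assoc]
    exact mul_left_comm _ _ _
  rw [retract, smul_smul, hfac, mul_smul, smul_eq_of_const hq, mul_smul]
  rfl

theorem SmoothFrameAt.expUnits {E' H' X : Type*} [NormedAddCommGroup E'] [NormedSpace ℝ E']
    [TopologicalSpace H'] {J : ModelWithCorners ℝ E' H'} [TopologicalSpace X] [ChartedSpace H' X]
    {x : X} {A : X → Matrix (Fin n) (Fin 2) ℂ} (hA : SmoothFrameAt J A x) {s : X → Fin n → ℝ}
    (hs : ContMDiffAt J 𝓘(ℝ, Fin n → ℝ) ∞ s x) :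
    SmoothFrameAt J (fun y => SymplecticReduction.scale
      (fun i => (SymplecticReduction.expUnits (s y) i : ℂ)) (A y)) x := by
  refine hA.scale fun i => ?_
  have h : ContDiff ℝ ∞ fun a : ℝ => ((Real.exp a : ℝ) : ℂ) :=
    Complex.ofRealCLM.contDiff.comp Real.contDiff_exp
  exact (h.contMDiff.contMDiffAt).comp x (contMDiffAt_pi_space.1 hs i)

theorem exists_smoothFrameAt (L : Gr n) : ∃ A : Gr n → Matrix (Fin n) (Fin 2) ℂ,
    SmoothFrameAt 𝓘(ℝ, GrModel n) A L ∧ ∀ᶠ M in 𝓝 L, IsFrame (A M) M := by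
  obtain ⟨e, he⟩ := exists_mem_source L
  refine ⟨fun M => graphFrame e (grHomeo e M), fun i j => ?_, ?_⟩
  · exact ((contDiff_graphFrame e i j).contMDiff.contMDiffAt).comp L (contMDiffAt_grHomeo e he)
  · filter_upwards [(grHomeo e).open_source.mem_nhds he] with M hM
    have h1 := isFrame_graphFrame e (grHomeo e M)
    rwa [show graph e (grHomeo e M) = M from (grHomeo e).left_inv hM] at h1

theorem contMDiffAt_retract {x : Fin n → ℝ} {L : Gr n} (hL : L ∈ stable x) :
    ContMDiffAt 𝓘(ℝ, GrModel n) 𝓘(ℝ, GrModel n) ∞ (retract x) L := by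
  obtain ⟨A, hA, hF⟩ := exists_smoothFrameAt L
  refine (hA.expUnits (contMDiffAt_logScale hL)).contMDiffAt ?_
  filter_upwards [hF] with M hM
  exact hM.scale _

/-! ### Slices for the action of the complex torus -/

/-- A numbering of the coordinates, in which three of them are distinguished, and a number different
from `0` and `1`. It gives a slice: the planes spanned by `(1, …, 1)` and a vector with the
distinguished coordinates `0`, `1` and `m`. -/
structure Slice (n : ℕ) where
  num : Option (Fin 2 ⊕ Fin (n - 3)) ≃ Fin n
  m : ℂ
  ne_zero : m ≠ 0
  ne_one : m ≠ 1

namespace Slice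

variable (c : Slice n)

/-- The first distinguished coordinate. -/
def i : Fin n := c.num (some (Sum.inl 0))
/-- The second distinguished coordinate. -/
def j : Fin n := c.num (some (Sum.inl 1))
/-- The third distinguished coordinate. -/
def k : Fin n := c.num none
/-- The other coordinates. -/
def l (q : Fin (n - 3)) : Fin n := c.num (some (Sum.inr q))

/-- The second vector of the frame of a plane in the slice. -/
def vec (v : Fin (n - 3) → ℂ) (a : Fin n) : ℂ := (c.num.symm a).elim c.m (Sum.elim ![0, 1] v)

theorem vec_i (v : Fin (n - 3) → ℂ) : c.vec v c.i = 0 := by simp [vec, i]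
theorem vec_j (v : Fin (n - 3) → ℂ) : c.vec v c.j = 1 := by simp [vec, j]
theorem vec_k (v : Fin (n - 3) → ℂ) : c.vec v c.k = c.m := by simp [vec, k]
theorem vec_l (v : Fin (n - 3) → ℂ) (q : Fin (n - 3)) : c.vec v (c.l q) = v q := by simp [vec, l]

/-- A property of all coordinates. -/
theorem forall_coord {p : Fin n → Prop} (hi : p c.i) (hj : p c.j) (hk : p c.k)
    (hl : ∀ q, p (c.l q)) (a : Fin n) : p a := by
  obtain ⟨b, rfl⟩ := c.num.surjective a
  rcases b with _ | b | q
  · exact hk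
  · fin_cases b
    · exact hi
    · exact hj
  · exact hl q

/-- The frame of a plane in the slice. -/
def mat (v : Fin (n - 3) → ℂ) : Matrix (Fin n) (Fin 2) ℂ := Matrix.of fun a => ![1, c.vec v a]

theorem minor_mat (v : Fin (n - 3) → ℂ) (a b : Fin n) :
    minor (c.mat v) a b = c.vec v b - c.vec v a := by
  simp [minor, mat]

theorem exists_plane (v : Fin (n - 3) → ℂ) : ∃ L : Gr n, IsFrame (c.mat v) L :=
  isFrame_of_minor_ne_zero (i := c.i) (j := c.j) (by rw [minor_mat, vec_i, vec_j]; simp)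

/-- The planes in the slice. -/
def plane (v : Fin (n - 3) → ℂ) : Gr n := (c.exists_plane v).choose

theorem isFrame_mat (v : Fin (n - 3) → ℂ) : IsFrame (c.mat v) (c.plane v) :=
  (c.exists_plane v).choose_spec

theorem contDiff_vec (a : Fin n) : ContDiff ℝ ∞ fun v => c.vec v a := by
  refine c.forall_coord (p := fun a => ContDiff ℝ ∞ fun v => c.vec v a) ?_ ?_ ?_ (fun q => ?_) a
  · simp only [vec_i]; exact contDiff_const
  · simp only [vec_j]; exact contDiff_const
  · simp only [vec_k]; exact contDiff_const
  · simp only [vec_l]; exact contDiff_apply ℝ ℂ q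

theorem smoothFrameAt_mat (v : Fin (n - 3) → ℂ) :
    SmoothFrameAt 𝓘(ℝ, Fin (n - 3) → ℂ) c.mat v := by
  intro a b
  fin_cases b
  · exact contMDiffAt_const (c := (1 : ℂ))
  · exact (c.contDiff_vec a).contMDiff.contMDiffAt

theorem contMDiff_plane : ContMDiff 𝓘(ℝ, Fin (n - 3) → ℂ) 𝓘(ℝ, GrModel n) ∞ c.plane := fun v =>
  (c.smoothFrameAt_mat v).contMDiffAt (Eventually.of_forall c.isFrame_mat)

/-! ### Slice coordinates and torus coordinates of a plane -/

/-- A vector of the plane which is mapped to `(1, …, 1)` by the element of the torus that moves the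
plane to the slice. -/
def lam (A : Matrix (Fin n) (Fin 2) ℂ) (a : Fin n) : ℂ :=
  c.m * minor A c.j c.k * minor A c.i a + (1 - c.m) * minor A c.i c.k * minor A c.j a

theorem lam_i (A : Matrix (Fin n) (Fin 2) ℂ) :
    c.lam A c.i = (c.m - 1) * minor A c.i c.k * minor A c.i c.j := by
  rw [lam, minor_self, minor_swap A c.j c.i]; ring

theorem lam_j (A : Matrix (Fin n) (Fin 2) ℂ) :
    c.lam A c.j = c.m * minor A c.j c.k * minor A c.i c.j := by
  rw [lam, minor_self]; ring

theorem lam_k (A : Matrix (Fin n) (Fin 2) ℂ) :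
    c.lam A c.k = minor A c.i c.k * minor A c.j c.k := by
  rw [lam]; ring

theorem lam_mul (A : Matrix (Fin n) (Fin 2) ℂ) (g : Matrix (Fin 2) (Fin 2) ℂ) (a : Fin n) :
    c.lam (A * g) a = g.det ^ 2 * c.lam A a := by
  simp only [lam, minor_mul]; ring

/-- The factor `t c.i * t c.j * t c.k` is common to all `a`; it cancels in `coord`, along with `t
a`, and in `ratio`, which therefore records only `t a / t c.k`. -/
theorem lam_scale (t : Fin n → ℂ) (A : Matrix (Fin n) (Fin 2) ℂ) (a : Fin n) :
    c.lam (scale t A) a = t c.i * t c.j * t c.k * t a * c.lam A a := by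
  simp only [lam, minor_scale]; ring

theorem lam_mat (v : Fin (n - 3) → ℂ) (a : Fin n) : c.lam (c.mat v) a = c.m * (c.m - 1) := by
  simp only [lam, minor_mat, vec_i, vec_j, vec_k]; ring

/-- The coordinates of the plane of the slice in the orbit of a plane. -/
def coord (A : Matrix (Fin n) (Fin 2) ℂ) (q : Fin (n - 3)) : ℂ :=
  c.m * minor A c.j c.k * minor A c.i (c.l q) / c.lam A (c.l q)

theorem coord_mul (A : Matrix (Fin n) (Fin 2) ℂ) (g : Matrix (Fin 2) (Fin 2) ℂ)
    (hg : IsUnit g.det) : c.coord (A * g) = c.coord A := by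
  funext q
  simp only [coord, lam_mul, minor_mul]
  rw [show c.m * (g.det * minor A c.j c.k) * (g.det * minor A c.i (c.l q))
    = g.det ^ 2 * (c.m * minor A c.j c.k * minor A c.i (c.l q)) by ring,
    mul_div_mul_left _ _ (pow_ne_zero 2 hg.ne_zero)]

theorem coord_scale (t : Fin n → ℂ) (ht : ∀ a, t a ≠ 0) (A : Matrix (Fin n) (Fin 2) ℂ) :
    c.coord (scale t A) = c.coord A := by
  funext q
  simp only [coord, lam_scale, minor_scale]
  have h0 : t c.i * t c.j * t c.k * t (c.l q) ≠ 0 :=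
    mul_ne_zero (mul_ne_zero (mul_ne_zero (ht _) (ht _)) (ht _)) (ht _)
  rw [show c.m * (t c.j * t c.k * minor A c.j c.k) * (t c.i * t (c.l q) * minor A c.i (c.l q))
    = t c.i * t c.j * t c.k * t (c.l q) * (c.m * minor A c.j c.k * minor A c.i (c.l q)) by ring,
    mul_div_mul_left _ _ h0]

theorem coord_mat (v : Fin (n - 3) → ℂ) : c.coord (c.mat v) = v := by
  funext q
  rw [coord, lam_mat, minor_mat, minor_mat, vec_i, vec_j, vec_k, vec_l]
  have h1 := c.ne_zero
  have h2 : c.m - 1 ≠ 0 := sub_ne_zero.2 c.ne_one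
  field_simp
  ring

/-- The normalised element of the torus that moves the plane of the slice back. -/
def ratio (A : Matrix (Fin n) (Fin 2) ℂ) (a : Fin n) : ℂ := c.lam A a / c.lam A c.k

theorem ratio_mul (A : Matrix (Fin n) (Fin 2) ℂ) (g : Matrix (Fin 2) (Fin 2) ℂ)
    (hg : IsUnit g.det) : c.ratio (A * g) = c.ratio A := by
  funext a
  simp only [ratio, lam_mul]
  rw [mul_div_mul_left _ _ (pow_ne_zero 2 hg.ne_zero)]

theorem ratio_scale (t : Fin n → ℂ) (ht : ∀ a, t a ≠ 0) (A : Matrix (Fin n) (Fin 2) ℂ)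
    (a : Fin n) : c.ratio (scale t A) a = t a / t c.k * c.ratio A a := by
  simp only [ratio, lam_scale]
  have h0 : t c.i * t c.j * t c.k ≠ 0 := mul_ne_zero (mul_ne_zero (ht _) (ht _)) (ht _)
  rw [mul_assoc (t c.i * t c.j * t c.k), mul_assoc (t c.i * t c.j * t c.k),
    mul_div_mul_left _ _ h0, mul_div_mul_comm]

theorem ratio_mat (v : Fin (n - 3) → ℂ) (a : Fin n) : c.ratio (c.mat v) a = 1 := by
  rw [ratio, lam_mat, lam_mat, div_self (mul_ne_zero c.ne_zero (sub_ne_zero.2 c.ne_one))]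

/-- The planes whose orbit meets the slice. -/
def domain : Set (Gr n) := {L | ∀ a, c.lam (frame L) a ≠ 0}

theorem mem_domain_iff {A : Matrix (Fin n) (Fin 2) ℂ} {L : Gr n} (hA : IsFrame A L) :
    L ∈ c.domain ↔ ∀ a, c.lam A a ≠ 0 := by
  obtain ⟨g, hg, rfl⟩ := (isFrame_frame L).exists_mul hA
  simp only [lam_mul]
  exact forall_congr' fun a => by simp [hg.ne_zero]

/-- The slice coordinates of a plane. -/
def coords (L : Gr n) : Fin (n - 3) → ℂ := c.coord (frame L)

theorem coords_eq {A : Matrix (Fin n) (Fin 2) ℂ} {L : Gr n} (hA : IsFrame A L) :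
    c.coords L = c.coord A := by
  obtain ⟨g, hg, rfl⟩ := (isFrame_frame L).exists_mul hA
  exact (c.coord_mul _ g hg).symm

/-- The torus coordinates of a plane. -/
def torus (L : Gr n) : Fin n → ℂ := c.ratio (frame L)

theorem torus_eq {A : Matrix (Fin n) (Fin 2) ℂ} {L : Gr n} (hA : IsFrame A L) :
    c.torus L = c.ratio A := by
  obtain ⟨g, hg, rfl⟩ := (isFrame_frame L).exists_mul hA
  exact (c.ratio_mul _ g hg).symm

theorem torus_ne_zero {L : Gr n} (hL : L ∈ c.domain) (a : Fin n) : c.torus L a ≠ 0 :=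
  div_ne_zero (hL a) (hL c.k)

theorem torus_k {L : Gr n} (hL : L ∈ c.domain) : c.torus L c.k = 1 := div_self (hL c.k)

theorem plane_mem_domain (v : Fin (n - 3) → ℂ) : c.plane v ∈ c.domain :=
  (c.mem_domain_iff (c.isFrame_mat v)).2 fun a => by
    rw [lam_mat]; exact mul_ne_zero c.ne_zero (sub_ne_zero.2 c.ne_one)

theorem coords_plane (v : Fin (n - 3) → ℂ) : c.coords (c.plane v) = v := by
  rw [c.coords_eq (c.isFrame_mat v), coord_mat]

theorem torus_plane (v : Fin (n - 3) → ℂ) (a : Fin n) : c.torus (c.plane v) a = 1 := by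
  rw [c.torus_eq (c.isFrame_mat v), ratio_mat]

theorem smul_mem_domain_iff (t : Fin n → ℂˣ) (L : Gr n) : t • L ∈ c.domain ↔ L ∈ c.domain := by
  rw [c.mem_domain_iff ((isFrame_frame L).scale t)]
  simp only [lam_scale]
  exact forall_congr' fun a => by simp

theorem coords_smul (t : Fin n → ℂˣ) (L : Gr n) : c.coords (t • L) = c.coords L := by
  rw [c.coords_eq ((isFrame_frame L).scale t), c.coord_scale _ fun a => (t a).ne_zero]
  rfl

theorem torus_smul (t : Fin n → ℂˣ) (L : Gr n) (a : Fin n) :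
    c.torus (t • L) a = t a / t c.k * c.torus L a := by
  rw [c.torus_eq ((isFrame_frame L).scale t), c.ratio_scale _ fun a => (t a).ne_zero]
  rfl

/-- The element of the torus that moves the plane of the slice to a given plane. -/
def torusUnits {L : Gr n} (hL : L ∈ c.domain) (a : Fin n) : ℂˣ :=
  Units.mk0 (c.torus L a) (c.torus_ne_zero hL a)

/-- The vectors with entries λ_a and α · minor(i, a) form a basis of the plane. Dividing row a by
λ_a turns them into (1, …, 1) and the second vector of the slice. -/
theorem torusUnits_smul_plane {L : Gr n} (hL : L ∈ c.domain) :
    c.torusUnits hL • c.plane (c.coords L) = L := by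
  set A := frame L with hA
  have hF : IsFrame A L := isFrame_frame L
  set α := c.m * minor A c.j c.k with hα
  set β := (1 - c.m) * minor A c.i c.k with hβ
  -- The change of frame whose product with `A` has these two vectors as columns.
  let g : Matrix (Fin 2) (Fin 2) ℂ :=
    !![-(α * A c.i 1 + β * A c.j 1), -(α * A c.i 1); α * A c.i 0 + β * A c.j 0, α * A c.i 0]
  have hi := hL c.i
  have hj := hL c.j
  rw [lam_i] at hi
  rw [lam_j] at hj
  have hij : minor A c.i c.j ≠ 0 := right_ne_zero_of_mul hi
  have hik : minor A c.i c.k ≠ 0 := right_ne_zero_of_mul (left_ne_zero_of_mul hi)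
  have hα0 : α ≠ 0 := left_ne_zero_of_mul hj
  have hβ0 : β ≠ 0 := mul_ne_zero (sub_ne_zero.2 (Ne.symm c.ne_one)) hik
  have hg : g.det = -(α * β * minor A c.i c.j) := by
    simp only [g, Matrix.det_fin_two_of, minor]; ring
  have hgu : IsUnit g.det := by
    rw [hg]; exact isUnit_iff_ne_zero.2 (neg_ne_zero.2 (mul_ne_zero (mul_ne_zero hα0 hβ0) hij))
  have hvec : ∀ a, c.lam A a * c.vec (c.coords L) a = α * minor A c.i a := by
    refine c.forall_coord ?_ ?_ ?_ fun q => ?_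
    · rw [vec_i, minor_self]; ring
    · rw [vec_j, lam_j, hα]; ring
    · rw [vec_k, lam_k, hα]; ring
    · rw [vec_l, coords, coord, mul_div_cancel₀ _ (hL _)]
  have hmat : A * g = scale (c.lam A) (c.mat (c.coords L)) := by
    ext a b
    rw [Matrix.mul_apply, Fin.sum_univ_two]
    fin_cases b
    · simp only [g, scale, mat, lam, minor, Matrix.of_apply, Matrix.cons_val', Matrix.cons_val_zero,
        Matrix.cons_val_one, Fin.zero_eta, Matrix.cons_val_fin_one]
      simp only [hα, hβ, minor]
      ring
    · have := hvec a
      simp only [g, scale, mat, Matrix.of_apply, Matrix.cons_val', Matrix.cons_val_zero,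
        Matrix.cons_val_one, Fin.mk_one, Matrix.cons_val_fin_one]
      rw [this, minor]
      ring
  have h1 : IsFrame (scale (c.lam A) (c.mat (c.coords L))) L := hmat ▸ hF.mul hgu
  -- `torus` is λ normalised to 1 at the third distinguished coordinate; the common factor does not
  -- change the plane.
  refine ((h1.smul (inv_ne_zero (hL c.k))).unique (M := _) ?_).symm
  convert (c.isFrame_mat (c.coords L)).scale (c.torusUnits hL) using 1
  ext a b
  simp only [scale, Matrix.smul_apply, Matrix.of_apply, smul_eq_mul, torusUnits, Units.val_mk0,
    torus, ratio]
  ring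

section
variable {E' H' X : Type*} [NormedAddCommGroup E'] [NormedSpace ℝ E']
    [TopologicalSpace H'] {J : ModelWithCorners ℝ E' H'} [TopologicalSpace X] [ChartedSpace H' X]
    {A : X → Matrix (Fin n) (Fin 2) ℂ} {x : X}

theorem contMDiffAt_lam (hA : SmoothFrameAt J A x) (a : Fin n) :
    ContMDiffAt J 𝓘(ℝ, ℂ) ∞ (fun y => c.lam (A y) a) x :=
  (contMDiffAt_cmul (contMDiffAt_cmul contMDiffAt_const (hA.minor _ _)) (hA.minor _ _)).add
    (contMDiffAt_cmul (contMDiffAt_cmul contMDiffAt_const (hA.minor _ _)) (hA.minor _ _))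

end

theorem isOpen_domain : IsOpen c.domain := by
  rw [isOpen_iff_eventually]
  intro L hL
  obtain ⟨A, hA, hF⟩ := exists_smoothFrameAt L
  have h1 : ∀ᶠ M in 𝓝 L, ∀ a, c.lam (A M) a ≠ 0 := eventually_all.2 fun a =>
    (c.contMDiffAt_lam hA a).continuousAt.eventually_ne
      ((c.mem_domain_iff hF.self_of_nhds).1 hL a)
  filter_upwards [hF, h1] with M hM hM1
  exact (c.mem_domain_iff hM).2 hM1

theorem contMDiffAt_coords {L : Gr n} (hL : L ∈ c.domain) :
    ContMDiffAt 𝓘(ℝ, GrModel n) 𝓘(ℝ, Fin (n - 3) → ℂ) ∞ c.coords L := by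
  obtain ⟨A, hA, hF⟩ := exists_smoothFrameAt L
  have h0 := (c.mem_domain_iff hF.self_of_nhds).1 hL
  have h1 : ContMDiffAt 𝓘(ℝ, GrModel n) 𝓘(ℝ, Fin (n - 3) → ℂ) ∞ (fun M => c.coord (A M)) L :=
    contMDiffAt_pi_space.2 fun q => contMDiffAt_cdiv
      (contMDiffAt_cmul (contMDiffAt_cmul contMDiffAt_const (hA.minor _ _)) (hA.minor _ _))
      (c.contMDiffAt_lam hA _) (h0 _)
  refine h1.congr_of_eventuallyEq ?_
  filter_upwards [hF] with M hM
  exact c.coords_eq hM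

theorem contMDiffAt_torus {L : Gr n} (hL : L ∈ c.domain) (a : Fin n) :
    ContMDiffAt 𝓘(ℝ, GrModel n) 𝓘(ℝ, ℂ) ∞ (fun M => c.torus M a) L := by
  obtain ⟨A, hA, hF⟩ := exists_smoothFrameAt L
  have h0 := (c.mem_domain_iff hF.self_of_nhds).1 hL
  have h1 : ContMDiffAt 𝓘(ℝ, GrModel n) 𝓘(ℝ, ℂ) ∞ (fun M => c.ratio (A M) a) L :=
    contMDiffAt_cdiv (c.contMDiffAt_lam hA _) (c.contMDiffAt_lam hA _) (h0 _)
  refine h1.congr_of_eventuallyEq ?_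
  filter_upwards [hF] with M hM
  exact congrFun (c.torus_eq hM) a

end Slice

theorem exists_num {i j k : Fin n} (hij : i ≠ j) (hik : i ≠ k) (hjk : j ≠ k) :
    ∃ f : Option (Fin 2 ⊕ Fin (n - 3)) ≃ Fin n,
      f (some (Sum.inl 0)) = i ∧ f (some (Sum.inl 1)) = j ∧ f none = k := by
  classical
  have hn : 3 ≤ n := by
    have h := Finset.card_le_univ ({i, j, k} : Finset (Fin n))
    rw [Finset.card_eq_three.2 ⟨i, j, k, hij, hik, hjk, rfl⟩, Fintype.card_fin] at h
    exact h
  have hcard : Fintype.card (Option (Fin 2 ⊕ Fin (n - 3))) = (Finset.univ : Finset (Fin n)).card := by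
    simp; omega
  let f : Option (Fin 2 ⊕ Fin (n - 3)) → Fin n := fun o => o.elim k (Sum.elim ![i, j] fun _ => i)
  obtain ⟨g, hg⟩ := Finset.exists_equiv_extend_of_card_eq hcard
    (s := {some (Sum.inl 0), some (Sum.inl 1), none}) (f := f) (Finset.subset_univ _) (by
      intro a ha b hb hab
      simp only [Finset.coe_insert, Finset.coe_singleton, Set.mem_insert_iff,
        Set.mem_singleton_iff] at ha hb
      rcases ha with rfl | rfl | rfl <;> rcases hb with rfl | rfl | rfl <;>
        simp_all [f, hij.symm, hik.symm, hjk.symm])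
  let u : (Finset.univ : Finset (Fin n)) ≃ Fin n := Equiv.subtypeUnivEquiv fun a => Finset.mem_univ a
  exact ⟨g.trans u, hg _ (by simp), hg _ (by simp), hg _ (by simp)⟩

/-- The slices meet all orbits of planes with rigid support. -/
theorem IsRigid.exists_slice {L : Gr n} (h : IsRigid (supp L)) : ∃ c : Slice n, L ∈ c.domain := by
  classical
  have hA := isFrame_frame L
  obtain ⟨i, j, k, hij, hik, hjk, hl⟩ := h.exists_rows hA
  set A := frame L with hAdef
  have hne : ∀ {a b : Fin n}, minor A a b ≠ 0 → a ≠ b := by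
    rintro a _ h rfl
    exact h (minor_self A a)
  obtain ⟨f, hfi, hfj, hfk⟩ := exists_num (hne hij) (hne hik) (hne hjk)
  -- λ_a is affine in `m`, so for each row at most one value of `m` sends its point to infinity.
  -- Those finitely many values are excluded, together with 0 and 1.
  let bad : Finset ℂ := {0, 1} ∪ Finset.univ.image fun a : Fin n =>
    minor A i k * minor A j a / (minor A i k * minor A j a - minor A j k * minor A i a)
  obtain ⟨m, hm⟩ := Infinite.exists_notMem_finset bad
  simp only [bad, Finset.mem_union, Finset.mem_insert, Finset.mem_singleton, Finset.mem_image,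
    Finset.mem_univ, true_and, not_or, not_exists] at hm
  refine ⟨⟨f, m, hm.1.1, hm.1.2⟩, fun a ha => ?_⟩
  simp only [Slice.lam, Slice.i, Slice.j, Slice.k, hfi, hfj, hfk, ← hAdef] at ha
  have h1 : minor A i k * minor A j a
      = m * (minor A i k * minor A j a - minor A j k * minor A i a) := by linear_combination ha
  -- If the coefficient of `m` vanishes, then λ_a = 0 would make row `a` dependent on both row `i`
  -- and row `j`, which `hl` forbids.
  by_cases hz : minor A i k * minor A j a - minor A j k * minor A i a = 0
  · rw [hz, mul_zero] at h1
    have h2 : minor A j k * minor A i a = 0 := by rw [h1, zero_sub, neg_eq_zero] at hz; exact hz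
    rcases hl a with h3 | h3
    · exact mul_ne_zero hjk h3 h2
    · exact mul_ne_zero hik h3 h1
  · exact hm.2 a (by rw [div_eq_iff hz]; exact h1)

/-! ### Smooth structures given by families of charts -/

section Charts

variable {E X ι : Type*} [NormedAddCommGroup E] [NormedSpace ℝ E] [TopologicalSpace X]

/-- The charted space whose atlas is a family of charts that cover the space. -/
abbrev chartedSpaceOfFamily (φ : ι → OpenPartialHomeomorph X E) (idx : X → ι)
    (h : ∀ p, p ∈ (φ (idx p)).source) : ChartedSpace E X where
  atlas := Set.range φ
  chartAt p := φ (idx p)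
  mem_chart_source := h
  chart_mem_atlas _ := ⟨_, rfl⟩

theorem isManifold_of_family (φ : ι → OpenPartialHomeomorph X E) (idx : X → ι)
    (h : ∀ p, p ∈ (φ (idx p)).source)
    (hs : ∀ a b, ∀ y ∈ ((φ a).symm.trans (φ b)).source,
      ContDiffAt ℝ ∞ (fun y => φ b ((φ a).symm y)) y) :
    @IsManifold ℝ _ E _ _ E _ 𝓘(ℝ, E) ∞ X _ (chartedSpaceOfFamily φ idx h) := by
  let _ := chartedSpaceOfFamily φ idx h
  apply isManifold_of_contDiffOn
  rintro _ _ ⟨a, rfl⟩ ⟨b, rfl⟩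
  simp only [modelWithCornersSelf_coe, modelWithCornersSelf_coe_symm, Set.preimage_id,
    Set.range_id, Set.inter_univ, Function.id_comp, Function.comp_id]
  exact fun y hy => (hs a b y hy).contDiffWithinAt

variable {M F : Type*} [NormedAddCommGroup F] [NormedSpace ℝ F] [TopologicalSpace M]
  [ChartedSpace F M]

/-- A chart of a subset of a manifold, which is the restriction of a smooth map and whose inverse is
a smooth map to the manifold. -/
structure SubsetChart (E F : Type*) [NormedAddCommGroup E] [NormedSpace ℝ E] {M : Type*}
    [NormedAddCommGroup F] [NormedSpace ℝ F] [TopologicalSpace M] [ChartedSpace F M]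
    (P : M → Prop) where
  fwd : M → E
  bwd : E → M
  source : Set M
  target : Set E
  isOpen_source : IsOpen source
  isOpen_target : IsOpen target
  smooth_fwd : ∀ p ∈ source, P p → ContMDiffAt 𝓘(ℝ, F) 𝓘(ℝ, E) ∞ fwd p
  smooth_bwd : ∀ y ∈ target, ContMDiffAt 𝓘(ℝ, E) 𝓘(ℝ, F) ∞ bwd y
  bwd_prop : ∀ y ∈ target, P (bwd y)
  bwd_mem : ∀ y ∈ target, bwd y ∈ source
  fwd_bwd : ∀ y ∈ target, fwd (bwd y) = y
  fwd_mem : ∀ p ∈ source, P p → fwd p ∈ target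
  bwd_fwd : ∀ p ∈ source, P p → bwd (fwd p) = p

variable {P : M → Prop}

open Classical in
/-- The chart, as an open partial homeomorphism. -/
def SubsetChart.chart (c : SubsetChart E F P) (p₀ : {p // P p}) :
    OpenPartialHomeomorph {p // P p} E where
  toFun p := c.fwd p.1
  -- Outside the target `bwd` may leave the subset, and the value `p₀` is only a filler.
  invFun y := if h : P (c.bwd y) then ⟨c.bwd y, h⟩ else p₀
  source := Subtype.val ⁻¹' c.source
  target := c.target
  map_source' p hp := c.fwd_mem p.1 hp p.2
  map_target' y hy := by
    simp only [dif_pos (c.bwd_prop y hy)]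
    exact c.bwd_mem y hy
  left_inv' p hp := by
    have h : P (c.bwd (c.fwd p.1)) := by rw [c.bwd_fwd p.1 hp p.2]; exact p.2
    simp only [dif_pos h]
    exact Subtype.ext (c.bwd_fwd p.1 hp p.2)
  right_inv' y hy := by
    simp only [dif_pos (c.bwd_prop y hy)]
    exact c.fwd_bwd y hy
  open_source := c.isOpen_source.preimage continuous_subtype_val
  open_target := c.isOpen_target
  continuousOn_toFun p hp := ((c.smooth_fwd p.1 hp p.2).continuousAt.comp
    continuous_subtype_val.continuousAt).continuousWithinAt
  continuousOn_invFun y hy := by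
    refine ContinuousAt.continuousWithinAt ?_
    rw [(Topology.IsInducing.induced (Subtype.val : {p // P p} → M)).continuousAt_iff]
    refine (c.smooth_bwd y hy).continuousAt.congr ?_
    filter_upwards [c.isOpen_target.mem_nhds hy] with z hz
    simp only [Function.comp_apply, dif_pos (c.bwd_prop z hz)]

theorem SubsetChart.coe_chart_symm (c : SubsetChart E F P) (p₀ : {p // P p}) {y : E}
    (hy : y ∈ c.target) : ((c.chart p₀).symm y : M) = c.bwd y := by
  exact congrArg Subtype.val (dif_pos (c.bwd_prop y hy))

/-- A family of charts that cover a subset of a manifold. -/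
structure SubsetAtlas (E F : Type*) [NormedAddCommGroup E] [NormedSpace ℝ E] {M : Type*}
    [NormedAddCommGroup F] [NormedSpace ℝ F] [TopologicalSpace M] [ChartedSpace F M]
    (P : M → Prop) where
  index : Type
  chart : index → SubsetChart E F P
  covers : ∀ p, P p → ∃ a, p ∈ (chart a).source

namespace SubsetAtlas

variable (𝒜 : SubsetAtlas E F P) (p₀ : {p // P p})

/-- The charted space structure on a subset of a manifold. -/
abbrev chartedSpace : ChartedSpace E {p // P p} :=
  chartedSpaceOfFamily (fun a => (𝒜.chart a).chart p₀) (fun p => (𝒜.covers p.1 p.2).choose)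
    (fun p => (𝒜.covers p.1 p.2).choose_spec)

theorem isManifold : @IsManifold ℝ _ E _ _ E _ 𝓘(ℝ, E) ∞ {p // P p} _ (𝒜.chartedSpace p₀) := by
  refine isManifold_of_family _ _ _ fun a b y hy => ?_
  have hy1 : y ∈ (𝒜.chart a).target := hy.1
  have hy2 : ((𝒜.chart a).chart p₀).symm y ∈ ((𝒜.chart b).chart p₀).source := hy.2
  have h1 : (𝒜.chart a).bwd y ∈ (𝒜.chart b).source := by
    rw [← (𝒜.chart a).coe_chart_symm p₀ hy1]; exact hy2
  have h2 := ((𝒜.chart b).smooth_fwd _ h1 ((𝒜.chart a).bwd_prop y hy1)).comp y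
    ((𝒜.chart a).smooth_bwd y hy1)
  refine h2.contDiffAt.congr_of_eventuallyEq ?_
  filter_upwards [(𝒜.chart a).isOpen_target.mem_nhds hy1] with z hz
  rw [Function.comp_apply, ← (𝒜.chart a).coe_chart_symm p₀ hz]
  rfl

theorem contMDiffAt_chart {a : 𝒜.index} {p : {p // P p}} (hp : p.1 ∈ (𝒜.chart a).source) :
    letI := 𝒜.chartedSpace p₀
    ContMDiffAt 𝓘(ℝ, E) 𝓘(ℝ, E) ∞ (fun q : {p // P p} => (𝒜.chart a).fwd q.1) p := by
  let _ := 𝒜.chartedSpace p₀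
  have := 𝒜.isManifold p₀
  exact contMDiffAt_of_mem_maximalAtlas (e := (𝒜.chart a).chart p₀)
    (IsManifold.subset_maximalAtlas ⟨a, rfl⟩) hp

theorem contMDiffAt_chart_symm {a : 𝒜.index} {y : E} (hy : y ∈ (𝒜.chart a).target) :
    letI := 𝒜.chartedSpace p₀
    ContMDiffAt 𝓘(ℝ, E) 𝓘(ℝ, E) ∞ ((𝒜.chart a).chart p₀).symm y := by
  let _ := 𝒜.chartedSpace p₀
  have := 𝒜.isManifold p₀
  exact contMDiffAt_symm_of_mem_maximalAtlas (e := (𝒜.chart a).chart p₀)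
    (IsManifold.subset_maximalAtlas ⟨a, rfl⟩) hy

theorem contMDiff_val :
    letI := 𝒜.chartedSpace p₀
    ContMDiff 𝓘(ℝ, E) 𝓘(ℝ, F) ∞ (Subtype.val : {p // P p} → M) := by
  let _ := 𝒜.chartedSpace p₀
  intro p
  obtain ⟨a, ha⟩ := 𝒜.covers p.1 p.2
  refine (((𝒜.chart a).smooth_bwd _ ((𝒜.chart a).fwd_mem p.1 ha p.2)).comp p
    (𝒜.contMDiffAt_chart p₀ ha)).congr_of_eventuallyEq ?_
  filter_upwards [((𝒜.chart a).chart p₀).open_source.mem_nhds ha] with q hq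
  exact ((𝒜.chart a).bwd_fwd q.1 hq q.2).symm

theorem mfderiv_val_injective (p : {p // P p}) :
    letI := 𝒜.chartedSpace p₀
    Function.Injective (mfderiv 𝓘(ℝ, E) 𝓘(ℝ, F) (Subtype.val : {p // P p} → M) p) := by
  let _ := 𝒜.chartedSpace p₀
  have := 𝒜.isManifold p₀
  obtain ⟨a, ha⟩ := 𝒜.covers p.1 p.2
  have h1 : Function.Injective (mfderiv 𝓘(ℝ, E) 𝓘(ℝ, E)
      (fun q : {p // P p} => (𝒜.chart a).fwd q.1) p) :=
    ((mdifferentiable_of_mem_atlas (I := 𝓘(ℝ, E)) (e := (𝒜.chart a).chart p₀)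
      (show _ ∈ Set.range _ from ⟨a, rfl⟩)).mfderiv_injective ha)
  intro u v huv
  apply h1
  have hf := ((𝒜.chart a).smooth_fwd p.1 ha p.2).mdifferentiableAt (by simp)
  have hv := (𝒜.contMDiff_val p₀ p).mdifferentiableAt (by simp)
  refine (mfderiv_comp_apply p hf hv u).trans (Eq.trans ?_ (mfderiv_comp_apply p hf hv v).symm)
  exact congrArg _ huv

/-- A map to the subset is smooth if it is smooth as a map to the manifold. -/
theorem contMDiffAt_of_val {E' H' Y : Type*} [NormedAddCommGroup E'] [NormedSpace ℝ E']
    [TopologicalSpace H'] {J : ModelWithCorners ℝ E' H'} [TopologicalSpace Y] [ChartedSpace H' Y]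
    {G : Y → {p // P p}} {y : Y} (hG : ContMDiffAt J 𝓘(ℝ, F) ∞ (fun y => (G y : M)) y) :
    letI := 𝒜.chartedSpace p₀
    ContMDiffAt J 𝓘(ℝ, E) ∞ G y := by
  let _ := 𝒜.chartedSpace p₀
  obtain ⟨a, ha⟩ := 𝒜.covers (G y).1 (G y).2
  have hc : ContinuousAt G y := by
    rw [(Topology.IsInducing.induced (Subtype.val : {p // P p} → M)).continuousAt_iff]
    exact hG.continuousAt
  have h1 := (((𝒜.chart a).smooth_fwd _ ha (G y).2).comp y hG)
  refine ((𝒜.contMDiffAt_chart_symm p₀ ((𝒜.chart a).fwd_mem _ ha (G y).2)).comp y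
    h1).congr_of_eventuallyEq ?_
  filter_upwards [hc.eventually (((𝒜.chart a).chart p₀).open_source.mem_nhds ha)] with z hz
  exact (((𝒜.chart a).chart p₀).left_inv hz).symm

end SubsetAtlas

end Charts

/-! ### The smooth structure of the space of parameters -/

section Parameter

variable {S : Set (Set (Pair n))}

theorem parameterMk_eq_iff {L M : strataUnion S} :
    parameterMk S L = parameterMk S M ↔ ∃ t : Fin n → ℂˣ, t • M.1 = L.1 :=
  Quotient.eq.trans Iff.rfl

theorem smul_mem_strataUnion_iff (t : Fin n → ℂˣ) (L : Gr n) :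
    t • L ∈ strataUnion S ↔ L ∈ strataUnion S := by
  simp only [mem_strataUnion_iff, supp_smul]

/-- The torus acts by homeomorphisms, so the union of the orbits that meet an open set is open. -/
theorem isOpenQuotientMap_parameterMk : IsOpenQuotientMap (parameterMk S) := by
  refine ⟨Quotient.mk_surjective, continuous_quotient_mk', fun V hV => ?_⟩
  change IsOpen (parameterMk S ⁻¹' (parameterMk S '' V))
  rw [isOpen_iff_mem_nhds]
  rintro L ⟨M, hM, hML⟩
  obtain ⟨t, ht⟩ := parameterMk_eq_iff.1 hML
  let f : strataUnion S → strataUnion S := fun L =>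
    ⟨t • L.1, (smul_mem_strataUnion_iff t L.1).2 L.2⟩
  have hf : Continuous f := ((contMDiff_smul t).continuous.comp continuous_subtype_val).subtype_mk _
  have h1 : f L = M := Subtype.ext ht
  filter_upwards [hf.continuousAt.preimage_mem_nhds (hV.mem_nhds (h1 ▸ hM : f L ∈ V))] with N hN
  exact ⟨f N, hN, parameterMk_eq_iff.2 ⟨t, rfl⟩⟩

open Classical in
/-- The chart of the space of parameters given by a slice. -/
def paramChart (hU : IsOpen (strataUnion S)) (q₀ : ParameterSpace S) (c : Slice n) :
    OpenPartialHomeomorph (ParameterSpace S) (Fin (n - 3) → ℂ) where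
  toFun := Quotient.lift (fun L : strataUnion S => c.coords L.1) (by
    rintro L M ⟨t, ht⟩
    rw [← show t • M.1 = L.1 from ht, c.coords_smul])
  invFun v := if h : c.plane v ∈ strataUnion S then parameterMk S ⟨c.plane v, h⟩ else q₀
  source := parameterMk S '' (Subtype.val ⁻¹' c.domain)
  target := {v | c.plane v ∈ strataUnion S}
  map_source' := by
    rintro _ ⟨L, hL, rfl⟩
    have h := c.torusUnits_smul_plane hL
    exact (smul_mem_strataUnion_iff (c.torusUnits hL) _).1 (h.symm ▸ L.2)
  map_target' v hv := by
    have hv' : c.plane v ∈ strataUnion S := hv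
    rw [dif_pos hv']
    exact ⟨⟨c.plane v, hv⟩, c.plane_mem_domain v, rfl⟩
  left_inv' := by
    rintro _ ⟨L, hL, rfl⟩
    have h := c.torusUnits_smul_plane hL
    have h' : c.plane (c.coords L.1) ∈ strataUnion S :=
      (smul_mem_strataUnion_iff (c.torusUnits hL) _).1 (h.symm ▸ L.2)
    exact (dif_pos h').trans (parameterMk_eq_iff.2 ⟨(c.torusUnits hL)⁻¹, inv_smul_eq_iff.2 h.symm⟩)
  right_inv' v hv := by
    have hv' : c.plane v ∈ strataUnion S := hv
    exact (congrArg _ (dif_pos hv')).trans (c.coords_plane v)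
  open_source := isOpenQuotientMap_parameterMk.isOpenMap _
    (c.isOpen_domain.preimage continuous_subtype_val)
  open_target := hU.preimage c.contMDiff_plane.continuous
  continuousOn_toFun := by
    rintro _ ⟨L, hL, rfl⟩
    refine ContinuousAt.continuousWithinAt ?_
    rw [← isOpenQuotientMap_parameterMk.continuousAt_comp_iff]
    exact (c.contMDiffAt_coords hL).continuousAt.comp continuous_subtype_val.continuousAt
  continuousOn_invFun := by
    rw [continuousOn_iff_continuous_domRestrict]
    have h : Continuous fun v : {v | c.plane v ∈ strataUnion S} =>
        parameterMk S ⟨c.plane v.1, v.2⟩ := isOpenQuotientMap_parameterMk.continuous.comp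
      ((c.contMDiff_plane.continuous.comp continuous_subtype_val).subtype_mk _)
    refine h.congr fun v => ?_
    have hv : c.plane v.1 ∈ strataUnion S := v.2
    exact (dif_pos (t := fun h => parameterMk S ⟨c.plane v.1, h⟩) (e := fun _ => q₀) hv).symm

theorem paramChart_symm (hU : IsOpen (strataUnion S)) (q₀ : ParameterSpace S) (c : Slice n)
    {v : Fin (n - 3) → ℂ} (hv : c.plane v ∈ strataUnion S) :
    (paramChart hU q₀ c).symm v = parameterMk S ⟨c.plane v, hv⟩ := dif_pos hv

theorem mem_paramChart_source (hU : IsOpen (strataUnion S)) (q₀ : ParameterSpace S) (c : Slice n)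
    {L : strataUnion S} : parameterMk S L ∈ (paramChart hU q₀ c).source ↔ L.1 ∈ c.domain := by
  refine ⟨?_, fun h => ⟨L, h, rfl⟩⟩
  rintro ⟨M, hM, hML⟩
  obtain ⟨t, ht⟩ := parameterMk_eq_iff.1 hML
  rw [← c.smul_mem_domain_iff t, ht]
  exact hM

/-- The transition maps are `c'.coords ∘ c.plane`. No point of the chamber enters, so the smooth
structure is the same for all of them. -/
theorem contDiffAt_paramChart_transition (hU : IsOpen (strataUnion S)) (q₀ : ParameterSpace S)
    (c c' : Slice n) (v : Fin (n - 3) → ℂ)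
    (hv : v ∈ ((paramChart hU q₀ c).symm.trans (paramChart hU q₀ c')).source) :
    ContDiffAt ℝ ∞ (fun w => paramChart hU q₀ c' ((paramChart hU q₀ c).symm w)) v := by
  have h1 : c.plane v ∈ strataUnion S := hv.1
  have h2 : (paramChart hU q₀ c).symm v ∈ (paramChart hU q₀ c').source := hv.2
  rw [paramChart_symm hU q₀ c h1, mem_paramChart_source] at h2
  have h3 := ((c'.contMDiffAt_coords h2).comp v (c.contMDiff_plane v)).contDiffAt
  refine h3.congr_of_eventuallyEq ?_
  filter_upwards [(paramChart hU q₀ c).open_target.mem_nhds h1] with w hw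
  rw [paramChart_symm hU q₀ c hw]
  rfl

theorem exists_mem_paramChart_source (hU : IsOpen (strataUnion S)) (q₀ : ParameterSpace S)
    (hr : ∀ L ∈ strataUnion S, IsRigid (supp L)) (q : ParameterSpace S) :
    ∃ c : Slice n, q ∈ (paramChart hU q₀ c).source := by
  obtain ⟨L, rfl⟩ := Quotient.mk_surjective q
  obtain ⟨c, hc⟩ := (hr L.1 L.2).exists_slice
  exact ⟨c, L, hc, rfl⟩

end Parameter

/-! ### Level sets and their orbit spaces -/

section Level

variable {x : Fin n → ℝ}

theorem reducedMk_eq_iff {p q : LevelSet (momentMap (n := n)) x} :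
    reducedMk momentMap x p = reducedMk momentMap x q ↔ ∃ t : Fin n → Circle, t • q.1 = p.1 :=
  Quotient.eq.trans Iff.rfl

theorem exists_torusExp_eq (t : Fin n → Circle) :
    ∃ v ∈ Set.Icc (fun _ : Fin n => -Real.pi) (fun _ => Real.pi), torusExp v = t :=
  ⟨fun i => Complex.arg (t i), ⟨fun _ => (Complex.neg_pi_lt_arg _).le, fun _ => Complex.arg_le_pi _⟩,
    funext fun i => Circle.exp_arg (t i)⟩

/-- The relation is the continuous image of a compact set: a cube of angles times the Grassmann
manifold. -/
theorem isClosed_orbit_relation :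
    IsClosed {q : Gr n × Gr n | ∃ t : Fin n → Circle, t • q.2 = q.1} := by
  have h1 : IsCompact ((fun q : (Fin n → ℝ) × Gr n => (torusExp q.1 • q.2, q.2)) ''
      (Set.Icc (fun _ : Fin n => -Real.pi) (fun _ => Real.pi) ×ˢ Set.univ)) :=
    (isCompact_Icc.prod isCompact_univ).image
      (contMDiff_torusExp_smul.continuous.prodMk continuous_snd)
  convert h1.isClosed using 1
  ext ⟨p, q⟩
  simp only [Set.mem_ofPred_eq, Set.mem_image, Set.mem_prod, Set.mem_univ, and_true, Prod.mk.injEq,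
    Prod.exists]
  constructor
  · rintro ⟨t, ht⟩
    obtain ⟨v, hv, rfl⟩ := exists_torusExp_eq t
    exact ⟨v, q, hv, ht, rfl⟩
  · rintro ⟨v, _, _, h, rfl⟩
    exact ⟨_, h⟩

instance : CompactSpace (LevelSet (momentMap (n := n)) x) :=
  isCompact_iff_compactSpace.1 ((isClosed_singleton (x := x)).preimage
    contMDiff_momentMap.continuous).isCompact

/-- The union of the strata is the set of planes which are stable for `x`, and it contains the level
set at `x`. -/
structure IsStableLocus (S : Set (Set (Pair n))) (x : Fin n → ℝ) : Prop where
  eq_stable : strataUnion S = stable x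
  mem_of_momentMap_eq : ∀ L, momentMap L = x → L ∈ strataUnion S

variable {S : Set (Set (Pair n))}

theorem IsStableLocus.mem_stable (h : IsStableLocus S x) {L : Gr n} (hL : L ∈ strataUnion S) :
    L ∈ stable x := h.eq_stable ▸ hL

theorem IsStableLocus.isOpen (h : IsStableLocus S x) : IsOpen (strataUnion S) :=
  h.eq_stable ▸ isOpen_stable x

theorem IsStableLocus.isRigid (h : IsStableLocus S x) {L : Gr n} (hL : L ∈ strataUnion S) :
    IsRigid (supp L) := IsInner.isRigid (h.mem_stable hL)

/-- The inclusion of the level set in the union of the strata. -/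
def IsStableLocus.incl (h : IsStableLocus S x) (p : LevelSet (momentMap (n := n)) x) :
    strataUnion S := ⟨p.1, h.mem_of_momentMap_eq p.1 p.2⟩

/-- The retraction of the union of the strata to the level set. -/
def IsStableLocus.toLevelSet (h : IsStableLocus S x) (L : strataUnion S) :
    LevelSet (momentMap (n := n)) x := ⟨retract x L.1, momentMap_retract (h.mem_stable L.2)⟩

theorem IsStableLocus.continuous_toLevelSet (h : IsStableLocus S x) : Continuous h.toLevelSet := by
  refine Continuous.subtype_mk (continuous_iff_continuousAt.2 fun L => ?_) _
  exact (contMDiffAt_retract (h.mem_stable L.2)).continuousAt.comp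
    continuous_subtype_val.continuousAt

/-- The homeomorphism of the orbit space of the level set and the space of parameters. -/
def IsStableLocus.homeo (h : IsStableLocus S x) :
    ReducedSpace (momentMap (n := n)) x ≃ₜ ParameterSpace S where
  toFun := Quotient.lift (fun p => parameterMk S (h.incl p)) (by
    rintro p q ⟨t, ht⟩
    exact parameterMk_eq_iff.2 ⟨fun i => Circle.toUnits (t i), ht⟩)
  -- The retraction descends to orbits by its equivariance. It is the identity on the level set, and
  -- it moves each plane within its complex orbit, so the two maps are inverse to each other.
  invFun := Quotient.lift (fun L => reducedMk momentMap x (h.toLevelSet L)) (by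
    rintro L M ⟨t, ht⟩
    refine reducedMk_eq_iff.2 ⟨phase t, ?_⟩
    change phase t • retract x M.1 = retract x L.1
    rw [← retract_smul (h.mem_stable M.2), ← show t • M.1 = L.1 from ht])
  left_inv q := by
    obtain ⟨p, rfl⟩ := Quotient.mk_surjective q
    exact congrArg (reducedMk momentMap x)
      (Subtype.ext (retract_eq_self (h.mem_stable (h.incl p).2) p.2))
  right_inv q := by
    obtain ⟨L, rfl⟩ := Quotient.mk_surjective q
    exact parameterMk_eq_iff.2 ⟨expUnits (logScale x L.1), rfl⟩
  continuous_toFun := continuous_quot_lift _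
    (isOpenQuotientMap_parameterMk.continuous.comp (continuous_subtype_val.subtype_mk _))
  continuous_invFun := continuous_quot_lift _
    (continuous_quotient_mk'.comp h.continuous_toLevelSet)

theorem IsStableLocus.homeo_symm_parameterMk (h : IsStableLocus S x) (L : strataUnion S) :
    h.homeo.symm (parameterMk S L) = reducedMk momentMap x (h.toLevelSet L) := rfl

/-- Two planes have the same class exactly when their retractions lie in one orbit of the compact
torus, which is a closed condition. The noncompact torus is thereby avoided. -/
theorem IsStableLocus.t2Space (h : IsStableLocus S x) : T2Space (ParameterSpace S) := by
  rw [t2Space_iff_of_isOpenQuotientMap isOpenQuotientMap_parameterMk]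
  have hc : Continuous fun q : strataUnion S × strataUnion S =>
      ((h.toLevelSet q.1).1, (h.toLevelSet q.2).1) :=
    (continuous_subtype_val.comp (h.continuous_toLevelSet.comp continuous_fst)).prodMk
      (continuous_subtype_val.comp (h.continuous_toLevelSet.comp continuous_snd))
  convert (isClosed_orbit_relation (n := n)).preimage hc using 1
  ext ⟨L, M⟩
  have key : parameterMk S L = parameterMk S M ↔ reducedMk momentMap x (h.toLevelSet L)
      = reducedMk momentMap x (h.toLevelSet M) := by
    rw [← h.homeo_symm_parameterMk, ← h.homeo_symm_parameterMk, h.homeo.symm.injective.eq_iff]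
  exact key.trans reducedMk_eq_iff

theorem IsStableLocus.compactSpace (h : IsStableLocus S x) : CompactSpace (ParameterSpace S) :=
  h.homeo.compactSpace

end Level

/-! ### The charts of a level set -/

theorem momentMap_circle_smul (t : Fin n → Circle) (L : Gr n) :
    momentMap (t • L) = momentMap L := by
  rw [momentMap_eq ((isFrame_frame L).scale_circle t), momentMap]
  simp only [plucker_scale, norm_mul, Circle.norm_coe, one_mul]

theorem exp_arg_mul {w z : ℂ} (hw : w ≠ 0) (hz : z ≠ 0) :
    Circle.exp (Complex.arg (w * z)) = Circle.exp (Complex.arg w) * Circle.exp (Complex.arg z) := by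
  ext
  have h0 : (‖w * z‖ : ℂ) ≠ 0 := by simpa using ⟨hw, hz⟩
  rw [Circle.coe_mul, Circle.coe_exp, Circle.coe_exp, Circle.coe_exp]
  apply mul_left_cancel₀ h0
  rw [Complex.norm_mul_exp_arg_mul_I, norm_mul, Complex.ofReal_mul, mul_mul_mul_comm,
    Complex.norm_mul_exp_arg_mul_I, Complex.norm_mul_exp_arg_mul_I]

theorem exp_arg_circle_mul (w : Circle) {z : ℂ} (hz : z ≠ 0) :
    Circle.exp (Complex.arg (w * z)) = w * Circle.exp (Complex.arg z) := by
  rw [exp_arg_mul (Circle.coe_ne_zero w) hz, Circle.exp_arg]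

theorem arg_pos_mul_exp {r θ : ℝ} (hr : 0 < r) (h1 : -Real.pi < θ) (h2 : θ ≤ Real.pi) :
    Complex.arg (r * Circle.exp θ) = θ := by
  rw [Complex.arg_real_mul _ hr, Circle.arg_exp h1 h2]

theorem contDiffAt_arg {z : ℂ} (hz : z ∈ Complex.slitPlane) : ContDiffAt ℝ ∞ Complex.arg z := by
  have h : ContDiffAt ℝ ∞ Complex.log z := (Complex.contDiffAt_log hz).restrict_scalars ℝ
  exact (Complex.imCLM.contDiff.contDiffAt.comp z h).congr_of_eventuallyEq
    (Eventually.of_forall fun w => (Complex.log_im w).symm)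

/-- The coordinates of a plane in a level set: the slice coordinates and the angles. -/
abbrev LevelModel (n : ℕ) : Type := (Fin (n - 3) → ℂ) × (Fin 2 ⊕ Fin (n - 3) → ℝ)

/-- 2(n - 3) for the slice coordinates and n - 1 for the angles modulo the diagonal. -/
theorem finrank_levelModel (hn : 3 ≤ n) : Module.finrank ℝ (LevelModel n) = 3 * n - 7 := by
  simp only [LevelModel, Module.finrank_prod, Module.finrank_pi_fintype, Complex.finrank_real_complex,
    Finset.sum_const, Finset.card_univ, Fintype.card_fin, smul_eq_mul, Module.finrank_self,
    Fintype.card_sum]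
  omega

/-- The model space of a level set. -/
def levelModelEquiv (hn : 3 ≤ n) : LevelModel n ≃L[ℝ] EuclideanSpace ℝ (Fin (3 * n - 7)) :=
  ContinuousLinearEquiv.ofFinrankEq (by rw [finrank_levelModel hn]; simp)

namespace Slice

variable (c : Slice n)

/-- The element of the Lie algebra of the torus with given angles and angle `0` at the third
distinguished coordinate. -/
def angle (θ : Fin 2 ⊕ Fin (n - 3) → ℝ) (a : Fin n) : ℝ := (c.num.symm a).elim 0 θ

theorem angle_k (θ : Fin 2 ⊕ Fin (n - 3) → ℝ) : c.angle θ c.k = 0 := by simp [angle, k]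

theorem angle_num (θ : Fin 2 ⊕ Fin (n - 3) → ℝ) (s : Fin 2 ⊕ Fin (n - 3)) :
    c.angle θ (c.num (some s)) = θ s := by simp [angle]

theorem forall_num {p : Fin n → Prop} (hk : p c.k) (hl : ∀ s, p (c.num (some s))) (a : Fin n) :
    p a := by
  obtain ⟨b, rfl⟩ := c.num.surjective a
  rcases b with _ | b
  · exact hk
  · exact hl b

theorem contDiff_angle : ContDiff ℝ ∞ c.angle := by
  refine contDiff_pi.2 fun a => ?_
  refine c.forall_num (p := fun a => ContDiff ℝ ∞ fun θ => c.angle θ a) ?_ (fun s => ?_) a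
  · simp only [angle_k]; exact contDiff_const
  · simp only [angle_num]; exact contDiff_apply ℝ ℝ s

/-- The plane with given slice coordinates and angles in the level set at `x`. -/
def levelPlane (x : Fin n → ℝ) (b : Fin n → Circle) (y : LevelModel n) : Gr n :=
  torusExp (c.angle y.2) • b • retract x (c.plane y.1)

/-- The torus coordinates, rotated by `b`. -/
def rotatedTorus (b : Fin n → Circle) (L : Gr n) (a : Fin n) : ℂ :=
  ((b c.k * (b a)⁻¹ : Circle) : ℂ) * c.torus L a

/-- The slice coordinates and angles of a plane. -/
def levelCoords (b : Fin n → Circle) (L : Gr n) : LevelModel n :=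
  (c.coords L, fun s => Complex.arg (c.rotatedTorus b L (c.num (some s))))

theorem contMDiffAt_levelPlane {x : Fin n → ℝ} (b : Fin n → Circle) {y : LevelModel n}
    (hy : c.plane y.1 ∈ stable x) :
    ContMDiffAt 𝓘(ℝ, LevelModel n) 𝓘(ℝ, GrModel n) ∞ (c.levelPlane x b) y := by
  have h1 : ContMDiffAt 𝓘(ℝ, LevelModel n) 𝓘(ℝ, GrModel n) ∞
      (fun y : LevelModel n => b • retract x (c.plane y.1)) y :=
    (contMDiff_circle_smul b _).comp y ((contMDiffAt_retract hy).comp y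
      ((c.contMDiff_plane y.1).comp y contDiff_fst.contMDiff.contMDiffAt))
  have h2 : ContMDiffAt 𝓘(ℝ, LevelModel n) 𝓘(ℝ, Fin n → ℝ) ∞
      (fun y : LevelModel n => c.angle y.2) y :=
    (c.contDiff_angle.comp contDiff_snd).contMDiff.contMDiffAt
  exact (contMDiff_torusExp_smul.contMDiffAt
    (x := (c.angle y.2, b • retract x (c.plane y.1)))).comp y (h2.prodMk h1)

theorem contMDiffAt_rotatedTorus (b : Fin n → Circle) {L : Gr n} (hL : L ∈ c.domain) (a : Fin n) :
    ContMDiffAt 𝓘(ℝ, GrModel n) 𝓘(ℝ, ℂ) ∞ (fun M => c.rotatedTorus b M a) L :=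
  contMDiffAt_cmul contMDiffAt_const (c.contMDiffAt_torus hL a)

theorem contMDiffAt_levelCoords (b : Fin n → Circle) {L : Gr n} (hL : L ∈ c.domain)
    (h : ∀ a, c.rotatedTorus b L a ∈ Complex.slitPlane) :
    ContMDiffAt 𝓘(ℝ, GrModel n) 𝓘(ℝ, LevelModel n) ∞ (c.levelCoords b) L := by
  refine (c.contMDiffAt_coords hL).prodMk_space (contMDiffAt_pi_space.2 fun s => ?_)
  exact (contDiffAt_arg (h _)).contMDiffAt.comp L (c.contMDiffAt_rotatedTorus b hL _)

theorem levelPlane_eq (x : Fin n → ℝ) (b : Fin n → Circle) (y : LevelModel n) :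
    c.levelPlane x b y = ((fun a => Circle.toUnits (torusExp (c.angle y.2) a))
      * ((fun a => Circle.toUnits (b a)) * expUnits (logScale x (c.plane y.1)))) • c.plane y.1 := by
  rw [mul_smul, mul_smul]
  rfl

/-- The retraction contributes only positive factors, so the arguments of the torus coordinates are
the prescribed angles. -/
theorem rotatedTorus_levelPlane (x : Fin n → ℝ) (b : Fin n → Circle) (y : LevelModel n)
    (a : Fin n) : ∃ r : ℝ, 0 < r ∧
      c.rotatedTorus b (c.levelPlane x b y) a = r * Circle.exp (c.angle y.2 a) := by
  set s := logScale x (c.plane y.1) with hs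
  refine ⟨Real.exp (s a) / Real.exp (s c.k), by positivity, ?_⟩
  rw [rotatedTorus, levelPlane_eq, torus_smul, torus_plane, mul_one, ← hs]
  simp only [Pi.mul_apply, Units.val_mul, torusExp, expUnits, Units.val_mk0, Circle.toUnits_apply,
    angle_k, Circle.coe_mul, Circle.coe_inv, Complex.ofReal_div, Circle.exp_zero, Circle.coe_one]
  have h1 : (b a : ℂ) ≠ 0 := Circle.coe_ne_zero _
  have h2 : (b c.k : ℂ) ≠ 0 := Circle.coe_ne_zero _
  have h3 : (Real.exp (s c.k) : ℂ) ≠ 0 := by exact_mod_cast (Real.exp_pos _).ne'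
  field_simp

theorem coords_levelPlane (x : Fin n → ℝ) (b : Fin n → Circle) (y : LevelModel n) :
    c.coords (c.levelPlane x b y) = y.1 := by
  rw [levelPlane_eq, coords_smul, coords_plane]

theorem levelPlane_mem_domain (x : Fin n → ℝ) (b : Fin n → Circle) (y : LevelModel n) :
    c.levelPlane x b y ∈ c.domain := by
  rw [levelPlane_eq, smul_mem_domain_iff]
  exact c.plane_mem_domain _

/-- The plane of the slice in the orbit of a plane, moved to the level set at `x`. -/
def rep (x : Fin n → ℝ) (L : Gr n) : Gr n := retract x (c.plane (c.coords L))

theorem plane_coords_mem_stable {x : Fin n → ℝ} {L : Gr n} (hL : L ∈ c.domain)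
    (hs : L ∈ stable x) : c.plane (c.coords L) ∈ stable x :=
  (smul_mem_stable_iff (c.torusUnits hL) _).1 ((c.torusUnits_smul_plane hL).symm ▸ hs)

/-- L is the translate of its slice plane by a torus element. The retraction fixes L and acts on
that translation through phases only. -/
theorem phase_smul_rep {x : Fin n → ℝ} {L : Gr n} (hL : L ∈ c.domain) (hs : L ∈ stable x)
    (hx : momentMap L = x) : phase (c.torusUnits hL) • c.rep x L = L := by
  rw [rep, ← retract_smul (c.plane_coords_mem_stable hL hs), c.torusUnits_smul_plane hL,
    retract_eq_self hs hx]

theorem levelPlane_levelCoords {x : Fin n → ℝ} (b : Fin n → Circle) {L : Gr n}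
    (hL : L ∈ c.domain) (hs : L ∈ stable x) (hx : momentMap L = x) :
    c.levelPlane x b (c.levelCoords b L) = L := by
  set t := c.torusUnits hL with ht
  have h2 : phase t • retract x (c.plane (c.coords L)) = L := c.phase_smul_rep hL hs hx
  -- The angles reproduce the phases of L up to the constant `b c.k`, which acts trivially.
  have h3 : ∀ a, torusExp (c.angle (c.levelCoords b L).2) a * b a = b c.k * phase t a := by
    refine c.forall_num ?_ fun s => ?_
    · simp [torusExp, angle_k, phase, ht, torusUnits, c.torus_k hL]
    · simp only [torusExp, angle_num, levelCoords, rotatedTorus, phase, ht, torusUnits,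
        Units.val_mk0]
      rw [exp_arg_circle_mul _ (c.torus_ne_zero hL _), mul_right_comm, inv_mul_cancel_right]
  have h4 : (torusExp (c.angle (c.levelCoords b L).2) * b : Fin n → Circle)
      = (fun _ => b c.k) * phase t := funext h3
  rw [levelPlane, smul_smul, h4, mul_smul, show (c.levelCoords b L).1 = c.coords L from rfl, h2]
  exact smul_eq_of_const (t := fun _ => Circle.toUnits (b c.k)) (fun _ _ => rfl) L

/-- The chart of a level set given by a slice and an element of the torus. -/
def levelChart {x : Fin n → ℝ} (hx : ∀ L, momentMap L = x → L ∈ stable x) (b : Fin n → Circle) :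
    SubsetChart (LevelModel n) (GrModel n) fun L => momentMap L = x where
  fwd := c.levelCoords b
  bwd := c.levelPlane x b
  source := {L | L ∈ c.domain ∧ ∀ a, c.rotatedTorus b L a ∈ Complex.slitPlane}
  target := {y | c.plane y.1 ∈ stable x ∧ ∀ s, -Real.pi < y.2 s ∧ y.2 s < Real.pi}
  isOpen_source := by
    rw [isOpen_iff_eventually]
    rintro L ⟨hL, h⟩
    refine Filter.Eventually.and (c.isOpen_domain.mem_nhds hL) (eventually_all.2 fun a => ?_)
    exact (c.contMDiffAt_rotatedTorus b hL a).continuousAt.eventually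
      (Complex.isOpen_slitPlane.mem_nhds (h a))
  isOpen_target := by
    have h1 : IsOpen {y : LevelModel n | c.plane y.1 ∈ stable x} :=
      (isOpen_stable x).preimage (c.contMDiff_plane.continuous.comp continuous_fst)
    have h2 : IsOpen {y : LevelModel n | ∀ s, -Real.pi < y.2 s ∧ y.2 s < Real.pi} := by
      simp only [Set.ofPred_forall]
      refine isOpen_iInter_of_finite fun s => ?_
      have hc : Continuous fun y : LevelModel n => y.2 s := (continuous_apply s).comp continuous_snd
      exact (isOpen_lt continuous_const hc).inter (isOpen_lt hc continuous_const)
    exact h1.inter h2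
  smooth_fwd := fun L hL _ => c.contMDiffAt_levelCoords b hL.1 hL.2
  smooth_bwd := fun y hy => c.contMDiffAt_levelPlane b hy.1
  bwd_prop := fun y hy => by
    rw [levelPlane, momentMap_circle_smul, momentMap_circle_smul]
    exact momentMap_retract hy.1
  bwd_mem := fun y hy => by
    refine ⟨c.levelPlane_mem_domain x b y, c.forall_num ?_ fun s => ?_⟩
    · obtain ⟨r, hr, h⟩ := c.rotatedTorus_levelPlane x b y c.k
      rw [h, angle_k, Circle.exp_zero, Circle.coe_one, mul_one]
      exact Complex.ofReal_mem_slitPlane.2 hr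
    · obtain ⟨r, hr, h⟩ := c.rotatedTorus_levelPlane x b y (c.num (some s))
      rw [h, angle_num, Complex.mem_slitPlane_iff_arg,
        arg_pos_mul_exp hr (hy.2 s).1 (hy.2 s).2.le]
      exact ⟨(hy.2 s).2.ne, mul_ne_zero (by exact_mod_cast hr.ne') (Circle.coe_ne_zero _)⟩
  fwd_bwd := fun y hy => by
    refine Prod.ext (c.coords_levelPlane x b y) (funext fun s => ?_)
    obtain ⟨r, hr, h⟩ := c.rotatedTorus_levelPlane x b y (c.num (some s))
    simp only [levelCoords]
    rw [h, angle_num, arg_pos_mul_exp hr (hy.2 s).1 (hy.2 s).2.le]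
  fwd_mem := fun L hL hLx => by
    refine ⟨(smul_mem_stable_iff (c.torusUnits hL.1) _).1 ?_, fun s => ?_⟩
    · change c.torusUnits hL.1 • c.plane (c.coords L) ∈ _
      rw [c.torusUnits_smul_plane hL.1]
      exact hx L hLx
    · exact ⟨Complex.neg_pi_lt_arg _, lt_of_le_of_ne (Complex.arg_le_pi _)
        (Complex.mem_slitPlane_iff_arg.1 (hL.2 _)).1⟩
  bwd_fwd := fun L hL hLx => c.levelPlane_levelCoords b hL.1 (hx L hLx) hLx

/-- The rotation `b` moves the branch cut of the argument away from the given plane: with the phases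
of its own torus coordinates, the rotated coordinates become positive reals. -/
theorem exists_rotatedTorus_mem_slitPlane {L : Gr n} (hL : L ∈ c.domain) :
    ∃ b : Fin n → Circle, ∀ a, c.rotatedTorus b L a ∈ Complex.slitPlane := by
  refine ⟨fun a => Circle.exp (Complex.arg (c.torus L a)), fun a => ?_⟩
  have h0 : 0 < ‖c.torus L a‖ := norm_pos_iff.2 (c.torus_ne_zero hL a)
  have h : c.rotatedTorus (fun a => Circle.exp (Complex.arg (c.torus L a))) L a
      = (‖c.torus L a‖ : ℂ) := by
    rw [rotatedTorus, c.torus_k hL, Complex.arg_one, Circle.exp_zero, one_mul]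
    conv_lhs => rw [← Complex.norm_mul_exp_arg_mul_I (c.torus L a)]
    rw [mul_left_comm, ← Circle.coe_exp, ← Circle.coe_mul]
    simp [Complex.norm_mul_exp_arg_mul_I]
  rw [h]
  exact Complex.ofReal_mem_slitPlane.2 h0

end Slice

/-- The composition of a chart with a linear isomorphism. -/
def SubsetChart.trans {E E' F M : Type*} [NormedAddCommGroup E] [NormedSpace ℝ E]
    [NormedAddCommGroup E'] [NormedSpace ℝ E'] [NormedAddCommGroup F] [NormedSpace ℝ F]
    [TopologicalSpace M] [ChartedSpace F M] {P : M → Prop} (c : SubsetChart E F P)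
    (κ : E ≃L[ℝ] E') : SubsetChart E' F P where
  fwd p := κ (c.fwd p)
  bwd y := c.bwd (κ.symm y)
  source := c.source
  target := κ.symm ⁻¹' c.target
  isOpen_source := c.isOpen_source
  isOpen_target := c.isOpen_target.preimage κ.symm.continuous
  smooth_fwd p hp h := κ.contDiff.contMDiff.contMDiffAt.comp p (c.smooth_fwd p hp h)
  smooth_bwd y hy := (c.smooth_bwd _ hy).comp y κ.symm.contDiff.contMDiff.contMDiffAt
  bwd_prop y hy := c.bwd_prop _ hy
  bwd_mem y hy := c.bwd_mem _ hy
  fwd_bwd y hy := by rw [c.fwd_bwd _ hy, κ.apply_symm_apply]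
  fwd_mem p hp h := by
    rw [Set.mem_preimage, κ.symm_apply_apply]
    exact c.fwd_mem p hp h
  bwd_fwd p hp h := by rw [κ.symm_apply_apply, c.bwd_fwd p hp h]

/-- The charts of a level set. -/
def levelAtlas {x : Fin n → ℝ} (hn : 3 ≤ n) (hx : ∀ L, momentMap L = x → L ∈ stable x) :
    SubsetAtlas (EuclideanSpace ℝ (Fin (3 * n - 7))) (GrModel n)
      fun L : Gr n => momentMap L = x where
  index := Slice n × (Fin n → Circle)
  chart a := (a.1.levelChart hx a.2).trans (levelModelEquiv hn)
  covers L hL := by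
    obtain ⟨c, hc⟩ := (IsInner.isRigid (hx L hL)).exists_slice
    obtain ⟨b, hb⟩ := c.exists_rotatedTorus_mem_slitPlane hc
    exact ⟨(c, b), hc, hb⟩

/-! ### Rotations of a family of planes with constant moment -/

section
variable {ι : Type*} [Fintype ι]

theorem fubiniStudy_add_left (z a a' b : ι → ℂ) :
    fubiniStudy z (a + a') b = fubiniStudy z a b + fubiniStudy z a' b := by
  simp only [fubiniStudy, add_dotProduct, add_mul, add_div, Complex.sub_im, Complex.add_im]
  ring

theorem fubiniStudy_add_right (z a b b' : ι → ℂ) :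
    fubiniStudy z a (b + b') = fubiniStudy z a b + fubiniStudy z a b' := by
  simp only [fubiniStudy, star_add, dotProduct_add, mul_add, add_div, Complex.sub_im,
    Complex.add_im]
  ring

theorem fubiniStudy_neg (z a b : ι → ℂ) : fubiniStudy z a b = -fubiniStudy z b a := by
  have h := fubiniStudy_self z (a + b)
  rw [fubiniStudy_add_left, fubiniStudy_add_right, fubiniStudy_add_right, fubiniStudy_self,
    fubiniStudy_self] at h
  linarith

/-- Torus orbits are isotropic: both terms of the form are real. -/
theorem fubiniStudy_I_mul (z : ι → ℂ) (h k : ι → ℝ) :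
    fubiniStudy z (fun i => Complex.I * h i * z i) (fun i => Complex.I * k i * z i) = 0 := by
  have h1 : dotProduct (fun i => Complex.I * h i * z i) (star fun i => Complex.I * k i * z i)
      = ((∑ i, h i * k i * Complex.normSq (z i) : ℝ) : ℂ) := by
    rw [Complex.ofReal_sum]
    refine Finset.sum_congr rfl fun i _ => ?_
    simp only [Pi.star_apply, star_mul', Complex.star_def, Complex.conj_I, Complex.conj_ofReal,
      Complex.ofReal_mul, ← Complex.mul_conj]
    linear_combination -(h i * k i * z i * (starRingEnd ℂ) (z i) : ℂ) * Complex.I_mul_I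
  have h2 : dotProduct (fun i => Complex.I * h i * z i) (star z)
      = Complex.I * ((∑ i, h i * Complex.normSq (z i) : ℝ) : ℂ) := by
    rw [Complex.ofReal_sum, Finset.mul_sum]
    refine Finset.sum_congr rfl fun i _ => ?_
    simp only [Pi.star_apply, Complex.star_def, Complex.ofReal_mul, ← Complex.mul_conj]
    ring
  have h3 : dotProduct z (star fun i => Complex.I * k i * z i)
      = -Complex.I * ((∑ i, k i * Complex.normSq (z i) : ℝ) : ℂ) := by
    rw [Complex.ofReal_sum, Finset.mul_sum]
    refine Finset.sum_congr rfl fun i _ => ?_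
    simp only [Pi.star_apply, star_mul', Complex.star_def, Complex.conj_I, Complex.conj_ofReal,
      Complex.ofReal_mul, ← Complex.mul_conj]
    ring
  set r := ∑ i, h i * Complex.normSq (z i)
  set s := ∑ i, k i * Complex.normSq (z i)
  have h4 : Complex.I * (r : ℂ) * (-Complex.I * (s : ℂ)) = ((r * s : ℝ) : ℂ) := by
    rw [Complex.ofReal_mul]
    linear_combination -((r : ℂ) * s) * Complex.I_mul_I
  rw [fubiniStudy, h1, h2, h3, h4, dotProduct_star_self_eq]
  rw [← Complex.ofReal_pow, ← Complex.ofReal_div, ← Complex.ofReal_div, ← Complex.ofReal_sub,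
    Complex.ofReal_im, mul_zero]

/-- Up to a unitary factor, rotating the coordinates by phases `h` adds the torus direction i dh(u)
P to the derivative. Torus directions pair to zero among themselves, and with the derivatives of `P`
by the assumption `H`. -/
theorem fubiniStudy_rotate {X : Type*} [NormedAddCommGroup X] [NormedSpace ℝ X]
    {P : X → ι → ℂ} {h : X → ι → ℝ} {x : X} (hP : ContDiffAt ℝ ∞ P x) (hh : ContDiffAt ℝ ∞ h x)
    (H : ∀ u w, fubiniStudy (P x) (fun i => Complex.I * (fderiv ℝ h x u i : ℝ) * P x i)
      (fderiv ℝ P x w) = 0) (u w : X) :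
    fubiniStudy (fun i => Complex.exp (h x i * Complex.I) * P x i)
        (fderiv ℝ (fun y i => Complex.exp (h y i * Complex.I) * P y i) x u)
        (fderiv ℝ (fun y i => Complex.exp (h y i * Complex.I) * P y i) x w)
      = fubiniStudy (P x) (fderiv ℝ P x u) (fderiv ℝ P x w) := by
  have hd := (hP.differentiableAt (by simp : (∞ : WithTop ℕ∞) ≠ 0)).hasFDerivAt
  have hd' := (hh.differentiableAt (by simp : (∞ : WithTop ℕ∞) ≠ 0)).hasFDerivAt
  have key : ∀ u, fderiv ℝ (fun y i => Complex.exp (h y i * Complex.I) * P y i) x u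
      = (fun i => Complex.exp (h x i * Complex.I)) *
        (fderiv ℝ P x u + fun i => Complex.I * (fderiv ℝ h x u i : ℝ) * P x i) := by
    intro u
    have h1 : ∀ i, HasFDerivAt (fun y => Complex.exp (h y i * Complex.I) * P y i) _ x := fun i =>
      (((Complex.ofRealCLM.hasFDerivAt.comp x (hasFDerivAt_pi'.1 hd' i)).mul_const
        Complex.I).cexp).mul (hasFDerivAt_pi'.1 hd i)
    rw [(hasFDerivAt_pi.2 h1).fderiv]
    funext i
    simp
    ring
  rw [key, key]
  refine (fubiniStudy_unitary (fun i => Complex.exp (h x i * Complex.I)) (P x) _ _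
    fun i => Complex.norm_exp_ofReal_mul_I _).trans ?_
  rw [fubiniStudy_add_left, fubiniStudy_add_right, fubiniStudy_add_right, H, fubiniStudy_I_mul,
    fubiniStudy_neg _ (fderiv ℝ P x u) fun i => Complex.I * (fderiv ℝ h x w i : ℝ) * P x i, H]
  ring

end

theorem plucker_rotate (v : Fin n → ℝ) (A : Matrix (Fin n) (Fin 2) ℂ) (I : Pair n) :
    plucker (rotate v A) I = Complex.exp (wt v I * Complex.I) * plucker A I := by
  rw [rotate, plucker_scale, ← Complex.exp_add, wt, Complex.ofReal_add, add_mul]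

/-- By the moment equation a torus direction paired with the velocity of the family is the
derivative of a component of the moment, which is constant here. So the restriction of the form to a
level set does not see a torus-valued change of representatives. -/
theorem grForm_rotate {X : Type*} [NormedAddCommGroup X] [NormedSpace ℝ X]
    {G G' : X → Gr n} {η : X → Fin n → ℝ} {y : X} {m : Fin n → ℝ}
    (hG : ContMDiffAt 𝓘(ℝ, X) 𝓘(ℝ, GrModel n) ∞ G y) (hη : ContDiffAt ℝ ∞ η y)
    (hG' : ∀ᶠ z in 𝓝 y, G' z = torusExp (η z) • G z) (hm : ∀ᶠ z in 𝓝 y, momentMap (G z) = m)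
    (u w : X) :
    grForm n (G' y) (mfderiv 𝓘(ℝ, X) 𝓘(ℝ, GrModel n) G' y u : GrModel n)
        (mfderiv 𝓘(ℝ, X) 𝓘(ℝ, GrModel n) G' y w : GrModel n)
      = grForm n (G y) (mfderiv 𝓘(ℝ, X) 𝓘(ℝ, GrModel n) G y u : GrModel n)
        (mfderiv 𝓘(ℝ, X) 𝓘(ℝ, GrModel n) G y w : GrModel n) := by
  obtain ⟨A₀, hA₀, hF₀⟩ := exists_smoothFrameAt (G y)
  have hA : SmoothFrameAt 𝓘(ℝ, X) (fun z => A₀ (G z)) y := fun i j => (hA₀ i j).comp y hG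
  have hF : ∀ᶠ z in 𝓝 y, IsFrame (A₀ (G z)) (G z) := hG.continuousAt.eventually hF₀
  have hB : SmoothFrameAt 𝓘(ℝ, X) (fun z => rotate (η z) (A₀ (G z))) y :=
    hA.rotate hη.contMDiffAt
  have hF' : ∀ᶠ z in 𝓝 y, IsFrame (rotate (η z) (A₀ (G z))) (G' z) := by
    filter_upwards [hF, hG'] with z hz hz'
    rw [hz']
    exact hz.rotate _
  refine (grForm_mfderiv hB hF' hB hF' rfl rfl u w).trans
    (Eq.trans ?_ (grForm_mfderiv hA hF hA hF rfl rfl u w).symm)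
  have hwt : ContDiff ℝ ∞ (wt (n := n)) := contDiff_pi.2 fun I => by unfold wt; fun_prop
  have hh : ContDiffAt ℝ ∞ (fun z => wt (η z)) y := hwt.contDiffAt.comp y hη
  have hfun : (fun z => plucker (rotate (η z) (A₀ (G z))))
      = fun z I => Complex.exp (wt (η z) I * Complex.I) * plucker (A₀ (G z)) I :=
    funext fun z => funext fun I => plucker_rotate _ _ I
  have hz : plucker (rotate (η y) (A₀ (G y)))
      = fun I => Complex.exp (wt (η y) I * Complex.I) * plucker (A₀ (G y)) I := congrFun hfun y
  rw [hfun, hz]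
  refine fubiniStudy_rotate (P := fun z => plucker (A₀ (G z))) (h := fun z => wt (η z))
    hA.contDiffAt_plucker hh (fun u w => ?_) u w
  have hd : fderiv ℝ (fun z => wt (η z)) y u = wt (fderiv ℝ η y u) := by
    have h1 : ∀ I : Pair n, HasFDerivAt (fun z => wt (η z) I) _ y := fun I =>
      (hasFDerivAt_pi'.1 (hη.differentiableAt (by simp)).hasFDerivAt I.1.1).add
        (hasFDerivAt_pi'.1 (hη.differentiableAt (by simp)).hasFDerivAt I.1.2)
    have h2 : HasFDerivAt (fun z => wt (η z)) _ y := hasFDerivAt_pi.2 h1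
    rw [h2.fderiv]
    funext I
    simp [wt]
  rw [hd, ← fderiv_average _ hA.contDiffAt_plucker (plucker_ne_zero hF.self_of_nhds)]
  have hconst : (fun z => average (wt (fderiv ℝ η y u)) (plucker (A₀ (G z))))
      =ᶠ[𝓝 y] fun _ => ∑ k, fderiv ℝ η y u k * m k := by
    filter_upwards [hF, hm] with z hz hz'
    rw [← sum_mul_momentMap hz, hz']
  rw [hconst.fderiv_eq]
  simp

/-! ### Regular values and stabilisers -/

theorem fderiv_plucker_stretch (v : Fin n → ℝ) (A : Matrix (Fin n) (Fin 2) ℂ) :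
    fderiv ℝ (fun s : ℝ => plucker (scale (fun i => (expUnits (s • v) i : ℂ)) A)) 0 1
      = fun I => (wt v I : ℂ) * plucker A I := by
  have h : HasDerivAt (fun s : ℝ => plucker (scale (fun i => (expUnits (s • v) i : ℂ)) A))
      (fun I => (wt v I : ℂ) * plucker A I) 0 := by
    refine hasDerivAt_pi.2 fun I => ?_
    have h1 : ∀ i, HasDerivAt (fun s : ℝ => (expUnits (s • v) i : ℂ)) (v i : ℂ) 0 := by
      intro i
      have h2 : HasDerivAt (fun s : ℝ => Real.exp (s * v i)) (v i) 0 := by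
        simpa using ((hasDerivAt_id (0 : ℝ)).mul_const (v i)).exp
      exact h2.ofReal_comp
    have h3 := ((h1 I.1.1).mul (h1 I.1.2)).mul_const (plucker A I)
    refine (h3.congr_of_eventuallyEq (Eventually.of_forall fun s => plucker_scale _ _ I)).congr_deriv
      ?_
    simp [wt, expUnits]
  rw [fderiv_apply_one_eq_deriv, h.deriv]

/-- An element of the Lie algebra of the torus whose vector field pairs trivially with its image
under the complex structure has constant weight on the support. -/
theorem exists_wt_eq_of_grForm_eq_zero {p : Gr n} {v : Fin n → ℝ}
    (h : ∀ Y : TangentSpace 𝓘(ℝ, GrModel n) p,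
      grForm n p (fundamentalField (GrModel n) v p) Y = 0) :
    ∃ a : ℝ, ∀ I ∈ supp p, wt v I = a := by
  have hA := isFrame_frame p
  have hs : ContMDiffAt 𝓘(ℝ, ℝ) 𝓘(ℝ, Fin n → ℝ) ∞ (fun s : ℝ => s • v) 0 :=
    (contDiff_id.smul contDiff_const).contMDiff.contMDiffAt
  -- The curve exp(s v) of positive torus elements supplies the test vector: its velocity is, up to
  -- sign, the complex structure applied to the fundamental field, so the form becomes the metric.
  have hB : SmoothFrameAt 𝓘(ℝ, ℝ)
      (fun s : ℝ => scale (fun i => (expUnits (s • v) i : ℂ)) (frame p)) 0 :=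
    SmoothFrameAt.expUnits (A := fun _ : ℝ => frame p) (fun _ _ => contMDiffAt_const) hs
  have hp : expUnits ((0 : ℝ) • v) • p = p := by rw [zero_smul, expUnits_zero, one_smul]
  have h0 : scale (fun i => (expUnits ((0 : ℝ) • v) i : ℂ)) (frame p) = frame p := by
    ext i j
    simp [scale, expUnits]
  have h1 := grForm_mfderiv (G := fun θ : ℝ => torusExp (θ • v) • p)
    (H := fun s : ℝ => expUnits (s • v) • p) (p := p)
    (smoothFrameAt_rotate_line v (frame p) 0) (Eventually.of_forall fun θ => hA.rotate (θ • v))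
    hB (Eventually.of_forall fun s => hA.scale _) (h0.trans (by rw [zero_smul, rotate_zero]))
    (by rw [zero_smul, torusExp_zero, one_smul]) 1 1
  have h2 := h (mfderiv 𝓘(ℝ, ℝ) 𝓘(ℝ, GrModel n) (fun s : ℝ => expUnits (s • v) • p) 0 1 :
    GrModel n)
  have h3 := h1.symm.trans h2
  rw [fderiv_plucker_rotate, fderiv_plucker_stretch, zero_smul, rotate_zero] at h3
  set a : Pair n → ℂ := fun I => (wt v I : ℂ) * plucker (frame p) I with ha
  have h4 : (fun I => Complex.I * wt v I * plucker (frame p) I) = Complex.I • a := by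
    funext I
    simp [ha, mul_assoc]
  rw [h4, fubiniStudy_neg, neg_eq_zero] at h3
  obtain ⟨c, hc⟩ := eq_smul_of_fubiniStudy_I (plucker_ne_zero hA) h3
  refine ⟨c.re, fun I hI => ?_⟩
  have h5 := mul_right_cancel₀ hI (congrFun hc I)
  rw [← h5, Complex.ofReal_re]

theorem mfderiv_sum_mul_momentMap (v : Fin n → ℝ) (p : Gr n) (u : TangentSpace 𝓘(ℝ, GrModel n) p) :
    (mfderiv 𝓘(ℝ, GrModel n) 𝓘(ℝ, ℝ) (fun q : Gr n => ∑ k, v k * momentMap q k) p u : ℝ)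
      = ∑ k, v k * (mfderiv 𝓘(ℝ, GrModel n) 𝓘(ℝ, Fin n → ℝ) (momentMap (n := n)) p u :
        Fin n → ℝ) k := by
  let f : (Fin n → ℝ) →L[ℝ] ℝ := ∑ k, v k • ContinuousLinearMap.proj k
  have hf : ∀ y, f y = ∑ k, v k * y k := fun y => by simp [f]
  have h1 : (fun q : Gr n => ∑ k, v k * momentMap q k) = f ∘ momentMap :=
    funext fun q => (hf _).symm
  have hfm : MDifferentiableAt 𝓘(ℝ, Fin n → ℝ) 𝓘(ℝ, ℝ) f (momentMap p) :=
    f.differentiableAt.mdifferentiableAt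
  rw [h1]
  refine (mfderiv_comp_apply p hfm (contMDiff_momentMap.mdifferentiable (by simp) p) u).trans ?_
  rw [mfderiv_eq_fderiv, f.fderiv]
  exact hf _

/-- The derivative of the moment map, as a linear map. -/
def momentDeriv (p : Gr n) : GrModel n →ₗ[ℝ] Fin n → ℝ :=
  (mfderiv 𝓘(ℝ, GrModel n) 𝓘(ℝ, Fin n → ℝ) (momentMap (n := n)) p :
    GrModel n →L[ℝ] Fin n → ℝ).toLinearMap

theorem grForm_fundamentalField_eq (v : Fin n → ℝ) (p : Gr n) (u : GrModel n) :
    grForm n p (fundamentalField (GrModel n) v p) u = ∑ k, v k * momentDeriv p u k :=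
  ((isHamiltonianAction n).moment v p u).trans (mfderiv_sum_mul_momentMap v p u)

/-- The coordinates of the moment map add up to 2, so the range lies in the vectors with sum zero. A
functional `v` that kills the range has a fundamental field in the kernel of the form; then `wt v`
is constant on the support, rigidity makes `v` constant, and `v` kills all vectors with sum zero. -/
theorem range_momentDeriv {p : Gr n} (hp : IsRigid (supp p)) :
    LinearMap.range (momentDeriv p) = zeroSum n := by
  refine le_antisymm ?_ fun w hw => ?_
  · rintro _ ⟨u, rfl⟩
    have h1 := mfderiv_sum_mul_momentMap 1 p u
    have h2 : (fun q : Gr n => ∑ k, (1 : Fin n → ℝ) k * momentMap q k) = fun _ => 2 := by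
      funext q
      simp [sum_momentMap]
    rw [h2, mfderiv_const] at h1
    rw [mem_zeroSum]
    simp only [Pi.one_apply, one_mul] at h1
    exact h1.symm
  · by_contra hw'
    obtain ⟨f, hfw, hf⟩ := Submodule.exists_le_ker_of_notMem hw'
    set v : Fin n → ℝ := fun k => f (Pi.single k 1) with hv
    have hfv : ∀ y, f y = ∑ k, v k * y k := fun y => by
      conv_lhs => rw [← Finset.univ_sum_single y]
      rw [map_sum]
      refine Finset.sum_congr rfl fun k _ => ?_
      rw [hv, mul_comm, ← smul_eq_mul, ← map_smul, ← Pi.single_smul, smul_eq_mul, mul_one]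
    have h0 : ∀ u : GrModel n, grForm n p (fundamentalField (GrModel n) v p) u = 0 := fun u => by
      rw [grForm_fundamentalField_eq, ← hfv]
      exact hf ⟨u, rfl⟩
    obtain ⟨a, ha⟩ := exists_wt_eq_of_grForm_eq_zero h0
    have hc := hp v a ha
    apply hfw
    rw [hfv]
    rcases isEmpty_or_nonempty (Fin n) with hn | ⟨⟨k₀⟩⟩
    · simp
    · rw [Finset.sum_congr rfl fun k _ => by rw [hc k k₀], ← Finset.mul_sum, mem_zeroSum.1 hw,
        mul_zero]

theorem regular_of_isRigid {p : Gr n} (hp : IsRigid (supp p)) (w : Fin n → ℝ)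
    (hw : w ∈ vectorSpan ℝ (Set.range (momentMap (n := n)))) :
    ∃ u : TangentSpace 𝓘(ℝ, GrModel n) p,
      mfderiv 𝓘(ℝ, GrModel n) 𝓘(ℝ, Fin n → ℝ) (momentMap (n := n)) p u = w := by
  have h1 : w ∈ zeroSum n := vectorSpan_le_zeroSum (by rintro _ ⟨L, rfl⟩; exact sum_momentMap L) hw
  rw [← range_momentDeriv hp] at h1
  exact h1

theorem diagCircle_smul {t : Fin n → Circle} (ht : t ∈ diagCircle n) (p : Gr n) : t • p = p :=
  smul_eq_of_const (t := fun i => Circle.toUnits (t i)) (fun i j => congrArg _ (ht i j)) p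

theorem stabilizer_eq_diagCircle {p : Gr n} (hp : IsRigid (supp p)) :
    MulAction.stabilizer (Fin n → Circle) p = diagCircle n := by
  ext t
  refine ⟨fun h i j => ?_, fun h => diagCircle_smul h p⟩
  have h1 := hp.eq_of_smul_eq (t := fun i => Circle.toUnits (t i)) h i j
  exact Circle.ext (congrArg Units.val h1)

/-! ### The reduced form -/

namespace Slice

variable (c : Slice n) {x : Fin n → ℝ}

theorem contMDiffAt_retract_plane {v : Fin (n - 3) → ℂ} (hv : c.plane v ∈ stable x) :
    ContMDiffAt 𝓘(ℝ, Fin (n - 3) → ℂ) 𝓘(ℝ, GrModel n) ∞ (fun v => retract x (c.plane v)) v :=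
  (contMDiffAt_retract hv).comp v (c.contMDiff_plane v)

theorem contMDiffAt_rep {L : Gr n} (hL : L ∈ c.domain) (hs : L ∈ stable x) :
    ContMDiffAt 𝓘(ℝ, GrModel n) 𝓘(ℝ, GrModel n) ∞ (c.rep x) L :=
  (c.contMDiffAt_retract_plane (c.plane_coords_mem_stable hL hs)).comp L (c.contMDiffAt_coords hL)

theorem coords_retract_plane (v : Fin (n - 3) → ℂ) : c.coords (retract x (c.plane v)) = v := by
  rw [retract, coords_smul, coords_plane]

theorem retract_plane_mem_domain (v : Fin (n - 3) → ℂ) : retract x (c.plane v) ∈ c.domain :=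
  (c.smul_mem_domain_iff _ _).2 (c.plane_mem_domain v)

/-- Replacing the planes of a family in a level set by the representatives of their orbits does not
change the form. -/
theorem grForm_rep {X : Type*} [NormedAddCommGroup X] [NormedSpace ℝ X] {i : X → Gr n} {y : X}
    (hi : ContMDiffAt 𝓘(ℝ, X) 𝓘(ℝ, GrModel n) ∞ i y) (hx : ∀ᶠ z in 𝓝 y, momentMap (i z) = x)
    (hs : i y ∈ stable x) (hc : i y ∈ c.domain) (u w : X) :
    grForm n (c.rep x (i y))
        (mfderiv 𝓘(ℝ, X) 𝓘(ℝ, GrModel n) (fun z => c.rep x (i z)) y u : GrModel n)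
        (mfderiv 𝓘(ℝ, X) 𝓘(ℝ, GrModel n) (fun z => c.rep x (i z)) y w : GrModel n)
      = grForm n (i y) (mfderiv 𝓘(ℝ, X) 𝓘(ℝ, GrModel n) i y u : GrModel n)
        (mfderiv 𝓘(ℝ, X) 𝓘(ℝ, GrModel n) i y w : GrModel n) := by
  have hdom : ∀ᶠ z in 𝓝 y, i z ∈ c.domain ∧ i z ∈ stable x :=
    (hi.continuousAt.eventually (c.isOpen_domain.mem_nhds hc)).and
      (hi.continuousAt.eventually ((isOpen_stable x).mem_nhds hs))
  have hne : ∀ a, c.torus (i y) a ≠ 0 := fun a => c.torus_ne_zero hc a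
  -- A smooth branch of the phases near `y`: the argument at `y` plus the principal argument of a
  -- quotient that equals 1 at `y`, so that the cut is avoided.
  set η : X → Fin n → ℝ := fun z a => Complex.arg (c.torus (i y) a)
    + Complex.arg ((c.torus (i y) a)⁻¹ * c.torus (i z) a) with hη
  have hηs : ContDiffAt ℝ ∞ η y := by
    refine contDiffAt_pi.2 fun a => contDiffAt_const.add ?_
    have h1 : ContDiffAt ℝ ∞ (fun z => (c.torus (i y) a)⁻¹ * c.torus (i z) a) y :=
      contDiffAt_const.mul ((c.contMDiffAt_torus hc a).comp y hi).contDiffAt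
    refine ContDiffAt.comp (g := Complex.arg) y (contDiffAt_arg ?_) h1
    rw [inv_mul_cancel₀ (hne a)]
    exact Complex.one_mem_slitPlane
  refine (grForm_rotate (m := x) ((c.contMDiffAt_rep hc hs).comp y hi) hηs ?_ ?_ u w).symm
  · filter_upwards [hdom, hx] with z hz hzx
    have h1 := c.phase_smul_rep hz.1 hz.2 hzx
    have h2 : phase (c.torusUnits hz.1) = torusExp (η z) := by
      funext a
      have h3 : (c.torus (i y) a)⁻¹ * c.torus (i z) a ≠ 0 :=
        mul_ne_zero (inv_ne_zero (hne a)) (c.torus_ne_zero hz.1 a)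
      simp only [phase, torusUnits, Units.val_mk0, torusExp, hη, Circle.exp_add]
      rw [← exp_arg_mul (hne a) h3, mul_inv_cancel_left₀ (hne a)]
    rw [← h2]
    exact h1.symm
  · filter_upwards [hdom] with z hz
    exact momentMap_retract (c.plane_coords_mem_stable hz.1 hz.2)

theorem smoothFrameAt_retract_plane {v : Fin (n - 3) → ℂ} (hv : c.plane v ∈ stable x) :
    SmoothFrameAt 𝓘(ℝ, Fin (n - 3) → ℂ)
      (fun v => scale (fun a => (expUnits (logScale x (c.plane v)) a : ℂ)) (c.mat v)) v :=
  (c.smoothFrameAt_mat v).expUnits ((contMDiffAt_logScale hv).comp v (c.contMDiff_plane v))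

end Slice

theorem mfderiv_comp_of_eq {X Y : Type*} [NormedAddCommGroup X] [NormedSpace ℝ X]
    [NormedAddCommGroup Y] [NormedSpace ℝ Y] {f : Gr n → Y} {γ : X → Gr n} {y : X} {p : Gr n}
    (hp : γ y = p) (hf : ContMDiffAt 𝓘(ℝ, GrModel n) 𝓘(ℝ, Y) ∞ f p)
    (hγ : ContMDiffAt 𝓘(ℝ, X) 𝓘(ℝ, GrModel n) ∞ γ y) (u : X) :
    (mfderiv 𝓘(ℝ, GrModel n) 𝓘(ℝ, Y) f p
      (mfderiv 𝓘(ℝ, X) 𝓘(ℝ, GrModel n) γ y u : GrModel n) : Y)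
      = fderiv ℝ (fun z => f (γ z)) y u := by
  subst hp
  rw [← mfderiv_eq_fderiv]
  exact (mfderiv_comp_apply y (hf.mdifferentiableAt (by simp)) (hγ.mdifferentiableAt (by simp))
    u).symm

theorem contMDiffAt_torusExp_line (v : Fin n → ℝ) (p : Gr n) :
    ContMDiffAt 𝓘(ℝ, ℝ) 𝓘(ℝ, GrModel n) ∞ (fun θ : ℝ => torusExp (θ • v) • p) 0 :=
  (smoothFrameAt_rotate_line v (frame p) 0).contMDiffAt
    (Eventually.of_forall fun θ => (isFrame_frame p).rotate (θ • v))

/-- The derivative of a family of planes, with values in the model space. -/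
def velocity {X : Type*} [NormedAddCommGroup X] [NormedSpace ℝ X] (G : X → Gr n) (y : X) :
    X →L[ℝ] GrModel n := mfderiv 𝓘(ℝ, X) 𝓘(ℝ, GrModel n) G y

/-- The fundamental vector field of the torus action, with values in the model space. -/
def torusVelocity (η : Fin n → ℝ) (p : Gr n) : GrModel n := fundamentalField (GrModel n) η p

/-- The form of the Grassmann manifold, as a form on the model space. -/
def modelForm (p : Gr n) : LinearMap.BilinForm ℝ (GrModel n) := grForm n p

/-- 4(n - 2) - (n - 1) = 3n - 7, the dimension of the level set. -/
theorem finrank_ker_momentDeriv {p : Gr n} (hn : 3 ≤ n) (hp : IsRigid (supp p)) :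
    Module.finrank ℝ (LinearMap.ker (momentDeriv p)) = 3 * n - 7 := by
  have h1 := LinearMap.finrank_range_add_finrank_ker (momentDeriv p)
  have h2 := finrank_zeroSum_add_one (n := n) (by omega)
  rw [range_momentDeriv hp] at h1
  simp only [GrModel, Module.finrank_pi_fintype, Complex.finrank_real_complex, Finset.sum_const,
    Finset.card_univ, Fintype.card_fin, smul_eq_mul] at h1
  have h3 : Module.finrank ℝ (zeroSum n) + Module.finrank ℝ (LinearMap.ker (momentDeriv p))
    = (n - 2) * (2 * 2) := h1
  omega

namespace Slice

variable (c : Slice n) {x : Fin n → ℝ}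

theorem three_le (c : Slice n) : 3 ≤ n := by
  have h := Fintype.card_congr c.num
  simp only [Fintype.card_option, Fintype.card_sum, Fintype.card_fin] at h
  omega

theorem levelPlane_zero (v : Fin (n - 3) → ℂ) (θ : Fin 2 ⊕ Fin (n - 3) → ℝ) :
    c.levelPlane x 1 (v, θ) = torusExp (c.angle θ) • retract x (c.plane v) := by
  rw [levelPlane, one_smul]

theorem angle_smul (r : ℝ) (θ : Fin 2 ⊕ Fin (n - 3) → ℝ) : c.angle (r • θ) = r • c.angle θ := by
  funext a
  refine c.forall_num (p := fun a => c.angle (r • θ) a = (r • c.angle θ) a) ?_ (fun s => ?_) a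
  · simp [angle_k]
  · simp [angle_num]

/-- The velocities of the families in the level set are the kernel of the derivative of the moment
map. -/
theorem exists_of_momentDeriv_eq_zero (hx : ∀ L, momentMap L = x → L ∈ stable x)
    {v : Fin (n - 3) → ℂ} (hv : c.plane v ∈ stable x) {Y : GrModel n}
    (hY : momentDeriv (retract x (c.plane v)) Y = 0) :
    ∃ w η, Y = velocity (fun v => retract x (c.plane v)) v w
      + torusVelocity η (retract x (c.plane v)) := by
  set p := retract x (c.plane v) with hp
  have hps : p ∈ stable x := (retract_mem_stable_iff _).2 hv
  have h0 : torusExp (c.angle 0) = 1 := by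
    have : c.angle 0 = 0 := by simpa using c.angle_smul 0 0
    rw [this, torusExp_zero]
  have hp0 : c.levelPlane x 1 (v, 0) = p := by rw [levelPlane_zero, h0, one_smul]
  have hy : ((v, 0) : LevelModel n) ∈ (c.levelChart hx 1).target :=
    ⟨hv, fun _ => ⟨neg_lt_zero.2 Real.pi_pos, Real.pi_pos⟩⟩
  have hB := (c.levelChart hx 1).smooth_bwd _ hy
  set D : LevelModel n →L[ℝ] GrModel n := velocity (c.levelPlane x 1) (v, 0) with hD
  have hinj : Function.Injective D := by
    have hsrc := (c.levelChart hx 1).bwd_mem _ hy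
    have hf := (c.levelChart hx 1).smooth_fwd _ hsrc ((c.levelChart hx 1).bwd_prop _ hy)
    refine Function.LeftInverse.injective (g := (mfderiv 𝓘(ℝ, GrModel n) 𝓘(ℝ, LevelModel n)
      (c.levelCoords 1) (c.levelPlane x 1 (v, 0)) : GrModel n → LevelModel n)) fun u => ?_
    refine (mfderiv_comp_of_eq rfl hf hB u).trans ?_
    have h1 : (fun z => c.levelCoords 1 (c.levelPlane x 1 z)) =ᶠ[𝓝 (v, 0)] id := by
      filter_upwards [(c.levelChart hx 1).isOpen_target.mem_nhds hy] with z hz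
      exact (c.levelChart hx 1).fwd_bwd z hz
    refine (DFunLike.congr_fun h1.fderiv_eq u).trans ?_
    rw [fderiv_id]
    rfl
  have hle : LinearMap.range D.toLinearMap ≤ LinearMap.ker (momentDeriv p) := by
    rintro _ ⟨u, rfl⟩
    refine (mfderiv_comp_of_eq hp0 contMDiff_momentMap.contMDiffAt hB u).trans ?_
    have h1 : (fun z => momentMap (c.levelPlane x 1 z)) =ᶠ[𝓝 (v, 0)] fun _ => x := by
      filter_upwards [(c.levelChart hx 1).isOpen_target.mem_nhds hy] with z hz
      exact (c.levelChart hx 1).bwd_prop z hz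
    refine (DFunLike.congr_fun h1.fderiv_eq u).trans ?_
    simp
  -- The chart is an immersion into the level set, so its velocities lie in the kernel, and the two
  -- spaces have the same dimension 3n - 7.
  have heq : LinearMap.range D.toLinearMap = LinearMap.ker (momentDeriv p) := by
    refine Submodule.eq_of_le_of_finrank_eq hle ?_
    rw [finrank_ker_momentDeriv c.three_le (IsInner.isRigid hps),
      LinearMap.finrank_range_of_inj hinj, finrank_levelModel c.three_le]
  obtain ⟨⟨w, θ⟩, hwθ⟩ := heq.ge hY
  refine ⟨w, c.angle θ, ?_⟩
  have hBd := hB.mdifferentiableAt (by simp)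
  -- The two factors of the chart give the slice directions and, below, the torus directions.
  have e1 : D (w, 0) = velocity (fun v => retract x (c.plane v)) v w := by
    have hl : ContDiff ℝ ∞ fun v : Fin (n - 3) → ℂ => ((v, 0) : LevelModel n) :=
      contDiff_id.prodMk contDiff_const
    have h2 := mfderiv_comp_apply (g := c.levelPlane x 1)
      (f := fun v : Fin (n - 3) → ℂ => ((v, 0) : LevelModel n)) v hBd
      (hl.contMDiff.mdifferentiable (by simp) v) w
    have h3 : c.levelPlane x 1 ∘ (fun v : Fin (n - 3) → ℂ => ((v, 0) : LevelModel n))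
        = fun v => retract x (c.plane v) := by
      funext v
      rw [Function.comp_apply, levelPlane_zero, h0, one_smul]
    rw [h3] at h2
    refine Eq.trans ?_ h2.symm
    rw [mfderiv_eq_fderiv]
    have h4 : HasFDerivAt (𝕜 := ℝ) (fun v : Fin (n - 3) → ℂ => ((v, 0) : LevelModel n)) _ v :=
      (hasFDerivAt_id v).prodMk (hasFDerivAt_const _ _)
    rw [h4.fderiv]
    rfl
  have e2 : D (0, θ) = torusVelocity (c.angle θ) p := by
    have hl : ContDiff ℝ ∞ fun r : ℝ => ((v, r • θ) : LevelModel n) :=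
      contDiff_const.prodMk (contDiff_id.smul contDiff_const)
    have hBd' : MDifferentiableAt 𝓘(ℝ, LevelModel n) 𝓘(ℝ, GrModel n) (c.levelPlane x 1)
      ((v, (0 : ℝ) • θ) : LevelModel n) := by rw [zero_smul]; exact hBd
    have h2 := mfderiv_comp_apply (g := c.levelPlane x 1)
      (f := fun r : ℝ => ((v, r • θ) : LevelModel n)) 0 hBd'
      (hl.contMDiff.mdifferentiable (by simp) 0) 1
    have h3 : c.levelPlane x 1 ∘ (fun r : ℝ => ((v, r • θ) : LevelModel n))
        = fun r => torusExp (r • c.angle θ) • p := by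
      funext r
      rw [Function.comp_apply, levelPlane_zero, angle_smul]
    rw [h3] at h2
    refine Eq.trans ?_ h2.symm
    rw [mfderiv_eq_fderiv]
    have h4 : HasFDerivAt (𝕜 := ℝ) (fun r : ℝ => ((v, r • θ) : LevelModel n)) _ 0 :=
      (hasFDerivAt_const v (0 : ℝ)).prodMk ((hasFDerivAt_id (0 : ℝ)).smul_const θ)
    rw [h4.fderiv]
    have h5 : ∀ y, y = ((v, 0) : LevelModel n) → ∀ a, a = ((0, θ) : LevelModel n) →
        velocity (c.levelPlane x 1) (v, 0) (0, θ) = velocity (c.levelPlane x 1) y a := by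
      rintro _ rfl _ rfl
      rfl
    exact h5 _ (by simp) _ (Prod.ext rfl (one_smul ℝ θ))
  rw [← e1, ← e2, ← map_add, Prod.mk_add_mk, add_zero, zero_add]
  exact hwθ.symm

/-- The form is nondegenerate on the families of planes given by the slice. -/
theorem eq_zero_of_grForm_eq_zero (hx : ∀ L, momentMap L = x → L ∈ stable x)
    {v : Fin (n - 3) → ℂ} (hv : c.plane v ∈ stable x) {u : Fin (n - 3) → ℂ}
    (h : ∀ w, modelForm (retract x (c.plane v)) (velocity (fun v => retract x (c.plane v)) v u)
      (velocity (fun v => retract x (c.plane v)) v w) = 0) : u = 0 := by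
  set p := retract x (c.plane v) with hp
  set D := velocity (fun v => retract x (c.plane v)) v with hD
  have hG := c.contMDiffAt_retract_plane hv
  have hanti : ∀ a b, modelForm p a b = -modelForm p b a := fun a b =>
    fubiniStudy_neg _ _ _
  have hDm : ∀ w, momentDeriv p (D w) = 0 := by
    intro w
    refine (mfderiv_comp_of_eq rfl contMDiff_momentMap.contMDiffAt hG w).trans ?_
    have h1 : (fun z => momentMap (retract x (c.plane z))) =ᶠ[𝓝 v] fun _ => x := by
      filter_upwards [((isOpen_stable x).preimage c.contMDiff_plane.continuous).mem_nhds hv]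
        with z hz
      exact momentMap_retract hz
    refine (DFunLike.congr_fun h1.fderiv_eq w).trans ?_
    simp
  let ψ : GrModel n →ₗ[ℝ] ℝ := modelForm p (D u)
  -- Contraction with `D u` vanishes on slice directions by assumption and on torus directions by
  -- the moment equation, hence on ker dμ. So it factors through dμ.
  have hψ : ψ ∈ LinearMap.range (momentDeriv p).dualMap := by
    rw [LinearMap.range_dualMap_eq_dualAnnihilator_ker, Submodule.mem_dualAnnihilator]
    intro Y hY
    obtain ⟨w, η, rfl⟩ := c.exists_of_momentDeriv_eq_zero hx hv hY
    rw [map_add]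
    refine (congrArg₂ (· + ·) (h w) ((hanti _ _).trans (congrArg Neg.neg
      (grForm_fundamentalField_eq η p (D u))))).trans ?_
    rw [hDm]
    simp
  obtain ⟨f, hf⟩ := hψ
  set η : Fin n → ℝ := fun k => f (Pi.single k 1) with hη
  have hfη : ∀ y, f y = ∑ k, η k * y k := fun y => by
    conv_lhs => rw [← Finset.univ_sum_single y]
    rw [map_sum]
    refine Finset.sum_congr rfl fun k _ => ?_
    rw [hη, mul_comm, ← smul_eq_mul, ← map_smul, ← Pi.single_smul, smul_eq_mul, mul_one]
  -- A functional that factors through dμ is the contraction with a fundamental field, so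
  -- nondegeneracy upstairs makes `D u` a torus direction.
  have hX : D u - torusVelocity η p = 0 := by
    refine grForm_nondegenerate p _ fun Y => ?_
    have h1 : modelForm p (torusVelocity η p) Y = modelForm p (D u) Y := by
      refine (grForm_fundamentalField_eq η p Y).trans ?_
      rw [← hfη]
      exact DFunLike.congr_fun hf Y
    change modelForm p (D u - torusVelocity η p) Y = 0
    rw [map_sub, LinearMap.sub_apply, h1, sub_self]
  -- The slice coordinates invert the slice family and are constant on torus orbits: their
  -- derivative sends `D u` to `u` and the torus direction to 0.
  have hco := c.contMDiffAt_coords (c.retract_plane_mem_domain (x := x) v)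
  have e1 : (mfderiv 𝓘(ℝ, GrModel n) 𝓘(ℝ, Fin (n - 3) → ℂ) c.coords p (D u) : Fin (n - 3) → ℂ)
      = u := by
    refine (mfderiv_comp_of_eq (γ := fun v => retract x (c.plane v)) rfl hco hG u).trans ?_
    simp only [coords_retract_plane]
    simp
    rfl
  have e2 : (mfderiv 𝓘(ℝ, GrModel n) 𝓘(ℝ, Fin (n - 3) → ℂ) c.coords p
      (torusVelocity η p) : Fin (n - 3) → ℂ) = 0 := by
    refine (mfderiv_comp_of_eq (γ := fun θ : ℝ => torusExp (θ • η) • p)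
      (by rw [zero_smul, torusExp_zero, one_smul]) hco (contMDiffAt_torusExp_line η p) 1).trans ?_
    have h1 : ∀ θ : ℝ, c.coords (torusExp (θ • η) • p) = c.coords p := fun θ =>
      c.coords_smul (fun a => Circle.toUnits (torusExp (θ • η) a)) p
    simp only [h1]
    simp
    rfl
  exact e1.symm.trans ((congrArg _ (sub_eq_zero.1 hX)).trans e2)

end Slice

/-! ### The symplectic reduction -/

theorem velocity_congr {X : Type*} [NormedAddCommGroup X] [NormedSpace ℝ X] {G G' : X → Gr n} {y : X}
    (h : G =ᶠ[𝓝 y] G') : velocity G y = velocity G' y := h.mfderiv_eq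

/-- The vector space case `Slice.grForm_rep` applied in a chart, whose inverse has a surjective
derivative. -/
theorem Slice.grForm_rep_manifold {EX X : Type*} [NormedAddCommGroup EX] [NormedSpace ℝ EX]
    [TopologicalSpace X] [ChartedSpace EX X] [IsManifold 𝓘(ℝ, EX) ∞ X] (c : Slice n)
    {x : Fin n → ℝ} {i : X → Gr n} (hi : ContMDiff 𝓘(ℝ, EX) 𝓘(ℝ, GrModel n) ∞ i)
    (hx : ∀ z, momentMap (i z) = x) (p : X) (hs : i p ∈ stable x) (hc : i p ∈ c.domain)
    (u w : TangentSpace 𝓘(ℝ, EX) p) :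
    grForm n (c.rep x (i p))
        (mfderiv 𝓘(ℝ, EX) 𝓘(ℝ, GrModel n) (fun z => c.rep x (i z)) p u : GrModel n)
        (mfderiv 𝓘(ℝ, EX) 𝓘(ℝ, GrModel n) (fun z => c.rep x (i z)) p w : GrModel n)
      = grForm n (i p) (mfderiv 𝓘(ℝ, EX) 𝓘(ℝ, GrModel n) i p u : GrModel n)
        (mfderiv 𝓘(ℝ, EX) 𝓘(ℝ, GrModel n) i p w : GrModel n) := by
  obtain ⟨e, he, y, hy, rfl⟩ : ∃ e ∈ atlas EX X, ∃ y ∈ e.target, e.symm y = p :=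
    ⟨chartAt EX p, chart_mem_atlas EX p, chartAt EX p p, mem_chart_target EX p,
      (chartAt EX p).left_inv (mem_chart_source EX p)⟩
  have : IsManifold 𝓘(ℝ, EX) 1 X := IsManifold.of_le (n := ∞) (by simp)
  have hmd := mdifferentiable_of_mem_atlas (I := 𝓘(ℝ, EX)) he
  have hsym : ContMDiffAt 𝓘(ℝ, EX) 𝓘(ℝ, EX) ∞ e.symm y :=
    contMDiffAt_symm_of_mem_maximalAtlas (IsManifold.subset_maximalAtlas he) hy
  obtain ⟨u, rfl⟩ := hmd.symm.mfderiv_surjective hy u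
  obtain ⟨w, rfl⟩ := hmd.symm.mfderiv_surjective hy w
  have hs1 := hsym.mdifferentiableAt (by simp)
  have hi1 := hi.mdifferentiable (by simp) (e.symm y)
  have hr1 := ((c.contMDiffAt_rep hc hs).comp (e.symm y) (hi _)).mdifferentiableAt (by simp)
  refine (congrArg₂ (fun a b : GrModel n => modelForm (c.rep x (i (e.symm y))) a b)
    (mfderiv_comp_apply y hr1 hs1 u).symm (mfderiv_comp_apply y hr1 hs1 w).symm).trans ?_
  refine (c.grForm_rep (i := fun z => i (e.symm z)) ((hi _).comp y hsym)
    (Eventually.of_forall fun z => hx _) hs hc u w).trans ?_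
  exact congrArg₂ (fun a b : GrModel n => modelForm (i (e.symm y)) a b)
    (mfderiv_comp_apply y hi1 hs1 u) (mfderiv_comp_apply y hi1 hs1 w)

section Reduced

variable {S : Set (Set (Pair n))} {x : Fin n → ℝ} (h : IsStableLocus S x) (q₀ : ParameterSpace S)

namespace IsStableLocus

/-- The chart of the orbit space of the level set given by a slice. -/
def redChart (c : Slice n) :
    OpenPartialHomeomorph (ReducedSpace (momentMap (n := n)) x) (Fin (n - 3) → ℂ) :=
  h.homeo.transOpenPartialHomeomorph (paramChart h.isOpen q₀ c)

theorem mem_redChart_source {c : Slice n} {p : LevelSet (momentMap (n := n)) x} :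
    reducedMk momentMap x p ∈ (h.redChart q₀ c).source ↔ p.1 ∈ c.domain :=
  mem_paramChart_source h.isOpen q₀ c

theorem redChart_symm {c : Slice n} {v : Fin (n - 3) → ℂ} (hv : c.plane v ∈ strataUnion S) :
    (h.redChart q₀ c).symm v = reducedMk momentMap x (h.toLevelSet ⟨c.plane v, hv⟩) := by
  refine Eq.trans ?_ (h.homeo_symm_parameterMk ⟨c.plane v, hv⟩)
  exact congrArg h.homeo.symm (paramChart_symm h.isOpen q₀ c hv)

/-- The representatives in the level set of the points of the orbit space. -/
def sectionMap (c : Slice n) (q : ReducedSpace (momentMap (n := n)) x) : Gr n :=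
  retract x (c.plane (h.redChart q₀ c q))

theorem redChart_mem_stable {c : Slice n} {q : ReducedSpace (momentMap (n := n)) x}
    (hq : q ∈ (h.redChart q₀ c).source) : c.plane (h.redChart q₀ c q) ∈ stable x :=
  h.mem_stable ((h.redChart q₀ c).map_source hq)

variable [ChartedSpace (Fin (n - 3) → ℂ) (ReducedSpace (momentMap (n := n)) x)]

/-- The form of the orbit space: the pullback of the form of the Grassmann manifold by a choice of
representatives in the level set. -/
def reducedForm (idx : ReducedSpace (momentMap (n := n)) x → Slice n) :
    FormField (Fin (n - 3) → ℂ) (ReducedSpace (momentMap (n := n)) x) := fun q =>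
  (grForm n (h.sectionMap q₀ (idx q) q)).compl₁₂
    (mfderiv 𝓘(ℝ, Fin (n - 3) → ℂ) 𝓘(ℝ, GrModel n) (h.sectionMap q₀ (idx q)) q).toLinearMap
    (mfderiv 𝓘(ℝ, Fin (n - 3) → ℂ) 𝓘(ℝ, GrModel n) (h.sectionMap q₀ (idx q)) q).toLinearMap

variable [IsManifold 𝓘(ℝ, Fin (n - 3) → ℂ) ∞ (ReducedSpace (momentMap (n := n)) x)]
  (hat : atlas (Fin (n - 3) → ℂ) (ReducedSpace (momentMap (n := n)) x) = Set.range (h.redChart q₀))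
  {idx : ReducedSpace (momentMap (n := n)) x → Slice n}
  (hidx : ∀ q, q ∈ (h.redChart q₀ (idx q)).source)
include hat

theorem redChart_mem_maximalAtlas (c : Slice n) :
    h.redChart q₀ c ∈ IsManifold.maximalAtlas 𝓘(ℝ, Fin (n - 3) → ℂ) ∞
      (ReducedSpace (momentMap (n := n)) x) :=
  IsManifold.subset_maximalAtlas (hat ▸ ⟨c, rfl⟩)

theorem contMDiffAt_redChart {c : Slice n} {q : ReducedSpace (momentMap (n := n)) x}
    (hq : q ∈ (h.redChart q₀ c).source) :
    ContMDiffAt 𝓘(ℝ, Fin (n - 3) → ℂ) 𝓘(ℝ, Fin (n - 3) → ℂ) ∞ (h.redChart q₀ c) q :=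
  contMDiffAt_of_mem_maximalAtlas (h.redChart_mem_maximalAtlas q₀ hat c) hq

theorem contMDiffAt_redChart_symm {c : Slice n} {v : Fin (n - 3) → ℂ}
    (hv : v ∈ (h.redChart q₀ c).target) :
    ContMDiffAt 𝓘(ℝ, Fin (n - 3) → ℂ) 𝓘(ℝ, Fin (n - 3) → ℂ) ∞ (h.redChart q₀ c).symm v :=
  contMDiffAt_symm_of_mem_maximalAtlas (h.redChart_mem_maximalAtlas q₀ hat c) hv

theorem mdifferentiable_redChart (c : Slice n) :
    (h.redChart q₀ c).MDifferentiable 𝓘(ℝ, Fin (n - 3) → ℂ) 𝓘(ℝ, Fin (n - 3) → ℂ) := by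
  have : IsManifold 𝓘(ℝ, Fin (n - 3) → ℂ) 1 (ReducedSpace (momentMap (n := n)) x) :=
    IsManifold.of_le (n := ∞) (by simp)
  exact mdifferentiable_of_mem_atlas (hat ▸ ⟨c, rfl⟩)

theorem contMDiffAt_sectionMap {c : Slice n} {q : ReducedSpace (momentMap (n := n)) x}
    (hq : q ∈ (h.redChart q₀ c).source) :
    ContMDiffAt 𝓘(ℝ, Fin (n - 3) → ℂ) 𝓘(ℝ, GrModel n) ∞ (h.sectionMap q₀ c) q :=
  (c.contMDiffAt_retract_plane (h.redChart_mem_stable q₀ hq)).comp q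
    (h.contMDiffAt_redChart q₀ hat hq)

include hidx

/-- The reduced form in the chart given by a slice. -/
theorem chartCoeff_reducedForm {c : Slice n} {v : Fin (n - 3) → ℂ}
    (hv : c.plane v ∈ strataUnion S) (u w : Fin (n - 3) → ℂ) :
    chartCoeff (h.reducedForm q₀ idx) (h.redChart q₀ c) u w v
      = modelForm (retract x (c.plane v)) (velocity (fun v => retract x (c.plane v)) v u)
        (velocity (fun v => retract x (c.plane v)) v w) := by
  set e := h.redChart q₀ c with he
  set q := e.symm v with hq
  set c' := idx q with hc'
  have hsec := (h.contMDiffAt_sectionMap q₀ hat (hidx q)).mdifferentiableAt (by simp)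
  have hsym := (h.contMDiffAt_redChart_symm q₀ hat (show v ∈ e.target from hv)).mdifferentiableAt
    (by simp)
  have h1 : chartCoeff (h.reducedForm q₀ idx) e u w v
      = modelForm (h.sectionMap q₀ c' q) (velocity (fun z => h.sectionMap q₀ c' (e.symm z)) v u)
        (velocity (fun z => h.sectionMap q₀ c' (e.symm z)) v w) :=
    congrArg₂ (fun a b : GrModel n => modelForm (h.sectionMap q₀ c' q) a b)
      (mfderiv_comp_apply v hsec hsym u).symm (mfderiv_comp_apply v hsec hsym w).symm
  -- The form at each point is defined by the section attached to that point, not by that of `c`.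
  -- The two sections choose representatives of the same orbits in the level set, and `grForm_rep`
  -- shows that the form does not change.
  have h2 : ∀ z, c.plane z ∈ strataUnion S →
      h.sectionMap q₀ c' (e.symm z) = c'.rep x (retract x (c.plane z)) := by
    intro z hz
    rw [he, h.redChart_symm q₀ hz]
    rfl
  have h3 : (fun z => h.sectionMap q₀ c' (e.symm z)) =ᶠ[𝓝 v]
      fun z => c'.rep x (retract x (c.plane z)) := by
    filter_upwards [e.open_target.mem_nhds hv] with z hz
    exact h2 z hz
  have hst : c.plane v ∈ stable x := h.mem_stable hv
  have hdom : retract x (c.plane v) ∈ c'.domain := by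
    have h4 := hidx q
    rw [← hc', hq, he, h.redChart_symm q₀ hv, h.mem_redChart_source] at h4
    exact h4
  rw [h1, velocity_congr h3, hq, h2 v hv]
  refine c'.grForm_rep (c.contMDiffAt_retract_plane hst) ?_
    ((retract_mem_stable_iff _).2 hst) hdom u w
  filter_upwards [e.open_target.mem_nhds hv] with z hz
  exact momentMap_retract (h.mem_stable hz)

/-- In each slice chart the reduced form is a pullback of the Fubini–Study form by a smooth lift, so
smoothness and closedness follow as upstairs. -/
theorem chartCoeff_reducedForm_eq_fubiniStudy {c : Slice n} {v : Fin (n - 3) → ℂ}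
    (hv : c.plane v ∈ strataUnion S) (u w : Fin (n - 3) → ℂ) :
    chartCoeff (h.reducedForm q₀ idx) (h.redChart q₀ c) u w v
      = (fun P : (Fin (n - 3) → ℂ) → Pair n → ℂ =>
        fubiniStudy (P v) (fderiv ℝ P v u) (fderiv ℝ P v w)) (fun v => plucker
          (scale (fun a => (expUnits (logScale x (c.plane v)) a : ℂ)) (c.mat v))) := by
  have hF := c.smoothFrameAt_retract_plane (h.mem_stable hv)
  have hG : ∀ᶠ z in 𝓝 v, IsFrame
      (scale (fun a => (expUnits (logScale x (c.plane z)) a : ℂ)) (c.mat z))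
      (retract x (c.plane z)) := Eventually.of_forall fun z => (c.isFrame_mat z).scale _
  exact (h.chartCoeff_reducedForm q₀ hat hidx hv u w).trans
    (grForm_mfderiv hF hG hF hG rfl rfl u w)

theorem isSymplecticForm_reducedForm : IsSymplecticForm (h.reducedForm q₀ idx) := by
  have hP : ∀ {c : Slice n} {v : Fin (n - 3) → ℂ}, c.plane v ∈ strataUnion S →
      ContDiffAt ℝ ∞ (fun v => plucker
        (scale (fun a => (expUnits (logScale x (c.plane v)) a : ℂ)) (c.mat v))) v :=
    fun {c v} hv => (c.smoothFrameAt_retract_plane (h.mem_stable hv)).contDiffAt_plucker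
  have h0 : ∀ (c : Slice n) (v : Fin (n - 3) → ℂ), plucker
      (scale (fun a => (expUnits (logScale x (c.plane v)) a : ℂ)) (c.mat v)) ≠ 0 := fun c v =>
    plucker_ne_zero ((c.isFrame_mat v).scale _)
  have hev : ∀ {c : Slice n} {v : Fin (n - 3) → ℂ}, c.plane v ∈ strataUnion S →
      ∀ᶠ z in 𝓝 v, c.plane z ∈ strataUnion S := fun {c v} hv =>
    (h.redChart q₀ c).open_target.mem_nhds hv
  refine ⟨fun q u => fubiniStudy_self _ _, ?_, ?_, ?_⟩
  · intro e he u w v hv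
    rw [hat] at he
    obtain ⟨c, rfl⟩ := he
    refine ((contDiffAt_fubiniStudy (hP hv) (h0 c v) u w).congr_of_eventuallyEq
      ?_).contDiffWithinAt
    filter_upwards [hev hv] with z hz
    exact h.chartCoeff_reducedForm_eq_fubiniStudy q₀ hat hidx hz u w
  · intro e he v hv u w t
    rw [hat] at he
    obtain ⟨c, rfl⟩ := he
    have key : ∀ u w, chartCoeff (h.reducedForm q₀ idx) (h.redChart q₀ c) u w =ᶠ[𝓝 v] _ := fun u w =>
      (hev hv).mono fun z hz => h.chartCoeff_reducedForm_eq_fubiniStudy q₀ hat hidx hz u w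
    rw [(key w t).fderiv_eq, (key t u).fderiv_eq, (key u w).fderiv_eq]
    exact fubiniStudy_closed ((hev hv).mono fun z hz => hP hz) (h0 c v) u w t
  · intro q u hu
    set c := idx q with hc
    have hq := hidx q
    rw [← hc] at hq
    have hmd := h.mdifferentiable_redChart q₀ hat c
    have hst := h.redChart_mem_stable q₀ hq
    have hG := (c.contMDiffAt_retract_plane hst).mdifferentiableAt (by simp)
    have hch := (h.contMDiffAt_redChart q₀ hat hq).mdifferentiableAt (by simp)
    have hcomp : ∀ a, (mfderiv 𝓘(ℝ, Fin (n - 3) → ℂ) 𝓘(ℝ, GrModel n) (h.sectionMap q₀ c) q a :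
        GrModel n) = velocity (fun v => retract x (c.plane v)) (h.redChart q₀ c q)
          (mfderiv 𝓘(ℝ, Fin (n - 3) → ℂ) 𝓘(ℝ, Fin (n - 3) → ℂ) (h.redChart q₀ c) q a) := fun a =>
      mfderiv_comp_apply (g := fun v => retract x (c.plane v)) q hG hch a
    have h1 : (mfderiv 𝓘(ℝ, Fin (n - 3) → ℂ) 𝓘(ℝ, Fin (n - 3) → ℂ) (h.redChart q₀ c) q u :
        Fin (n - 3) → ℂ) = 0 := by
      refine c.eq_zero_of_grForm_eq_zero (fun L hL => h.mem_stable (h.mem_of_momentMap_eq L hL))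
        hst fun w => ?_
      obtain ⟨a, rfl⟩ := hmd.mfderiv_surjective hq w
      exact (congrArg₂ (fun a b : GrModel n => modelForm (h.sectionMap q₀ c q) a b)
        (hcomp u).symm (hcomp a).symm).trans (hu a)
    exact hmd.mfderiv_injective hq (h1.trans (map_zero _).symm)

/-! ### The projection from the level set to its orbit space -/

variable {EZ : Type*} [NormedAddCommGroup EZ] [NormedSpace ℝ EZ]
  [ChartedSpace EZ (LevelSet (momentMap (n := n)) x)]
  (hval : ContMDiff 𝓘(ℝ, EZ) 𝓘(ℝ, GrModel n) ∞ (Subtype.val : LevelSet (momentMap (n := n)) x → Gr n))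
include hval

-- In the slice charts the projection is the map of slice coordinates.
omit hidx in
theorem contMDiff_reducedMk :
    ContMDiff 𝓘(ℝ, EZ) 𝓘(ℝ, Fin (n - 3) → ℂ) ∞ (reducedMk (momentMap (n := n)) x) := by
  intro p
  have hps := h.mem_of_momentMap_eq p.1 p.2
  obtain ⟨c, hc⟩ := (h.isRigid hps).exists_slice
  have hsrc := (h.mem_redChart_source q₀).2 hc
  have h1 : ContMDiffAt 𝓘(ℝ, EZ) 𝓘(ℝ, Fin (n - 3) → ℂ) ∞
      (fun p : LevelSet (momentMap (n := n)) x => c.coords p.1) p :=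
    (c.contMDiffAt_coords hc).comp p (hval p)
  have h2 := (h.contMDiffAt_redChart_symm q₀ hat ((h.redChart q₀ c).map_source hsrc)).comp p h1
  refine h2.congr_of_eventuallyEq ?_
  filter_upwards [(c.isOpen_domain.preimage continuous_subtype_val).mem_nhds hc] with p' hp'
  exact ((h.redChart q₀ c).left_inv ((h.mem_redChart_source q₀).2 hp')).symm

/-- The section after the projection is the map `c.rep x`, and replacing planes by their
representatives preserves the form along the level set. -/
theorem reducedForm_mfderiv [IsManifold 𝓘(ℝ, EZ) ∞ (LevelSet (momentMap (n := n)) x)]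
    (p : LevelSet (momentMap (n := n)) x) (u w : TangentSpace 𝓘(ℝ, EZ) p) :
    h.reducedForm q₀ idx (reducedMk momentMap x p)
        (mfderiv 𝓘(ℝ, EZ) 𝓘(ℝ, Fin (n - 3) → ℂ) (reducedMk momentMap x) p u)
        (mfderiv 𝓘(ℝ, EZ) 𝓘(ℝ, Fin (n - 3) → ℂ) (reducedMk momentMap x) p w)
      = grForm n p.1 (mfderiv 𝓘(ℝ, EZ) 𝓘(ℝ, GrModel n) (Subtype.val) p u)
        (mfderiv 𝓘(ℝ, EZ) 𝓘(ℝ, GrModel n) (Subtype.val) p w) := by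
  set q := reducedMk momentMap x p with hq
  set c := idx q with hc
  have hsrc : q ∈ (h.redChart q₀ c).source := hidx q
  have hdom : p.1 ∈ c.domain := (h.mem_redChart_source q₀).1 hsrc
  have hps := h.mem_stable (h.mem_of_momentMap_eq p.1 p.2)
  have hsec := (h.contMDiffAt_sectionMap q₀ hat hsrc).mdifferentiableAt (by simp)
  have hpi := (h.contMDiff_reducedMk q₀ hat hval).mdifferentiable (by simp) p
  refine Eq.trans ?_ (c.grForm_rep_manifold hval (fun z => z.2) p hps hdom u w)
  exact congrArg₂ (fun a b : GrModel n => modelForm (h.sectionMap q₀ c q) a b)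
      (mfderiv_comp_apply p hsec hpi u).symm (mfderiv_comp_apply p hsec hpi w).symm

-- The section of the slice, rotated by the phases of the torus coordinates of `p` so that it passes
-- through `p`. The assumption `hof` supplies the smooth structure of the level set.
omit [ChartedSpace (Fin (n - 3) → ℂ) (ReducedSpace (momentMap (n := n)) x)]
  [IsManifold 𝓘(ℝ, Fin (n - 3) → ℂ) ∞ (ReducedSpace (momentMap (n := n)) x)] hat hidx hval in
theorem exists_local_lift {c : Slice n} {p : LevelSet (momentMap (n := n)) x}
    (hc : p.1 ∈ c.domain)
    (hof : ∀ (G : (Fin (n - 3) → ℂ) → LevelSet (momentMap (n := n)) x) (v : Fin (n - 3) → ℂ),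
      ContMDiffAt 𝓘(ℝ, Fin (n - 3) → ℂ) 𝓘(ℝ, GrModel n) ∞ (fun v => (G v : Gr n)) v →
      ContMDiffAt 𝓘(ℝ, Fin (n - 3) → ℂ) 𝓘(ℝ, EZ) ∞ G v) :
    ∃ G : (Fin (n - 3) → ℂ) → LevelSet (momentMap (n := n)) x,
      G (c.coords p.1) = p ∧
      ContMDiffAt 𝓘(ℝ, Fin (n - 3) → ℂ) 𝓘(ℝ, EZ) ∞ G (c.coords p.1) ∧
      (fun z => reducedMk momentMap x (G z)) =ᶠ[𝓝 (c.coords p.1)] (h.redChart q₀ c).symm := by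
  classical
  have hpS := h.mem_of_momentMap_eq p.1 p.2
  have hps := h.mem_stable hpS
  set b := phase (c.torusUnits hc) with hb
  set v := c.coords p.1 with hv
  have hvt : c.plane v ∈ strataUnion S := h.eq_stable ▸ c.plane_coords_mem_stable hc hps
  obtain ⟨G, hG⟩ : ∃ G : (Fin (n - 3) → ℂ) → LevelSet (momentMap (n := n)) x,
      ∀ z, c.plane z ∈ strataUnion S → (G z : Gr n) = b • retract x (c.plane z) := by
    have hex : ∀ z, ∃ y : LevelSet (momentMap (n := n)) x, c.plane z ∈ strataUnion S →
        (y : Gr n) = b • retract x (c.plane z) := by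
      intro z
      by_cases hz : c.plane z ∈ strataUnion S
      · exact ⟨⟨b • retract x (c.plane z), by
          rw [momentMap_circle_smul, momentMap_retract (h.mem_stable hz)]⟩, fun _ => rfl⟩
      · exact ⟨p, fun hz' => absurd hz' hz⟩
    choose G hG using hex
    exact ⟨G, hG⟩
  have hnear : ∀ᶠ z in 𝓝 v, c.plane z ∈ strataUnion S :=
    (h.isOpen.preimage c.contMDiff_plane.continuous).mem_nhds hvt
  have hGs : ContMDiffAt 𝓘(ℝ, Fin (n - 3) → ℂ) 𝓘(ℝ, EZ) ∞ G v := by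
    refine hof G v ?_
    have h1 : ContMDiffAt 𝓘(ℝ, Fin (n - 3) → ℂ) 𝓘(ℝ, GrModel n) ∞
        (fun z => b • retract x (c.plane z)) v :=
      (contMDiff_circle_smul b).contMDiffAt.comp v
        (c.contMDiffAt_retract_plane (h.mem_stable hvt))
    refine h1.congr_of_eventuallyEq ?_
    filter_upwards [hnear] with z hz
    exact hG z hz
  refine ⟨G, Subtype.ext ((hG v hvt).trans (c.phase_smul_rep hc hps p.2)), hGs, ?_⟩
  filter_upwards [hnear] with z hz
  rw [h.redChart_symm q₀ hz, reducedMk_eq_iff]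
  exact ⟨b, (hG z hz).symm⟩

-- A smooth lift through `p` of an inverse chart makes the projection a submersion there.
omit hidx in
theorem mfderiv_reducedMk_surjective
    (hof : ∀ (G : (Fin (n - 3) → ℂ) → LevelSet (momentMap (n := n)) x) (v : Fin (n - 3) → ℂ),
      ContMDiffAt 𝓘(ℝ, Fin (n - 3) → ℂ) 𝓘(ℝ, GrModel n) ∞ (fun v => (G v : Gr n)) v →
      ContMDiffAt 𝓘(ℝ, Fin (n - 3) → ℂ) 𝓘(ℝ, EZ) ∞ G v)
    (p : LevelSet (momentMap (n := n)) x) :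
    Function.Surjective
      (mfderiv 𝓘(ℝ, EZ) 𝓘(ℝ, Fin (n - 3) → ℂ) (reducedMk (momentMap (n := n)) x) p) := by
  have hpS := h.mem_of_momentMap_eq p.1 p.2
  obtain ⟨c, hc⟩ := (h.isRigid hpS).exists_slice
  have hvS : c.plane (c.coords p.1) ∈ strataUnion S :=
    h.eq_stable ▸ c.plane_coords_mem_stable hc (h.mem_stable hpS)
  have hvt : c.coords p.1 ∈ (h.redChart q₀ c).target := hvS
  obtain ⟨G, hGv, hGs, hcomp⟩ := h.exists_local_lift q₀ hc hof
  set v := c.coords p.1 with hv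
  intro w
  have hsurj : ∀ w : Fin (n - 3) → ℂ, ∃ a : Fin (n - 3) → ℂ,
      (mfderiv 𝓘(ℝ, Fin (n - 3) → ℂ) 𝓘(ℝ, Fin (n - 3) → ℂ) (h.redChart q₀ c).symm v a :
        Fin (n - 3) → ℂ) = w :=
    (h.mdifferentiable_redChart q₀ hat c).symm.mfderiv_surjective hvt
  have hpi := (h.contMDiff_reducedMk q₀ hat hval).mdifferentiable (by simp) (G v)
  have hchain : ∀ a : Fin (n - 3) → ℂ,
      (mfderiv 𝓘(ℝ, Fin (n - 3) → ℂ) 𝓘(ℝ, Fin (n - 3) → ℂ) (h.redChart q₀ c).symm v a :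
        Fin (n - 3) → ℂ)
      = mfderiv 𝓘(ℝ, EZ) 𝓘(ℝ, Fin (n - 3) → ℂ) (reducedMk (momentMap (n := n)) x) (G v)
        (mfderiv 𝓘(ℝ, Fin (n - 3) → ℂ) 𝓘(ℝ, EZ) G v a) := fun a =>
    (DFunLike.congr_fun hcomp.mfderiv_eq.symm a).trans
      (mfderiv_comp_apply v hpi (hGs.mdifferentiableAt (by simp)) a)
  have hfin : ∀ p', p' = p → (∃ u : TangentSpace 𝓘(ℝ, EZ) p',
      (mfderiv 𝓘(ℝ, EZ) 𝓘(ℝ, Fin (n - 3) → ℂ) (reducedMk (momentMap (n := n)) x) p' u :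
        Fin (n - 3) → ℂ) = w) → ∃ u : TangentSpace 𝓘(ℝ, EZ) p,
      (mfderiv 𝓘(ℝ, EZ) 𝓘(ℝ, Fin (n - 3) → ℂ) (reducedMk (momentMap (n := n)) x) p u :
        Fin (n - 3) → ℂ) = w := by
    rintro _ rfl H
    exact H
  refine hfin (G v) hGv ?_
  obtain ⟨a, ha⟩ := hsurj w
  exact ⟨_, (hchain a).symm.trans ha⟩

end IsStableLocus

end Reduced

end SymplecticReduction

end

/-! ### The space of parameters as symplectic reduction at every point of the chamber -/

theorem mainTheorem6 (n : ℕ) (S : Set (Set (Pair n))) (C : Set (Fin n → ℝ))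
    (hC : IsChamber S C) (hdim : Module.finrank ℝ (vectorSpan ℝ C) + 1 = n) :
    ∃ _ : ChartedSpace (Fin (n - 3) → ℂ) (ParameterSpace S),
      IsManifold 𝓘(ℝ, Fin (n - 3) → ℂ) ∞ (ParameterSpace S) ∧
      T2Space (ParameterSpace S) ∧ SecondCountableTopology (ParameterSpace S) ∧
      ∀ x ∈ C,
        ∃ (_ : ChartedSpace (Fin (n - 3) → ℂ) (ReducedSpace (momentMap (n := n)) x))
          (Ωr : FormField (Fin (n - 3) → ℂ) (ReducedSpace (momentMap (n := n)) x)),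
          IsSymplecticReduction (grForm n) momentMap (diagCircle n) x
            (EuclideanSpace ℝ (Fin (3 * n - 7))) (Fin (n - 3) → ℂ) Ωr ∧
          ∃ Φ : ReducedSpace (momentMap (n := n)) x
              ≃ₘ^∞⟮𝓘(ℝ, Fin (n - 3) → ℂ), 𝓘(ℝ, Fin (n - 3) → ℂ)⟯ ParameterSpace S,
            ∀ p : LevelSet (momentMap (n := n)) x, ∃ hp : p.1 ∈ strataUnion S,
              Φ (reducedMk momentMap x p) = parameterMk S ⟨p.1, hp⟩ := by
  have hst : ∀ x ∈ C, IsStableLocus S x := fun x hx =>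
    ⟨Set.ext fun L => hC.mem_iff hdim hx L, fun L hL => hC.mem_of_momentMap_eq hx hL⟩
  obtain ⟨x₀, hx₀⟩ := hC.nonempty
  have h₀ := hst x₀ hx₀
  obtain ⟨L₀, hL₀⟩ := hC.nonempty_strataUnion
  set q₀ : ParameterSpace S := parameterMk S ⟨L₀, hL₀⟩
  -- A slice has three distinguished coordinates, so its existence gives 3 ≤ n and rules out
  -- truncation in `n - 3` and `3 * n - 7`.
  obtain ⟨c₀, -⟩ := (h₀.isRigid hL₀).exists_slice
  have hn : 3 ≤ n := c₀.three_le
  choose idx hidx using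
    exists_mem_paramChart_source h₀.isOpen q₀ fun L hL => h₀.isRigid hL
  let cs : ChartedSpace (Fin (n - 3) → ℂ) (ParameterSpace S) :=
    chartedSpaceOfFamily (paramChart h₀.isOpen q₀) idx hidx
  have hman : IsManifold 𝓘(ℝ, Fin (n - 3) → ℂ) ∞ (ParameterSpace S) :=
    isManifold_of_family _ idx hidx (contDiffAt_paramChart_transition h₀.isOpen q₀)
  -- The point `x₀` only serves to establish topological properties of the space of parameters;
  -- compactness together with the charts gives second countability.
  have hcomp := h₀.compactSpace
  have hsc : SecondCountableTopology (ParameterSpace S) :=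
    ChartedSpace.secondCountable_of_sigmaCompact (Fin (n - 3) → ℂ) (ParameterSpace S)
  have ht2 := h₀.t2Space
  refine ⟨cs, hman, ht2, hsc, fun x hx => ?_⟩
  have h := hst x hx
  have hidx' : ∀ q, q ∈ (h.redChart q₀ (idx (h.homeo q))).source := fun q => hidx (h.homeo q)
  have htr : ∀ a b, ∀ v ∈ ((h.redChart q₀ a).symm.trans (h.redChart q₀ b)).source,
      ContDiffAt ℝ ∞ (fun y => h.redChart q₀ b ((h.redChart q₀ a).symm y)) v := by
    intro a b v hv
    have key : ∀ y, h.homeo ((h.redChart q₀ a).symm y) = (paramChart h.isOpen q₀ a).symm y :=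
      fun y => h.homeo.apply_symm_apply _
    have hv2 : h.homeo ((h.redChart q₀ a).symm v) ∈ (paramChart h.isOpen q₀ b).source := hv.2
    rw [key] at hv2
    refine (contDiffAt_paramChart_transition h.isOpen q₀ a b v ⟨hv.1, hv2⟩).congr_of_eventuallyEq
      (Filter.Eventually.of_forall fun y => ?_)
    exact congrArg (paramChart h.isOpen q₀ b) (key y)
  -- The atlas is transported from the space of parameters, so the homeomorphism is the identity in
  -- corresponding charts and therefore a diffeomorphism.
  let csr : ChartedSpace (Fin (n - 3) → ℂ) (ReducedSpace (momentMap (n := n)) x) :=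
    chartedSpaceOfFamily (h.redChart q₀) (fun q => idx (h.homeo q)) hidx'
  have hmanr : IsManifold 𝓘(ℝ, Fin (n - 3) → ℂ) ∞ (ReducedSpace (momentMap (n := n)) x) :=
    isManifold_of_family _ _ hidx' htr
  have hat : atlas (Fin (n - 3) → ℂ) (ReducedSpace (momentMap (n := n)) x)
      = Set.range (h.redChart q₀) := rfl
  refine ⟨csr, h.reducedForm q₀ fun q => idx (h.homeo q), ?_, ?_⟩
  · have hlev : ∀ L, momentMap L = x → L ∈ stable x := fun L hL =>
      h.mem_stable (h.mem_of_momentMap_eq L hL)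
    refine
      { symplectic := isSymplecticForm_grForm n
        hamiltonian := isHamiltonianAction n
        proper := isProperMap_momentMap
        regular := fun p hp => regular_of_isRigid (IsInner.isRigid (hlev p hp))
        kernel := fun t ht p => diagCircle_smul ht p
        free := fun p hp => stabilizer_eq_diagCircle (IsInner.isRigid (hlev p hp))
        isManifold := hmanr
        t2 := h.homeo.symm.t2Space
        secondCountable := h.homeo.secondCountableTopology
        symplectic_reduced := h.isSymplecticForm_reducedForm q₀ hat hidx'
        pullback := ?_ }
    let p₀ : LevelSet (momentMap (n := n)) x := h.toLevelSet ⟨L₀, hL₀⟩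
    let csz : ChartedSpace (EuclideanSpace ℝ (Fin (3 * n - 7))) (LevelSet (momentMap (n := n)) x) :=
      (levelAtlas hn hlev).chartedSpace p₀
    have hmanz : IsManifold 𝓘(ℝ, EuclideanSpace ℝ (Fin (3 * n - 7))) ∞
        (LevelSet (momentMap (n := n)) x) := (levelAtlas hn hlev).isManifold p₀
    have hval : ContMDiff 𝓘(ℝ, EuclideanSpace ℝ (Fin (3 * n - 7))) 𝓘(ℝ, GrModel n) ∞
        (Subtype.val : LevelSet (momentMap (n := n)) x → Gr n) :=
      (levelAtlas hn hlev).contMDiff_val p₀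
    exact ⟨csz, hmanz, hval, (levelAtlas hn hlev).mfderiv_val_injective p₀,
      h.contMDiff_reducedMk q₀ hat hval,
      h.mfderiv_reducedMk_surjective q₀ hat hval
        fun G v hG => (levelAtlas hn hlev).contMDiffAt_of_val p₀ hG,
      h.reducedForm_mfderiv q₀ hat hidx' hval⟩
  · have hfwd : ContMDiff 𝓘(ℝ, Fin (n - 3) → ℂ) 𝓘(ℝ, Fin (n - 3) → ℂ) ∞ h.homeo := by
      intro q
      set c := idx (h.homeo q)
      have h1 : ContMDiffAt 𝓘(ℝ, Fin (n - 3) → ℂ) 𝓘(ℝ, Fin (n - 3) → ℂ) ∞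
          (paramChart h.isOpen q₀ c).symm (h.redChart q₀ c q) :=
        contMDiffAt_symm_of_mem_maximalAtlas (IsManifold.subset_maximalAtlas ⟨c, rfl⟩)
          ((h.redChart q₀ c).map_source (hidx' q))
      refine (h1.comp q (h.contMDiffAt_redChart q₀ hat (hidx' q))).congr_of_eventuallyEq ?_
      filter_upwards [(h.redChart q₀ c).open_source.mem_nhds (hidx' q)] with r hr
      exact ((paramChart h.isOpen q₀ c).left_inv hr).symm
    have hbwd : ContMDiff 𝓘(ℝ, Fin (n - 3) → ℂ) 𝓘(ℝ, Fin (n - 3) → ℂ) ∞ h.homeo.symm := by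
      intro q
      set c := idx q
      have hq : q ∈ (paramChart h.isOpen q₀ c).source := hidx q
      have h1 : ContMDiffAt 𝓘(ℝ, Fin (n - 3) → ℂ) 𝓘(ℝ, Fin (n - 3) → ℂ) ∞
          (paramChart h.isOpen q₀ c) q :=
        contMDiffAt_of_mem_maximalAtlas (IsManifold.subset_maximalAtlas ⟨c, rfl⟩) hq
      refine ((h.contMDiffAt_redChart_symm q₀ hat
        ((paramChart h.isOpen q₀ c).map_source hq)).comp q h1).congr_of_eventuallyEq ?_
      filter_upwards [(paramChart h.isOpen q₀ c).open_source.mem_nhds hq] with r hr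
      exact (congrArg h.homeo.symm ((paramChart h.isOpen q₀ c).left_inv hr)).symm
    exact ⟨⟨h.homeo.toEquiv, hfwd, hbwd⟩, fun p => ⟨h.mem_of_momentMap_eq p.1 p.2, rfl⟩⟩
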